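/- Let $\Bbbk$ be a field, $G$ an abelian group, and $A=(A,\mu,\eta,\Delta,\varepsilon)$ a bimonoid in the braided monoidal category ${}^{\Bbbk G}_{\Bbbk G}\mathcal{YD}$ of Yetter–Drinfeld modules over $\Bbbk G$ (that is, $G$-graded vector spaces $V=\bigoplus_{h\in G}V_h$ with an action of $G$ preserving each $V_h$, with braiding $c(v\otimes w)=(g\cdot w)\otimes v$ for $v\in V_g$). Let $P_\bullet\xrightarrow{f}A$ be a complex of $A$-bimodules in ${}^{\Bbbk G}_{\Bbbk G}\mathcal{YD}$ which is a projective resolution of $A$ in the category of $A$-bimodules, and suppose that for every $n\ge 0$ there are a finite-dimensional $G$-graded vector space $V_n$ and an isomorphism of $G$-graded $A$-bimodules $P_n\simeq A\otimes V_n\otimes A$. Regard $\Bbbk$ as an $A$-bimodule through $\varepsilon$ and let $C^n=\mathrm{Hom}_{AA}(P_n,\Bbbk)$ be the space of $A$-bimodule maps, with differential $\varphi\mapsto\varphi\circ d$. Then: 1. Each $C^n$ is a Yetter–Drinfeld module, with action $(g\cdot\varphi)(x)=\varphi(g^{-1}\cdot x)$, and with $\varphi$ of degree $h$ if and only if $\varphi$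 vanishes on $(P_n)_s$ for all $s\neq h^{-1}$; the differential of $C^\bullet$ is a morphism of Yetter–Drinfeld modules. 2. The isomorphism $A\simeq A\otimes_A A$ lifts to a chain map of $A$-bimodules $\omega:P_\bullet\to (P\otimes_A P)_\bullet$. For any such $\omega$, let $\varphi\cup\psi=(\varphi\otimes_A\psi)\circ\omega$ be the cup product, and let $\varphi\smallsmile\psi=(-1)^{pq}\,\psi\cup\varphi$, for $\varphi\in C^p$ and $\psi\in C^q$, be the opposite product. Then $(C^\bullet,\smallsmile)$ is a differential graded algebra, associative and unital (with unit $\varepsilon\circ f\in C^0$) up to $\Bbbk$-linear homotopy, and it is graded braided commutative up to $\Bbbk$-linear homotopy: the cochain maps $\smallsmile$ and $\smallsmile\circ\, c^{gr}$ from $C^\bullet\otimes C^\bullet$ to $C^\bullet$ are homotopic as maps of complexes of $\Bbbk$-vector spaces, where $c^{gr}$ is $(-1)^{pq}\,c$ on $C^p\otimes C^q$. Explicitly, $c^{gr}(\varphi\otimes\psi)=(-1)^{pq}\,(h\cdot\psi)\otimes\varphi$ for $\varphi\in C^p$ of degree $h$ and $\psi\in C^q$. -/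

import Mathlib

open scoped TensorProduct
open MulOpposite

set_option linter.unusedSectionVars false

noncomputable section

/-! ## Gradings by a group -/

section Grading

variable {k G V W : Type*} [Field k] [AddCommGroup V] [Module k V] [AddCommGroup W] [Module k W]

/-- `V` is the direct sum of the subspaces `D g`. -/
structure IsGrading (D : G → Submodule k V) : Prop where
  indep : iSupIndep D
  span : ⨆ g, D g = ⊤

/-- The grading of a tensor product: degree `g` is the span of the tensors `v ⊗ w` with `v` of
degree `s`, `w` of degree `t` and `s * t = g`. -/
def tensorDeg [Mul G] (D : G → Submodule k V) (E : G → Submodule k W) (g : G) :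
    Submodule k (V ⊗[k] W) :=
  Submodule.span k {x | ∃ s t v w, s * t = g ∧ v ∈ D s ∧ w ∈ E t ∧ x = v ⊗ₜ[k] w}

open Classical in
/-- The decomposition of a graded space into homogeneous components, `v ↦ ∑ g, [g] v_g`
(this is the coaction of the group algebra). -/
def IsGrading.coact {D : G → Submodule k V} (h : IsGrading D) : V →ₗ[k] (G →₀ V) :=
  (DirectSum.toModule k G (G →₀ V) fun g => (Finsupp.lsingle g).comp (D g).subtype) ∘ₗ
    (LinearEquiv.ofBijective (DirectSum.coeLinearMap D)
      ((DirectSum.isInternal_submodule_iff_iSupIndep_and_iSup_eq_top D).2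
        ⟨h.indep, h.span⟩)).symm.toLinearMap

theorem IsGrading.coact_of_mem {D : G → Submodule k V} (h : IsGrading D) {g : G} {v : V}
    (hv : v ∈ D g) : h.coact v = Finsupp.single g v := by
  classical
  have hb := (DirectSum.isInternal_submodule_iff_iSupIndep_and_iSup_eq_top D).2 ⟨h.indep, h.span⟩
  have : (LinearEquiv.ofBijective (DirectSum.coeLinearMap D) hb).symm v
      = DirectSum.lof k G (fun i => D i) g ⟨v, hv⟩ := by
    rw [LinearEquiv.symm_apply_eq]
    exact (DirectSum.coeLinearMap_lof D g ⟨v, hv⟩).symm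
  simp only [IsGrading.coact, LinearMap.comp_apply, LinearEquiv.coe_coe]
  erw [this]
  simp

theorem iSupIndep_of_coact {D : G → Submodule k V} (Φ : V →ₗ[k] (G →₀ V))
    (hΦ : ∀ g, ∀ v ∈ D g, Φ v = Finsupp.single g v) : iSupIndep D := by
  classical
  intro g
  rw [Submodule.disjoint_def]
  intro x hx hx'
  have hle : (⨆ (j) (_ : j ≠ g), D j) ≤ LinearMap.ker ((Finsupp.lapply g) ∘ₗ Φ) := by
    refine iSup₂_le fun j hj v hv => ?_
    simp [hΦ j v hv, hj]
  have := hle hx'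
  simpa [hΦ g x hx] using this

theorem IsGrading.tensor [Mul G] {D : G → Submodule k V} {E : G → Submodule k W}
    (hD : IsGrading D) (hE : IsGrading E) : IsGrading (tensorDeg D E) := by
  classical
  refine ⟨iSupIndep_of_coact ((Finsupp.lmapDomain (V ⊗[k] W) k fun p : G × G => p.1 * p.2) ∘ₗ
    (finsuppTensorFinsupp k k V W G G).toLinearMap ∘ₗ
      TensorProduct.map hD.coact hE.coact) ?_, ?_⟩
  · intro g x hx
    induction hx using Submodule.span_induction with
    | mem x hx =>
      obtain ⟨s, t, v, w, rfl, hv, hw, rfl⟩ := hx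
      simp [hD.coact_of_mem hv, hE.coact_of_mem hw, Finsupp.mapDomain_single]
    | zero => simp
    | add x y _ _ hx hy => simp only [map_add, hx, hy, Finsupp.single_add]
    | smul c x _ hx => simp only [map_smul, hx, Finsupp.smul_single]
  · rw [eq_top_iff, ← TensorProduct.span_tmul_eq_top, Submodule.span_le]
    rintro _ ⟨v, w, rfl⟩
    have hv : v ∈ ⨆ g, D g := hD.span ▸ Submodule.mem_top
    have hw : w ∈ ⨆ g, E g := hE.span ▸ Submodule.mem_top
    change v ⊗ₜ[k] w ∈ (⨆ g, tensorDeg D E g : Submodule k (V ⊗[k] W))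
    induction hv using Submodule.iSup_induction' with
    | mem s v hv =>
      induction hw using Submodule.iSup_induction' with
      | mem t w hw =>
        exact Submodule.mem_iSup_of_mem (s * t)
          (Submodule.subset_span ⟨s, t, v, w, rfl, hv, hw, rfl⟩)
      | zero => simp
      | add x y _ _ hx hy => rw [TensorProduct.tmul_add]; exact add_mem hx hy
    | zero => simp
    | add x y _ _ hx hy => rw [TensorProduct.add_tmul]; exact add_mem hx hy

end Grading

/-! ## Yetter–Drinfeld modules over a group algebra -/

/-- A (left-left) Yetter–Drinfeld module structure over the group algebra `k[G]` on the vector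
space `V`: an action of `G`, and a `G`-grading (that is, a coaction of `k[G]`) such that
`g • V_h ⊆ V_{g h g⁻¹}`. -/
structure YetterDrinfeld (k G V : Type*) [Field k] [Group G] [AddCommGroup V] [Module k V] where
  act : Representation k G V
  deg : G → Submodule k V
  isGrading : IsGrading deg
  act_mem : ∀ (g h : G) (v : V), v ∈ deg h → act g v ∈ deg (g * h * g⁻¹)

namespace YetterDrinfeld

variable {k G V W : Type*} [Field k] [Group G] [AddCommGroup V] [Module k V]
  [AddCommGroup W] [Module k W]

/-- A linear map is a morphism of Yetter–Drinfeld modules if it commutes with the actions of `G`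
and preserves the degree. -/
structure IsHom (Y : YetterDrinfeld k G V) (Z : YetterDrinfeld k G W) (f : V →ₗ[k] W) : Prop where
  map_act : ∀ g v, f (Y.act g v) = Z.act g (f v)
  map_deg : ∀ g, ∀ v ∈ Y.deg g, f v ∈ Z.deg g

variable (k G) in
/-- The unit object: `k` with trivial action, concentrated in degree `1`. -/
def unit : YetterDrinfeld k G k where
  act := 1
  deg g := ⨆ (_ : g = 1), ⊤
  isGrading := by
    refine ⟨iSupIndep_of_coact (Finsupp.lsingle 1) ?_, ?_⟩
    · intro g v hv
      by_cases h : g = 1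
      · subst h; rfl
      · have : v = 0 := by simpa [h] using hv
        simp [this]
    · simp
  act_mem g h v hv := by
    by_cases h1 : h = 1
    · simp [h1]
    · have : v = 0 := by simpa [h1] using hv
      simp [this]

/-- The tensor product of Yetter–Drinfeld modules: diagonal action, multiplicative degree. -/
def tensor (Y : YetterDrinfeld k G V) (Z : YetterDrinfeld k G W) :
    YetterDrinfeld k G (V ⊗[k] W) where
  act := Y.act.tprod Z.act
  deg := tensorDeg Y.deg Z.deg
  isGrading := Y.isGrading.tensor Z.isGrading
  act_mem g h x hx := by
    induction hx using Submodule.span_induction with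
    | mem x hx =>
      obtain ⟨s, t, v, w, rfl, hv, hw, rfl⟩ := hx
      exact Submodule.subset_span ⟨g * s * g⁻¹, g * t * g⁻¹, Y.act g v, Z.act g w, by group,
        Y.act_mem g s v hv, Z.act_mem g t w hw, by simp⟩
    | zero => simp
    | add x y _ _ hx hy => rw [map_add]; exact add_mem hx hy
    | smul c x _ hx => rw [map_smul]; exact Submodule.smul_mem _ c hx

/-- The braiding `c (v ⊗ w) = ∑ g, (g • w) ⊗ v_g`. -/
def braid (Y : YetterDrinfeld k G V) (Z : YetterDrinfeld k G W) : V ⊗[k] W →ₗ[k] W ⊗[k] V :=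
  TensorProduct.lift ((Finsupp.lsum k fun g : G =>
    ((TensorProduct.mk k W V).compl₁₂ (Z.act g) LinearMap.id).flip) ∘ₗ Y.isGrading.coact)

theorem braid_tmul (Y : YetterDrinfeld k G V) (Z : YetterDrinfeld k G W) {g : G} {v : V}
    (hv : v ∈ Y.deg g) (w : W) : Y.braid Z (v ⊗ₜ w) = Z.act g w ⊗ₜ v := by
  simp [braid, Y.isGrading.coact_of_mem hv]

end YetterDrinfeld

/-- The map `id ⊗ c ⊗ id : (M ⊗ N) ⊗ (K ⊗ L) → (M ⊗ K) ⊗ (N ⊗ L)`, for `c : N ⊗ K → K ⊗ N`. -/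
def middleMap {k : Type*} [Field k] {N K : Type*} (M L : Type*)
    [AddCommGroup M] [Module k M] [AddCommGroup N] [Module k N]
    [AddCommGroup K] [Module k K] [AddCommGroup L] [Module k L] (c : N ⊗[k] K →ₗ[k] K ⊗[k] N) :
    (M ⊗[k] N) ⊗[k] (K ⊗[k] L) →ₗ[k] (M ⊗[k] K) ⊗[k] (N ⊗[k] L) :=
  (TensorProduct.assoc k M K (N ⊗[k] L)).symm.toLinearMap ∘ₗ
    LinearMap.lTensor M ((TensorProduct.assoc k K N L).toLinearMap ∘ₗ
      LinearMap.rTensor L c ∘ₗ (TensorProduct.assoc k N K L).symm.toLinearMap) ∘ₗ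
    (TensorProduct.assoc k M N (K ⊗[k] L)).toLinearMap

/-! ## Bimonoids -/

section Bimonoid

variable {k G A : Type*} [Field k] [Group G] [Ring A] [Algebra k A] [Coalgebra k A]

open Coalgebra in
/-- An algebra and coalgebra `A` with a Yetter–Drinfeld structure is a bimonoid in the braided
category of Yetter–Drinfeld modules: the four structure maps are morphisms of Yetter–Drinfeld
modules, and the comultiplication and the counit are multiplicative and unital, where `A ⊗ A`
has the product `(μ ⊗ μ) ∘ (id ⊗ c ⊗ id)` twisted by the braiding. -/
structure IsBimonoid (Y : YetterDrinfeld k G A) : Prop where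
  mul_hom : (Y.tensor Y).IsHom Y (LinearMap.mul' k A)
  one_hom : (YetterDrinfeld.unit k G).IsHom Y (Algebra.linearMap k A)
  comul_hom : Y.IsHom (Y.tensor Y) comul
  counit_hom : Y.IsHom (YetterDrinfeld.unit k G) counit
  comul_mul : (comul : A →ₗ[k] A ⊗[k] A) ∘ₗ LinearMap.mul' k A =
    TensorProduct.map (LinearMap.mul' k A) (LinearMap.mul' k A) ∘ₗ
      middleMap A A (Y.braid Y) ∘ₗ TensorProduct.map comul comul
  comul_one : comul (R := k) (1 : A) = 1 ⊗ₜ 1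
  counit_mul : ∀ a b : A, counit (R := k) (a * b) = counit (R := k) a * counit (R := k) b
  counit_one : counit (R := k) (1 : A) = 1

end Bimonoid

/-! ## Bimodules -/

section Bimodule

/-- Morphisms of `A`-bimodules over `k`. A bimodule is a vector space with commuting actions of
`A` and of the opposite algebra `Aᵐᵒᵖ`; the right action is `x · a = op a • x`. -/
structure BimodHom (k A M N : Type*) [Field k] [Ring A]
    [AddCommGroup M] [Module k M] [Module A M] [Module Aᵐᵒᵖ M]
    [AddCommGroup N] [Module k N] [Module A N] [Module Aᵐᵒᵖ N] where
  toLin : M →ₗ[k] N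
  map_left : ∀ (a : A) (x : M), toLin (a • x) = a • toLin x
  map_right : ∀ (a : A) (x : M), toLin (op a • x) = op a • toLin x

variable {k A : Type*} [Field k] [Ring A] [Algebra k A]
variable {M N M' N' : Type*}
  [AddCommGroup M] [Module k M] [Module A M] [Module Aᵐᵒᵖ M]
  [AddCommGroup N] [Module k N] [Module A N] [Module Aᵐᵒᵖ N]
  [AddCommGroup M'] [Module k M'] [Module A M'] [Module Aᵐᵒᵖ M']
  [AddCommGroup N'] [Module k N'] [Module A N'] [Module Aᵐᵒᵖ N']

/-- The kernel of `M ⊗ N → M ⊗_A N`. -/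
def balanced (k A M N : Type*) [Field k] [Ring A]
    [AddCommGroup M] [Module k M] [Module Aᵐᵒᵖ M] [AddCommGroup N] [Module k N] [Module A N] :
    Submodule k (M ⊗[k] N) :=
  Submodule.span k {t | ∃ (x : M) (a : A) (y : N), t = (op a • x) ⊗ₜ[k] y - x ⊗ₜ[k] (a • y)}

/-- The tensor product `M ⊗_A N` over the (noncommutative) algebra `A`: the coequalizer of the two
maps `M ⊗ A ⊗ N → M ⊗ N` given by the actions. -/
def TensorOver (k A M N : Type*) [Field k] [Ring A]
    [AddCommGroup M] [Module k M] [Module Aᵐᵒᵖ M] [AddCommGroup N] [Module k N] [Module A N] :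
    Type _ :=
  (M ⊗[k] N) ⧸ balanced k A M N

namespace TensorOver

instance : AddCommGroup (TensorOver k A M N) :=
  inferInstanceAs (AddCommGroup ((M ⊗[k] N) ⧸ balanced k A M N))

instance : Module k (TensorOver k A M N) :=
  inferInstanceAs (Module k ((M ⊗[k] N) ⧸ balanced k A M N))

variable (k A M N) in
/-- The projection `M ⊗ N → M ⊗_A N`. -/
def mk : M ⊗[k] N →ₗ[k] TensorOver k A M N := (balanced k A M N).mkQ

theorem mk_surjective : Function.Surjective (mk k A M N) := Submodule.mkQ_surjective _

theorem mk_balanced (x : M) (a : A) (y : N) :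
    mk k A M N ((op a • x) ⊗ₜ y) = mk k A M N (x ⊗ₜ (a • y)) :=
  (Submodule.Quotient.eq _).2 (Submodule.subset_span ⟨x, a, y, rfl⟩)

/-- A linear map on `M ⊗ N` which is balanced over `A` descends to `M ⊗_A N`. -/
def desc {X : Type*} [AddCommGroup X] [Module k X] (f : M ⊗[k] N →ₗ[k] X)
    (hf : ∀ (x : M) (a : A) (y : N), f ((op a • x) ⊗ₜ y) = f (x ⊗ₜ (a • y))) :
    TensorOver k A M N →ₗ[k] X :=
  (balanced k A M N).liftQ f <| Submodule.span_le.2 <| by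
    rintro _ ⟨x, a, y, rfl⟩
    simp [hf]

@[simp]
theorem desc_mk {X : Type*} [AddCommGroup X] [Module k X] (f : M ⊗[k] N →ₗ[k] X)
    (hf : ∀ (x : M) (a : A) (y : N), f ((op a • x) ⊗ₜ y) = f (x ⊗ₜ (a • y))) (t : M ⊗[k] N) :
    desc f hf (mk k A M N t) = f t :=
  Submodule.liftQ_apply _ _ _

theorem hom_ext {X : Type*} [AddCommGroup X] [Module k X] {f g : TensorOver k A M N →ₗ[k] X}
    (h : ∀ x y, f (mk k A M N (x ⊗ₜ y)) = g (mk k A M N (x ⊗ₜ y))) : f = g := by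
  ext t
  obtain ⟨t, rfl⟩ := mk_surjective t
  exact LinearMap.congr_fun (TensorProduct.ext' (g := f ∘ₗ mk k A M N) (h := g ∘ₗ mk k A M N) h) t

section Actions

variable [IsScalarTower k A M] [SMulCommClass A Aᵐᵒᵖ M]

/-- The left action of `A` on `M ⊗_A N`: `a · (x ⊗ y) = (a · x) ⊗ y`. -/
def leftAct : A →+* Module.End k (TensorOver k A M N) where
  toFun a := desc (mk k A M N ∘ₗ LinearMap.rTensor N (Algebra.lsmul k k M a)) fun x b y => by
    simp only [LinearMap.comp_apply, LinearMap.rTensor_tmul, Algebra.lsmul_coe]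
    rw [smul_comm, mk_balanced]
  map_one' := hom_ext fun x y => by simp
  map_mul' a b := hom_ext fun x y => by simp
  map_zero' := hom_ext fun x y => by simp
  map_add' a b := hom_ext fun x y => by simp

instance : Module A (TensorOver k A M N) := Module.compHom _ (leftAct (k := k) (M := M) (N := N))

theorem smul_mk (a : A) (x : M) (y : N) :
    a • mk k A M N (x ⊗ₜ y) = mk k A M N ((a • x) ⊗ₜ y) := by
  change leftAct a (mk k A M N (x ⊗ₜ y)) = _
  simp [leftAct]

end Actions

section Actions

variable [IsScalarTower k Aᵐᵒᵖ N] [SMulCommClass A Aᵐᵒᵖ N]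

/-- The right action of `A` on `M ⊗_A N`: `(x ⊗ y) · a = x ⊗ (y · a)`. -/
def rightAct : Aᵐᵒᵖ →+* Module.End k (TensorOver k A M N) where
  toFun a := desc (mk k A M N ∘ₗ LinearMap.lTensor M (Algebra.lsmul k k N a)) fun x b y => by
    simp only [LinearMap.comp_apply, LinearMap.lTensor_tmul, Algebra.lsmul_coe]
    rw [mk_balanced, smul_comm]
  map_one' := hom_ext fun x y => by simp
  map_mul' a b := hom_ext fun x y => by simp
  map_zero' := hom_ext fun x y => by simp
  map_add' a b := hom_ext fun x y => by simp

instance : Module Aᵐᵒᵖ (TensorOver k A M N) :=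
  Module.compHom _ (rightAct (k := k) (M := M) (N := N))

theorem op_smul_mk (a : Aᵐᵒᵖ) (x : M) (y : N) :
    a • mk k A M N (x ⊗ₜ y) = mk k A M N (x ⊗ₜ (a • y)) := by
  change rightAct a (mk k A M N (x ⊗ₜ y)) = _
  simp [rightAct]

end Actions

/-- Functoriality: `f ⊗_A g` for bimodule morphisms `f` and `g`. -/
def map (f : BimodHom k A M M') (g : BimodHom k A N N') :
    TensorOver k A M N →ₗ[k] TensorOver k A M' N' :=
  desc (mk k A M' N' ∘ₗ TensorProduct.map f.toLin g.toLin) fun x a y => by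
    simp [f.map_right, g.map_left, mk_balanced]

end TensorOver

/-- The identity morphism of a bimodule. -/
def BimodHom.id : BimodHom k A M M := ⟨LinearMap.id, fun _ _ => rfl, fun _ _ => rfl⟩

/-- `M` is projective in the category of `A`-bimodules, i.e. of modules over `A ⊗ Aᵐᵒᵖ`. -/
def IsProjectiveBimodule (k A M : Type*) [Field k] [Ring A] [Algebra k A]
    [AddCommGroup M] [Module k M] [Module A M] [Module Aᵐᵒᵖ M]
    [IsScalarTower k A M] [IsScalarTower k Aᵐᵒᵖ M] [SMulCommClass A Aᵐᵒᵖ M] : Prop :=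
  letI : Module (A ⊗[k] Aᵐᵒᵖ) M := TensorProduct.Algebra.module
  Module.Projective (A ⊗[k] Aᵐᵒᵖ) M

section YD

variable {G : Type*} [Group G] [IsScalarTower k A M] [IsScalarTower k Aᵐᵒᵖ M]

/-- `M` is an `A`-bimodule in the category of Yetter–Drinfeld modules: both actions
`A ⊗ M → M` and `M ⊗ A → M` are morphisms of Yetter–Drinfeld modules. -/
structure IsYDBimodule (YA : YetterDrinfeld k G A) (YM : YetterDrinfeld k G M) : Prop where
  left_hom : (YA.tensor YM).IsHom YM
    (TensorProduct.lift (Algebra.lsmul k k M : A →ₐ[k] Module.End k M).toLinearMap)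
  right_hom : (YM.tensor YA).IsHom YM
    (TensorProduct.lift ((Algebra.lsmul k k M : Aᵐᵒᵖ →ₐ[k] Module.End k M).toLinearMap ∘ₗ
      (opLinearEquiv k : A ≃ₗ[k] Aᵐᵒᵖ).toLinearMap).flip)

end YD

end Bimodule

/-! ## Bimodule homomorphisms to the trivial bimodule -/

section HomTriv

variable {k A : Type*} [Field k] [Ring A] [Algebra k A] [Coalgebra k A]
variable {M N : Type*}
  [AddCommGroup M] [Module k M] [Module A M] [Module Aᵐᵒᵖ M]
  [AddCommGroup N] [Module k N] [Module A N] [Module Aᵐᵒᵖ N]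

/-- `Hom_{AA}(M, k)`: the space of bimodule morphisms from `M` to `k`, where `A` acts on `k` on
both sides through the counit. -/
def HomTriv (k A M : Type*) [Field k] [Ring A] [Algebra k A] [Coalgebra k A]
    [AddCommGroup M] [Module k M] [Module A M] [Module Aᵐᵒᵖ M] : Submodule k (M →ₗ[k] k) where
  carrier := {f | (∀ (a : A) x, f (a • x) = Coalgebra.counit (R := k) a * f x) ∧
    ∀ (a : A) x, f (op a • x) = f x * Coalgebra.counit (R := k) a}
  add_mem' hf hg := ⟨fun a x => by simp [hf.1, hg.1, mul_add],
    fun a x => by simp [hf.2, hg.2, add_mul]⟩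
  zero_mem' := by simp
  smul_mem' c f hf := ⟨fun a x => by simp [hf.1, mul_left_comm],
    fun a x => by simp [hf.2, mul_assoc]⟩

/-- Precomposition with a bimodule morphism. -/
def HomTriv.precomp (φ : BimodHom k A M N) : HomTriv k A N →ₗ[k] HomTriv k A M :=
  (LinearMap.lcomp k k φ.toLin).restrict fun f hf =>
    ⟨fun a x => by simp [φ.map_left, hf.1], fun a x => by simp [φ.map_right, hf.2]⟩

/-- The map `Hom_{AA}(M, k) ⊗ Hom_{AA}(N, k) → Hom_k(M ⊗_A N, k)`,
`f ⊗ g ↦ f ⊗_A g = (x ⊗ y ↦ f x * g y)`. -/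
def HomTriv.pairing (k A M N : Type*) [Field k] [Ring A] [Algebra k A] [Coalgebra k A]
    [AddCommGroup M] [Module k M] [Module A M] [Module Aᵐᵒᵖ M]
    [AddCommGroup N] [Module k N] [Module A N] [Module Aᵐᵒᵖ N] :
    HomTriv k A M →ₗ[k] HomTriv k A N →ₗ[k] (TensorOver k A M N →ₗ[k] k) :=
  LinearMap.mk₂ k
    (fun f g => TensorOver.desc (LinearMap.mul' k k ∘ₗ TensorProduct.map f.1 g.1) fun x a y => by
      simp [f.2.2, g.2.1, mul_assoc])
    (fun f f' g => TensorOver.hom_ext fun x y => by simp [add_mul])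
    (fun c f g => TensorOver.hom_ext fun x y => by simp [mul_assoc])
    (fun f g g' => TensorOver.hom_ext fun x y => by simp [mul_add])
    (fun c f g => TensorOver.hom_ext fun x y => by simp [mul_left_comm])

/-- The Yetter–Drinfeld structure `Z` on `Hom_{AA}(M, k)` is that of the internal hom:
`(g • f)(x) = g • f(g⁻¹ • x) = f(g⁻¹ • x)`, and `f` has degree `h` if and only if it maps `M_s`
to `k_{h s}` for all `s`, where `k` is concentrated in degree `1`. -/
structure IsInternalHom {G : Type*} [Group G] (Y : YetterDrinfeld k G M)
    (Z : YetterDrinfeld k G (HomTriv k A M)) : Prop where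
  act_apply : ∀ (g : G) (f : HomTriv k A M) (x : M),
    (Z.act g f).1 x = (YetterDrinfeld.unit k G).act g (f.1 (Y.act g⁻¹ x))
  mem_deg : ∀ (h : G) (f : HomTriv k A M),
    f ∈ Z.deg h ↔ ∀ s, ∀ x ∈ Y.deg s, f.1 x ∈ (YetterDrinfeld.unit k G).deg (h * s)

end HomTriv

/-! ## Resolutions -/

section Resolution

variable {k G A : Type*} [Field k] [Group G] [Ring A] [Algebra k A] [Coalgebra k A]
  (YA : YetterDrinfeld k G A)
  (P : ℕ → Type*) [∀ n, AddCommGroup (P n)] [∀ n, Module k (P n)] [∀ n, Module A (P n)]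
  [∀ n, Module Aᵐᵒᵖ (P n)] [∀ n, IsScalarTower k A (P n)] [∀ n, IsScalarTower k Aᵐᵒᵖ (P n)]
  [∀ n, SMulCommClass A Aᵐᵒᵖ (P n)]

/-- A complex `⋯ → P 1 → P 0 → A` of `A`-bimodules in Yetter–Drinfeld modules which is a
projective resolution of `A` in the category of `A`-bimodules. -/
structure YDResolution where
  yd : ∀ n, YetterDrinfeld k G (P n)
  isYDBimodule : ∀ n, IsYDBimodule YA (yd n)
  d : ∀ n, BimodHom k A (P (n + 1)) (P n)
  d_hom : ∀ n, (yd (n + 1)).IsHom (yd n) (d n).toLin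
  aug : BimodHom k A (P 0) A
  aug_hom : (yd 0).IsHom YA aug.toLin
  projective : ∀ n, IsProjectiveBimodule k A (P n)
  exact_d : ∀ n, Function.Exact (d (n + 1)).toLin (d n).toLin
  exact_aug : Function.Exact (d 0).toLin aug.toLin
  aug_surjective : Function.Surjective aug.toLin

variable {YA P}

/-- An isomorphism of `G`-graded `A`-bimodules between `A ⊗ V ⊗ A` and `P n`, where `V` is a
`G`-graded vector space with grading `D`. -/
structure GradedFreeIso (R : YDResolution YA P) (n : ℕ) {V : Type*} [AddCommGroup V] [Module k V]
    (D : G → Submodule k V) where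
  equiv : A ⊗[k] (V ⊗[k] A) ≃ₗ[k] P n
  map_left : ∀ (a b c : A) (v : V), equiv ((a * b) ⊗ₜ (v ⊗ₜ c)) = a • equiv (b ⊗ₜ (v ⊗ₜ c))
  map_right : ∀ (a b c : A) (v : V), equiv (b ⊗ₜ (v ⊗ₜ (c * a))) = op a • equiv (b ⊗ₜ (v ⊗ₜ c))
  map_deg : ∀ (g : G) (t : A ⊗[k] (V ⊗[k] A)),
    t ∈ tensorDeg YA.deg (tensorDeg D YA.deg) g ↔ equiv t ∈ (R.yd n).deg g

/-- A chain map of bimodules `ω : P → P ⊗_A P` lifting the canonical isomorphism `A ≃ A ⊗_A A`;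
`comp p q n` is the component from `P n` to `P p ⊗_A P q`, where `p + q = n`. The differential
of `P ⊗_A P` is `d (x ⊗ y) = d x ⊗ y + (-1) ^ p • x ⊗ d y` for `x` in `P p`. -/
structure Diagonal (R : YDResolution YA P) where
  comp : ∀ p q n, p + q = n → BimodHom k A (P n) (TensorOver k A (P p) (P q))
  comm : ∀ p q n (h : p + q = n) (x : P (n + 1)),
    (comp p q n h).toLin ((R.d n).toLin x) =
      TensorOver.map (R.d p) BimodHom.id ((comp (p + 1) q (n + 1) (by omega)).toLin x) +
      (-1 : k) ^ p •
        TensorOver.map BimodHom.id (R.d q) ((comp p (q + 1) (n + 1) (by omega)).toLin x)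
  lift : ∀ x : P 0, TensorOver.map R.aug R.aug ((comp 0 0 0 rfl).toLin x) =
    TensorOver.mk k A A A (1 ⊗ₜ R.aug.toLin x)

namespace YDResolution

variable (R : YDResolution YA P)

/-- The differential of the cochain complex `Hom_{AA}(P, k)`. -/
def homD (n : ℕ) : HomTriv k A (P n) →ₗ[k] HomTriv k A (P (n + 1)) := HomTriv.precomp (R.d n)

/-- The unit of the cup product, the composition of the counit of `A` with `P 0 → A`. -/
def homOne (hA : IsBimonoid YA) : HomTriv k A (P 0) :=
  ⟨(Coalgebra.counit : A →ₗ[k] k) ∘ₗ R.aug.toLin,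
    fun a x => by simp [R.aug.map_left, hA.counit_mul],
    fun a x => by simp [R.aug.map_right, hA.counit_mul]⟩

variable {R}

/-- The cup product `f ∪ g = (f ⊗_A g) ∘ ω` of `f` in degree `p` and `g` in degree `q`. -/
def cup (ω : Diagonal R) (p q n : ℕ) (h : p + q = n) :
    HomTriv k A (P p) →ₗ[k] HomTriv k A (P q) →ₗ[k] HomTriv k A (P n) :=
  LinearMap.mk₂ k
    (fun f g => ⟨HomTriv.pairing k A (P p) (P q) f g ∘ₗ (ω.comp p q n h).toLin, by
      have hl : ∀ (a : A) (t : TensorOver k A (P p) (P q)),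
          HomTriv.pairing k A (P p) (P q) f g (a • t) =
            Coalgebra.counit (R := k) a * HomTriv.pairing k A (P p) (P q) f g t := by
        intro a t
        obtain ⟨t, rfl⟩ := TensorOver.mk_surjective t
        induction t with
        | zero => simp
        | add x y hx hy => rw [map_add, smul_add, map_add, map_add, hx, hy, mul_add]
        | tmul x y =>
          rw [TensorOver.smul_mk]
          simp [HomTriv.pairing, f.2.1, mul_assoc]
      have hr : ∀ (a : A) (t : TensorOver k A (P p) (P q)),
          HomTriv.pairing k A (P p) (P q) f g (op a • t) =
            HomTriv.pairing k A (P p) (P q) f g t * Coalgebra.counit (R := k) a := by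
        intro a t
        obtain ⟨t, rfl⟩ := TensorOver.mk_surjective t
        induction t with
        | zero => simp
        | add x y hx hy => rw [map_add, smul_add, map_add, map_add, hx, hy, add_mul]
        | tmul x y =>
          rw [TensorOver.op_smul_mk]
          simp [HomTriv.pairing, g.2.2, mul_assoc]
      exact ⟨fun a x => by simp [BimodHom.map_left, hl],
        fun a x => by simp [BimodHom.map_right, hr]⟩⟩)
    (fun f f' g => Subtype.ext <| by ext x; simp)
    (fun c f g => Subtype.ext <| by ext x; simp)
    (fun f g g' => Subtype.ext <| by ext x; simp)
    (fun c f g => Subtype.ext <| by ext x; simp)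

/-- The opposite of the cup product: `f ⊗ g ↦ (-1) ^ (p * q) • g ∪ f` for `f` in degree `p` and
`g` in degree `q`. -/
def opCup (ω : Diagonal R) (p q n : ℕ) (h : p + q = n) :
    HomTriv k A (P p) ⊗[k] HomTriv k A (P q) →ₗ[k] HomTriv k A (P n) :=
  (-1 : k) ^ (p * q) • TensorProduct.lift (cup ω q p n (by omega)).flip

end YDResolution

end Resolution

/-! ## Cochain complexes with a product, up to homotopy -/

section Homotopy

variable {k : Type*} [Field k] {C : ℕ → Type*} [∀ n, AddCommGroup (C n)] [∀ n, Module k (C n)]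
  (d : ∀ n, C n →ₗ[k] C (n + 1))

/-- Two degree-preserving linear maps `f, f' : C → C` are homotopic: `f - f' = d s + s d` for a
linear map `s` of degree `-1`. -/
def Homotopic₁ (f f' : ∀ n, C n →ₗ[k] C n) : Prop :=
  ∃ s : ∀ n, C (n + 1) →ₗ[k] C n,
    f 0 - f' 0 = s 0 ∘ₗ d 0 ∧
    ∀ n, f (n + 1) - f' (n + 1) = d n ∘ₗ s n + s (n + 1) ∘ₗ d (n + 1)

/-- Two degree-preserving linear maps `f, f' : C ⊗ C → C`, given by their components
`C p ⊗ C q → C n` for `p + q = n`, are homotopic: `f - f' = d s + s d` for a linear map `s` of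
degree `-1`, where `d (x ⊗ y) = d x ⊗ y + (-1) ^ p • x ⊗ d y` for `x` in `C p`. -/
def Homotopic₂ (f f' : ∀ p q n, p + q = n → C p ⊗[k] C q →ₗ[k] C n) : Prop :=
  ∃ s : ∀ p q n, p + q = n + 1 → C p ⊗[k] C q →ₗ[k] C n,
    f 0 0 0 rfl - f' 0 0 0 rfl =
      s 1 0 0 rfl ∘ₗ LinearMap.rTensor (C 0) (d 0) +
      s 0 1 0 rfl ∘ₗ LinearMap.lTensor (C 0) (d 0) ∧
    ∀ p q n (h : p + q = n + 1), f p q (n + 1) h - f' p q (n + 1) h =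
      d n ∘ₗ s p q n h +
      s (p + 1) q (n + 1) (by omega) ∘ₗ LinearMap.rTensor (C q) (d p) +
      (-1 : k) ^ p • s p (q + 1) (n + 1) (by omega) ∘ₗ LinearMap.lTensor (C p) (d q)

/-- The analogous notion for degree-preserving linear maps `C ⊗ (C ⊗ C) → C`. -/
def Homotopic₃ (f f' : ∀ p q r n, p + q + r = n → C p ⊗[k] (C q ⊗[k] C r) →ₗ[k] C n) : Prop :=
  ∃ s : ∀ p q r n, p + q + r = n + 1 → C p ⊗[k] (C q ⊗[k] C r) →ₗ[k] C n,
    f 0 0 0 0 rfl - f' 0 0 0 0 rfl =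
      s 1 0 0 0 rfl ∘ₗ LinearMap.rTensor (C 0 ⊗[k] C 0) (d 0) +
      s 0 1 0 0 rfl ∘ₗ LinearMap.lTensor (C 0) (LinearMap.rTensor (C 0) (d 0)) +
      s 0 0 1 0 rfl ∘ₗ LinearMap.lTensor (C 0) (LinearMap.lTensor (C 0) (d 0)) ∧
    ∀ p q r n (h : p + q + r = n + 1), f p q r (n + 1) h - f' p q r (n + 1) h =
      d n ∘ₗ s p q r n h +
      s (p + 1) q r (n + 1) (by omega) ∘ₗ LinearMap.rTensor (C q ⊗[k] C r) (d p) +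
      (-1 : k) ^ p • s p (q + 1) r (n + 1) (by omega) ∘ₗ
        LinearMap.lTensor (C p) (LinearMap.rTensor (C r) (d q)) +
      (-1 : k) ^ (p + q) • s p q (r + 1) (n + 1) (by omega) ∘ₗ
        LinearMap.lTensor (C p) (LinearMap.lTensor (C q) (d r))

/-- `(C, d)` is a cochain complex and `m`, `e` make it a differential graded algebra up to
homotopy: the product `m : C ⊗ C → C` is a cochain map (the Leibniz rule), `e` is a cocycle, and
`m` is unital with unit `e` and associative, up to homotopy. -/
structure IsHomotopyMonoid (m : ∀ p q n, p + q = n → C p ⊗[k] C q →ₗ[k] C n) (e : C 0) :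
    Prop where
  d_comp_d : ∀ n, d (n + 1) ∘ₗ d n = 0
  leibniz : ∀ p q n (h : p + q = n), d n ∘ₗ m p q n h =
    m (p + 1) q (n + 1) (by omega) ∘ₗ LinearMap.rTensor (C q) (d p) +
    (-1 : k) ^ p • m p (q + 1) (n + 1) (by omega) ∘ₗ LinearMap.lTensor (C p) (d q)
  d_one : d 0 e = 0
  one_mul : Homotopic₁ d
    (fun n => m 0 n n (Nat.zero_add n) ∘ₗ TensorProduct.mk k (C 0) (C n) e)
    (fun _ => LinearMap.id)
  mul_one : Homotopic₁ d
    (fun n => m n 0 n (Nat.add_zero n) ∘ₗ (TensorProduct.mk k (C n) (C 0)).flip e)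
    (fun _ => LinearMap.id)
  mul_assoc : Homotopic₃ d
    (fun p q r n h => m (p + q) r n h ∘ₗ LinearMap.rTensor (C r) (m p q (p + q) rfl) ∘ₗ
      (TensorProduct.assoc k (C p) (C q) (C r)).symm.toLinearMap)
    (fun p q r n h => m p (q + r) n (by omega) ∘ₗ
      LinearMap.lTensor (C p) (m q r (q + r) rfl))

/-- The product `m` is graded braided commutative up to `k`-linear homotopy: `m` is homotopic to
`m ∘ c`, where `c` is the graded braiding, equal to `(-1) ^ (p * q)` times the braiding of
Yetter–Drinfeld modules on `C p ⊗ C q`. -/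
def IsBraidedCommUpToHomotopy {G : Type*} [Group G] (Y : ∀ n, YetterDrinfeld k G (C n))
    (m : ∀ p q n, p + q = n → C p ⊗[k] C q →ₗ[k] C n) : Prop :=
  Homotopic₂ d m fun p q n h =>
    (-1 : k) ^ (p * q) • m q p n (by omega) ∘ₗ (Y p).braid (Y q)

end Homotopy

end

/-!
All of the assertions follow from the comparison theorem for complexes of bimodules. Since
`P n ≃ A ⊗ V n ⊗ A`, bimodule maps out of `P` lift through surjections, so that a bimodule map
from `A` lifts to a chain map from `P` to any complex of bimodules that is a resolution, and any
two lifts are homotopic (`YDResolution.exists_chainMap`, `YDResolution.exists_homotopy`). A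
homotopy of bimodule chain maps from `P` to the total complex of a double complex induces, by
pairing cochains, a homotopy of products on `Hom_{AA}(P, k)` (`YDResolution.homotopic₂_precomp`).
Three target complexes are needed; each is exact because its rows are contracted onto a complex
that is known to be exact (`RowContraction.exact`).

* `P ⊗_A P`. The rows are contracted since `P → A` splits by right `A`-linear maps. This gives the
  diagonal `ω` (`YDResolution.nonempty_diagonal`) and the unit laws, as `(id ⊗ aug) ω` and
  `(aug ⊗ id) ω` lift the identity of `A`. It also shows that `ω` may be replaced by `(u ⊗ v) ω`
  for all chain maps `u`, `v` lifting the identity (`Diagonal.homotopic₂_map`).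
* `P ⊗_A (P ⊗_A P)`, where `(id ⊗ ω) ω` and `(ω ⊗ id) ω` are compared. This gives associativity
  (`Diagonal.homotopic₃_opCup`).
* `P ⊗ P`, the tensor product over `k` with `A` acting through its comultiplication and the
  braiding (`TwTensor`). This is a resolution of `A ⊗ A`, and it is responsible for braided
  commutativity.

For the last point, let `ρ : P → P ⊗ A` and `l : P → A ⊗ P` be chain maps of bimodules that lift
the comultiplication of `A`. Then `x ⊗ y ↦ ρ x * l y` and `x ⊗ y ↦ ± l x * ρ y`, where the
products are those of the braided tensor product (`YetterDrinfeld.brMul`), are well defined on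
`P ⊗_A P`, and composed with `ω` they give two chain maps `P → P ⊗ P` that lift the
comultiplication. So these are homotopic (`YDResolution.ComulLift.homotopic₂_diag`). The counit
turns `ρ` and `l` into chain maps `(id ⊗ ε) ρ` and `(ε ⊗ id) l` from `P` to itself that lift the
identity. Paired with `f ⊗ g`, the first product becomes the cup product of `f` and `g` up to
these chain maps, whereas in the second one the degree of `g` acts on `f` and the factors are
exchanged (`HomTriv.twTensor_mulRL`, `HomTriv.twTensor_mulLR`); this is the braiding of the
Yetter–Drinfeld modules of cochains.

The finiteness of `V n` enters through the grading of the cochains: a bimodule map to `k` is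
determined by its values on free generators, which lie in finitely many degrees
(`GradedFreeIso.isGrading`).
-/

noncomputable section

/-! ### Chain maps and homotopies by lifting -/

section Comparison

/-- A sequence can be chosen recursively along a serial relation between consecutive terms. -/
theorem exists_dependent_seq {S : ℕ → Type*} (r : ∀ n, S n → S (n + 1) → Prop)
    (h : ∀ n a, ∃ b, r n a b) (a : S 0) :
    ∃ f : ∀ n, S n, f 0 = a ∧ ∀ n, r n (f n) (f (n + 1)) := by
  choose g hg using h
  exact ⟨fun n => Nat.rec a (fun n x => g n x) n, rfl, fun n => hg n _⟩

variable {k : Type*} [Field k] {P T : ℕ → Type*}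
  [∀ n, AddCommGroup (P n)] [∀ n, Module k (P n)] [∀ n, AddCommGroup (T n)] [∀ n, Module k (T n)]
  (dP : ∀ n, P (n + 1) →ₗ[k] P n) (dT : ∀ n, T (n + 1) →ₗ[k] T n)
  (H : ∀ n m, Submodule k (P n →ₗ[k] T m))

/-- Existence part of the comparison theorem, relative to a class `H` of admissible maps with the
lifting property of a projective source: a map in degree `0` that is compatible with the
augmentations extends to a chain map. -/
theorem exists_chainMap_of_lift
    (hdd : ∀ n x, dP n (dP (n + 1) x) = 0)
    (hcomp : ∀ n m, ∀ f ∈ H n m, f ∘ₗ dP n ∈ H (n + 1) m)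
    (hlift : ∀ n m, ∀ g ∈ H n m, (∀ x, g x ∈ LinearMap.range (dT m)) →
      ∃ h ∈ H n (m + 1), dT m ∘ₗ h = g)
    (hex : ∀ m t, dT m t = 0 → t ∈ LinearMap.range (dT (m + 1)))
    (F₀ : P 0 →ₗ[k] T 0) (hF₀ : F₀ ∈ H 0 0) (h0 : ∀ x, F₀ (dP 0 x) ∈ LinearMap.range (dT 0)) :
    ∃ F : ∀ n, P n →ₗ[k] T n, F 0 = F₀ ∧ (∀ n, F n ∈ H n n) ∧
      ∀ n, dT n ∘ₗ F (n + 1) = F n ∘ₗ dP n := by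
  obtain ⟨F, hF, hF'⟩ := exists_dependent_seq
    (S := fun n => {F : P n →ₗ[k] T n // F ∈ H n n ∧ ∀ x, F (dP n x) ∈ LinearMap.range (dT n)})
    (fun n F F' => dT n ∘ₗ F'.1 = F.1 ∘ₗ dP n) (fun n a => by
      obtain ⟨h, hh, e⟩ := hlift (n + 1) n (a.1 ∘ₗ dP n) (hcomp _ _ _ a.2.1) a.2.2
      refine ⟨⟨h, hh, fun x => hex n _ ?_⟩, e⟩
      have := LinearMap.congr_fun e (dP (n + 1) x)
      simpa [hdd] using this) ⟨F₀, hF₀, h0⟩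
  exact ⟨fun n => (F n).1, congrArg Subtype.val hF, fun n => (F n).2.1, hF'⟩

/-- Uniqueness part of the comparison theorem, relative to a class `H` of admissible maps: a chain
map to an exact complex that vanishes on the homology in degree `0` is null-homotopic. -/
theorem exists_homotopy_of_lift
    (hdd : ∀ n x, dP n (dP (n + 1) x) = 0)
    (hcomp : ∀ n m, ∀ f ∈ H n m, f ∘ₗ dP n ∈ H (n + 1) m)
    (hlift : ∀ n m, ∀ g ∈ H n m, (∀ x, g x ∈ LinearMap.range (dT m)) →
      ∃ h ∈ H n (m + 1), dT m ∘ₗ h = g)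
    (hex : ∀ m t, dT m t = 0 → t ∈ LinearMap.range (dT (m + 1)))
    (F : ∀ n, P n →ₗ[k] T n) (hF : ∀ n, F n ∈ H n n)
    (hd : ∀ n x, dT n (F (n + 1) x) = F n (dP n x)) (h0 : ∀ x, F 0 x ∈ LinearMap.range (dT 0)) :
    ∃ h : ∀ n, P n →ₗ[k] T (n + 1), (∀ n, h n ∈ H n (n + 1)) ∧ (∀ x, F 0 x = dT 0 (h 0 x)) ∧
      ∀ n x, F (n + 1) x = dT (n + 1) (h (n + 1) x) + h n (dP n x) := by
  obtain ⟨h₀, hh₀, e₀⟩ := hlift 0 0 (F 0) (hF 0) h0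
  obtain ⟨h, hh, hh'⟩ := exists_dependent_seq
    (S := fun n => {h : P n →ₗ[k] T (n + 1) // h ∈ H n (n + 1) ∧
      ∀ x, F (n + 1) x - h (dP n x) ∈ LinearMap.range (dT (n + 1))})
    (fun n a b => ∀ x, F (n + 1) x = dT (n + 1) (b.1 x) + a.1 (dP n x)) (fun n a => by
      obtain ⟨h, hh, e⟩ := hlift (n + 1) (n + 1) (F (n + 1) - a.1 ∘ₗ dP n)
        (sub_mem (hF _) (hcomp _ _ _ a.2.1)) (fun x => by simpa using a.2.2 x)
      have e' : ∀ x, dT (n + 1) (h x) = F (n + 1) x - a.1 (dP n x) := LinearMap.congr_fun e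
      refine ⟨⟨h, hh, fun x => hex _ _ ?_⟩, fun x => by simp [e']⟩
      simp [e', hd, hdd]) ⟨h₀, hh₀, fun x => hex _ _ (by
        have := LinearMap.congr_fun e₀ (dP 0 x)
        simp only [LinearMap.comp_apply] at this
        simp [this, hd])⟩
  refine ⟨fun n => (h n).1, fun n => (h n).2.1, fun x => ?_, hh'⟩
  change F 0 x = dT 0 ((h 0).1 x)
  rw [hh]
  exact (LinearMap.congr_fun e₀ x).symm

end Comparison

/-! ### Total complexes of double complexes -/

section Total

variable {k A : Type*} [Field k] [Ring A] [Algebra k A]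

/-- The degree `n` part of the total complex of a double complex, as a finite product. -/
abbrev Tot (X : ℕ → ℕ → Type*) (n : ℕ) : Type _ :=
  ∀ i : {i : ℕ × ℕ // i.1 + i.2 = n}, X i.1.1 i.1.2

variable {X : ℕ → ℕ → Type*} [∀ p q, AddCommGroup (X p q)] [∀ p q, Module k (X p q)]

/-- The differential of the total complex: `d₁ + (-1) ^ p • d₂`, where `d₁` lowers the first index
`p` and `d₂` the second. -/
def totD (d₁ : ∀ p q, X (p + 1) q →ₗ[k] X p q) (d₂ : ∀ p q, X p (q + 1) →ₗ[k] X p q) (n : ℕ) :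
    Tot X (n + 1) →ₗ[k] Tot X n :=
  LinearMap.pi fun i =>
    d₁ i.1.1 i.1.2 ∘ₗ LinearMap.proj
      (⟨(i.1.1 + 1, i.1.2), by have := i.2; omega⟩ : {i : ℕ × ℕ // i.1 + i.2 = n + 1}) +
    (-1 : k) ^ i.1.1 • d₂ i.1.1 i.1.2 ∘ₗ LinearMap.proj
      (⟨(i.1.1, i.1.2 + 1), by have := i.2; omega⟩ : {i : ℕ × ℕ // i.1 + i.2 = n + 1})

theorem totD_apply (d₁ : ∀ p q, X (p + 1) q →ₗ[k] X p q) (d₂ : ∀ p q, X p (q + 1) →ₗ[k] X p q)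
    {n : ℕ} (t : Tot X (n + 1)) (p q : ℕ) (h : p + q = n) :
    totD d₁ d₂ n t ⟨(p, q), h⟩ = d₁ p q (t ⟨(p + 1, q), by omega⟩) +
      (-1 : k) ^ p • d₂ p q (t ⟨(p, q + 1), by omega⟩) := rfl

variable {Y : ℕ → Type*} [∀ q, AddCommGroup (Y q)] [∀ q, Module k (Y q)]
  {Z : Type*} [AddCommGroup Z] [Module k Z]

/-- A double complex whose rows are contracted, compatibly with the vertical differential, onto a
column `Y`. -/
structure RowContraction (d₁ : ∀ p q, X (p + 1) q →ₗ[k] X p q)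
    (d₂ : ∀ p q, X p (q + 1) →ₗ[k] X p q) (dY : ∀ q, Y (q + 1) →ₗ[k] Y q) where
  e : ∀ q, X 0 q →ₗ[k] Y q
  u : ∀ q, Y q →ₗ[k] X 0 q
  s : ∀ p q, X p q →ₗ[k] X (p + 1) q
  e_d₁ : ∀ q x, e q (d₁ 0 q x) = 0
  e_d₂ : ∀ q x, e q (d₂ 0 q x) = dY q (e (q + 1) x)
  u_d : ∀ q y, u q (dY q y) = d₂ 0 q (u (q + 1) y)
  s_d₂ : ∀ p q x, s p q (d₂ p q x) = d₂ (p + 1) q (s p (q + 1) x)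
  ds_zero : ∀ q x, d₁ 0 q (s 0 q x) + u q (e q x) = x
  ds_succ : ∀ p q x, d₁ (p + 1) q (s (p + 1) q x) + s p q (d₁ p q x) = x

namespace RowContraction

variable {d₁ : ∀ p q, X (p + 1) q →ₗ[k] X p q} {d₂ : ∀ p q, X p (q + 1) →ₗ[k] X p q}
  {dY : ∀ q, Y (q + 1) →ₗ[k] Y q}

/-- If `Y` is exact, then so is the total complex: a preimage of a cycle `t` has components `s t`
outside of the column `p = 0`, and in that column `u z`, where `z` is a preimage of `e t` in `Y`. -/
theorem exact (c : RowContraction d₁ d₂ dY)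
    (hY : ∀ m y, dY m y = 0 → y ∈ LinearMap.range (dY (m + 1)))
    (n : ℕ) (t : Tot X (n + 1)) (ht : totD d₁ d₂ n t = 0) :
    t ∈ LinearMap.range (totD d₁ d₂ (n + 1)) := by
  have ht' : ∀ p q (h : p + q = n), d₁ p q (t ⟨(p + 1, q), by omega⟩) =
      -((-1 : k) ^ p • d₂ p q (t ⟨(p, q + 1), by omega⟩)) := fun p q h => by
    rw [eq_neg_iff_add_eq_zero, ← totD_apply d₁ d₂ t p q h, ht]; rfl
  obtain ⟨z, hz⟩ := hY n (c.e (n + 1) (t ⟨(0, n + 1), by omega⟩)) <| by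
    have h := congrArg (c.e n) (ht' 0 n (by omega))
    rw [c.e_d₁] at h
    simpa [c.e_d₂] using h.symm
  -- the index `q` of the match below is only propositionally equal to `n + 2`
  let z' : ∀ q, q = n + 2 → Y q := fun q h => h ▸ z
  refine ⟨fun i => match i with
    | ⟨(0, q), h⟩ => c.u q (z' q (by simpa using h))
    | ⟨(p + 1, q), h⟩ => c.s p q (t ⟨(p, q), by simp at h; omega⟩), ?_⟩
  funext ⟨⟨p, q⟩, h⟩
  rw [totD_apply]
  match p, q, h with
  | 0, q, h =>
    obtain rfl : q = n + 1 := by simpa using h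
    change d₁ 0 _ (c.s 0 _ _) + _ • d₂ 0 _ (c.u _ z) = _
    rw [pow_zero, one_smul, ← c.u_d, hz, c.ds_zero]
  | p + 1, q, h =>
    change d₁ (p + 1) _ (c.s (p + 1) _ _) + _ • d₂ (p + 1) _ (c.s p _ _) = _
    have e := c.ds_succ p q (t ⟨(p + 1, q), h⟩)
    rw [ht' p q (by simp at h; omega)] at e
    rw [← c.s_d₂, pow_succ]
    simpa using e

theorem exact_zero (c : RowContraction d₁ d₂ dY) (eZ : Y 0 →ₗ[k] Z)
    (hY : ∀ y, eZ y = 0 → y ∈ LinearMap.range (dY 0))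
    (t : Tot X 0) (ht : eZ (c.e 0 (t ⟨(0, 0), rfl⟩)) = 0) :
    t ∈ LinearMap.range (totD d₁ d₂ 0) := by
  obtain ⟨z, hz⟩ := hY _ ht
  let z' : ∀ q, q = 1 → Y q := fun q h => h ▸ z
  refine ⟨fun i => match i with
    | ⟨(0, q), h⟩ => c.u q (z' q (by simpa using h))
    | ⟨(p + 1, q), h⟩ => c.s p q (t ⟨(p, q), by simp at h; omega⟩), ?_⟩
  funext ⟨⟨p, q⟩, h⟩
  rw [totD_apply]
  obtain ⟨rfl, rfl⟩ : p = 0 ∧ q = 0 := by simpa using h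
  change d₁ 0 _ (c.s 0 _ _) + _ • d₂ 0 _ (c.u _ z) = _
  rw [pow_zero, one_smul, ← c.u_d, hz, c.ds_zero]

end RowContraction

end Total

/-! ### Bimodule maps and tensor products over `A` -/

section BimodMaps

/-- The space of `A`-bimodule maps, as a subspace of the linear maps. -/
def bimodMaps (k A M N : Type*) [Field k] [Ring A] [Algebra k A]
    [AddCommGroup M] [Module k M] [Module A M] [Module Aᵐᵒᵖ M]
    [AddCommGroup N] [Module k N] [Module A N] [Module Aᵐᵒᵖ N]
    [IsScalarTower k A N] [IsScalarTower k Aᵐᵒᵖ N] : Submodule k (M →ₗ[k] N) where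
  carrier := {f | (∀ (a : A) x, f (a • x) = a • f x) ∧ ∀ (a : A) x, f (op a • x) = op a • f x}
  add_mem' hf hg := ⟨fun a x => by simp [hf.1, hg.1], fun a x => by simp [hf.2, hg.2]⟩
  zero_mem' := by simp
  smul_mem' c f hf := ⟨fun a x => by simp [hf.1, smul_comm a c],
    fun a x => by simp [hf.2, smul_comm (op a) c]⟩

/-- The space of right `A`-linear maps, as a subspace of the linear maps. -/
def rightMaps (k A M N : Type*) [Field k] [Ring A] [Algebra k A]
    [AddCommGroup M] [Module k M] [Module Aᵐᵒᵖ M]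
    [AddCommGroup N] [Module k N] [Module Aᵐᵒᵖ N]
    [IsScalarTower k Aᵐᵒᵖ N] : Submodule k (M →ₗ[k] N) where
  carrier := {f | ∀ (a : A) x, f (op a • x) = op a • f x}
  add_mem' hf hg := fun a x => by simp [hf a, hg a]
  zero_mem' := by simp
  smul_mem' c f hf := fun a x => by simp [hf a, smul_comm (op a) c]

variable {k A M N : Type*} [Field k] [Ring A] [Algebra k A]
    [AddCommGroup M] [Module k M] [Module A M] [Module Aᵐᵒᵖ M]
    [AddCommGroup N] [Module k N] [Module A N] [Module Aᵐᵒᵖ N]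
    [IsScalarTower k A N] [IsScalarTower k Aᵐᵒᵖ N]

theorem BimodHom.toLin_mem (f : BimodHom k A M N) : f.toLin ∈ bimodMaps k A M N :=
  ⟨f.map_left, f.map_right⟩

/-- The bimodule morphism underlying an element of `bimodMaps`. -/
def bimodHomOfMem {f : M →ₗ[k] N} (hf : f ∈ bimodMaps k A M N) : BimodHom k A M N :=
  ⟨f, hf.1, hf.2⟩

/-- The composition of bimodule morphisms. -/
def BimodHom.comp {L : Type*} [AddCommGroup L] [Module k L] [Module A L] [Module Aᵐᵒᵖ L]
    (g : BimodHom k A M N) (f : BimodHom k A L M) : BimodHom k A L N :=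
  ⟨g.toLin ∘ₗ f.toLin, fun a x => by simp [f.map_left, g.map_left],
    fun a x => by simp [f.map_right, g.map_right]⟩

end BimodMaps

namespace TensorOver

variable {k A : Type*} [Field k] [Ring A] [Algebra k A]
variable {M N M' N' L : Type*}
  [AddCommGroup M] [Module k M] [Module A M] [Module Aᵐᵒᵖ M]
  [AddCommGroup N] [Module k N] [Module A N] [Module Aᵐᵒᵖ N]
  [AddCommGroup M'] [Module k M'] [Module A M'] [Module Aᵐᵒᵖ M']
  [AddCommGroup N'] [Module k N'] [Module A N'] [Module Aᵐᵒᵖ N']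
  [AddCommGroup L] [Module k L] [Module A L] [Module Aᵐᵒᵖ L]

theorem induction {p : TensorOver k A M N → Prop} (t : TensorOver k A M N)
    (tmul : ∀ x y, p (mk k A M N (x ⊗ₜ y))) (add : ∀ s t, p s → p t → p (s + t)) : p t := by
  obtain ⟨t, rfl⟩ := mk_surjective t
  induction t with
  | zero => simpa using tmul 0 0
  | add x y hx hy => rw [map_add]; exact add _ _ hx hy
  | tmul x y => exact tmul x y

instance [IsScalarTower k A M] [SMulCommClass A Aᵐᵒᵖ M] :
    IsScalarTower k A (TensorOver k A M N) where
  smul_assoc c a t := by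
    induction t using TensorOver.induction with
    | tmul x y =>
      rw [smul_mk, smul_mk, smul_assoc, ← map_smul, TensorProduct.smul_tmul']
    | add s t hs ht => rw [smul_add, smul_add, smul_add, hs, ht]

instance [IsScalarTower k Aᵐᵒᵖ N] [SMulCommClass A Aᵐᵒᵖ N] :
    IsScalarTower k Aᵐᵒᵖ (TensorOver k A M N) where
  smul_assoc c a t := by
    induction t using TensorOver.induction with
    | tmul x y =>
      rw [op_smul_mk, op_smul_mk, smul_assoc, ← map_smul, TensorProduct.tmul_smul]
    | add s t hs ht => rw [smul_add, smul_add, smul_add, hs, ht]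

instance [IsScalarTower k A M] [SMulCommClass A Aᵐᵒᵖ M]
    [IsScalarTower k Aᵐᵒᵖ N] [SMulCommClass A Aᵐᵒᵖ N] :
    SMulCommClass A Aᵐᵒᵖ (TensorOver k A M N) where
  smul_comm a b t := by
    induction t using TensorOver.induction with
    | tmul x y => simp only [op_smul_mk, smul_mk]
    | add s t hs ht => simp only [smul_add, hs, ht]

/-- Functoriality of the tensor product over `A` in right linear and left linear maps. -/
def mapLin (f : M →ₗ[k] M') (hf : ∀ (a : A) x, f (op a • x) = op a • f x)
    (g : N →ₗ[k] N') (hg : ∀ (a : A) x, g (a • x) = a • g x) :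
    TensorOver k A M N →ₗ[k] TensorOver k A M' N' :=
  desc (mk k A M' N' ∘ₗ TensorProduct.map f g) fun x a y => by simp [hf, hg, mk_balanced]

@[simp]
theorem mapLin_mk (f : M →ₗ[k] M') (hf : ∀ (a : A) x, f (op a • x) = op a • f x)
    (g : N →ₗ[k] N') (hg : ∀ (a : A) x, g (a • x) = a • g x) (x : M) (y : N) :
    mapLin f hf g hg (mk k A M N (x ⊗ₜ y)) = mk k A M' N' (f x ⊗ₜ g y) := by
  simp [mapLin]

@[simp]
theorem map_mk (f : BimodHom k A M M') (g : BimodHom k A N N') (x : M) (y : N) :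
    map f g (mk k A M N (x ⊗ₜ y)) = mk k A M' N' (f.toLin x ⊗ₜ g.toLin y) := by
  simp [map]

section Bimod

variable [IsScalarTower k A M] [SMulCommClass A Aᵐᵒᵖ M]
  [IsScalarTower k Aᵐᵒᵖ N] [SMulCommClass A Aᵐᵒᵖ N]

/-- A linear map on `M ⊗_A N` that commutes with both actions of `A` on elementary tensors is a
bimodule morphism. -/
def bimodHomOfMk (f : TensorOver k A M N →ₗ[k] L)
    (hl : ∀ (a : A) x y, f (mk k A M N ((a • x) ⊗ₜ y)) = a • f (mk k A M N (x ⊗ₜ y)))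
    (hr : ∀ (a : A) x y, f (mk k A M N (x ⊗ₜ (op a • y))) = op a • f (mk k A M N (x ⊗ₜ y))) :
    BimodHom k A (TensorOver k A M N) L where
  toLin := f
  map_left a t := by
    induction t using TensorOver.induction with
    | tmul x y => rw [smul_mk, hl]
    | add s t hs ht => rw [smul_add, map_add, map_add, smul_add, hs, ht]
  map_right a t := by
    induction t using TensorOver.induction with
    | tmul x y => rw [op_smul_mk, hr]
    | add s t hs ht => rw [smul_add, map_add, map_add, smul_add, hs, ht]

variable [IsScalarTower k A M'] [SMulCommClass A Aᵐᵒᵖ M']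
  [IsScalarTower k Aᵐᵒᵖ N'] [SMulCommClass A Aᵐᵒᵖ N']

/-- `TensorOver.map` as a bimodule morphism. -/
def mapBimod (f : BimodHom k A M M') (g : BimodHom k A N N') :
    BimodHom k A (TensorOver k A M N) (TensorOver k A M' N') :=
  bimodHomOfMk (map f g) (fun a x y => by rw [map_mk, map_mk, f.map_left, smul_mk])
    fun a x y => by rw [map_mk, map_mk, g.map_right, op_smul_mk]

@[simp]
theorem mapBimod_toLin (f : BimodHom k A M M') (g : BimodHom k A N N') :
    (mapBimod f g).toLin = map f g :=
  rfl

end Bimod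

/-- The map `M ⊗_A N → N`, `x ⊗ y ↦ f x • y`, for a morphism `f : M → A`. -/
def augLeft [IsScalarTower k A N] (f : BimodHom k A M A) : TensorOver k A M N →ₗ[k] N :=
  desc (TensorProduct.lift ((Algebra.lsmul k k N : A →ₐ[k] Module.End k N).toLinearMap ∘ₗ f.toLin))
    fun x a y => by simp [f.map_right]

@[simp]
theorem augLeft_mk [IsScalarTower k A N] (f : BimodHom k A M A) (x : M) (y : N) :
    augLeft f (mk k A M N (x ⊗ₜ y)) = f.toLin x • y := by
  exact (desc_mk _ _ _).trans (by simp)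

/-- The map `M ⊗_A N → M`, `x ⊗ y ↦ x · f y`, for a morphism `f : N → A`. -/
def augRight [IsScalarTower k Aᵐᵒᵖ M] (f : BimodHom k A N A) : TensorOver k A M N →ₗ[k] M :=
  desc (TensorProduct.lift (((Algebra.lsmul k k M : Aᵐᵒᵖ →ₐ[k] Module.End k M).toLinearMap ∘ₗ
      (opLinearEquiv k : A ≃ₗ[k] Aᵐᵒᵖ).toLinearMap ∘ₗ f.toLin).flip))
    fun x a y => by simp [f.map_left]

@[simp]
theorem augRight_mk [IsScalarTower k Aᵐᵒᵖ M] (f : BimodHom k A N A) (x : M) (y : N) :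
    augRight f (mk k A M N (x ⊗ₜ y)) = op (f.toLin y) • x := by
  exact (desc_mk _ _ _).trans (by simp)

end TensorOver

section Lifting

variable {k G A : Type*} [Field k] [Group G] [Ring A] [Algebra k A] [Coalgebra k A]
  {YA : YetterDrinfeld k G A}
  {P : ℕ → Type*} [∀ n, AddCommGroup (P n)] [∀ n, Module k (P n)] [∀ n, Module A (P n)]
  [∀ n, Module Aᵐᵒᵖ (P n)] [∀ n, IsScalarTower k A (P n)] [∀ n, IsScalarTower k Aᵐᵒᵖ (P n)]
  [∀ n, SMulCommClass A Aᵐᵒᵖ (P n)] {R : YDResolution YA P}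
  {V : Type*} [AddCommGroup V] [Module k V] {D : G → Submodule k V} {n : ℕ}

theorem GradedFreeIso.induction (i : GradedFreeIso R n D) {p : P n → Prop} (x : P n)
    (tmul : ∀ a v c, p (i.equiv (a ⊗ₜ (v ⊗ₜ c)))) (add : ∀ x y, p x → p y → p (x + y)) : p x := by
  obtain ⟨t, rfl⟩ := i.equiv.surjective x
  induction t with
  | zero => simpa using tmul 0 0 0
  | add x y hx hy => rw [map_add]; exact add _ _ hx hy
  | tmul a t =>
    induction t with
    | zero => simpa using tmul 0 0 0
    | add x y hx hy => rw [TensorProduct.tmul_add, map_add]; exact add _ _ hx hy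
    | tmul v c => exact tmul a v c

theorem GradedFreeIso.equiv_tmul (i : GradedFreeIso R n D) (a : A) (v : V) (c : A) :
    i.equiv (a ⊗ₜ (v ⊗ₜ c)) = a • op c • i.equiv (1 ⊗ₜ (v ⊗ₜ 1)) := by
  rw [← i.map_right, ← i.map_left, mul_one, one_mul]

theorem LinearMap.exists_comp_eq_of_forall_mem_range {W E N : Type*} [AddCommGroup W] [Module k W]
    [AddCommGroup E] [Module k E] [AddCommGroup N] [Module k N] (e : E →ₗ[k] N) (g : W →ₗ[k] N)
    (h : ∀ x, g x ∈ LinearMap.range e) : ∃ l : W →ₗ[k] E, ∀ x, e (l x) = g x := by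
  obtain ⟨l, hl⟩ := Module.projective_lifting_property e.rangeRestrict (g.codRestrict _ h)
    e.surjective_rangeRestrict
  exact ⟨l, fun x => congrArg Subtype.val (LinearMap.congr_fun hl x)⟩

variable {E N : Type*}
  [AddCommGroup E] [Module k E] [Module A E] [Module Aᵐᵒᵖ E]
  [IsScalarTower k A E] [IsScalarTower k Aᵐᵒᵖ E]
  [AddCommGroup N] [Module k N] [Module A N] [Module Aᵐᵒᵖ N]
  [IsScalarTower k A N] [IsScalarTower k Aᵐᵒᵖ N]

/-- `P n ≃ A ⊗ V ⊗ A` is projective as a bimodule; the lift is determined by a linear lift on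
`V`. -/
theorem GradedFreeIso.exists_bimod_lift [SMulCommClass A Aᵐᵒᵖ E] (i : GradedFreeIso R n D)
    {e : E →ₗ[k] N} (he : e ∈ bimodMaps k A E N) {g : P n →ₗ[k] N} (hg : g ∈ bimodMaps k A (P n) N)
    (hr : ∀ x, g x ∈ LinearMap.range e) : ∃ h ∈ bimodMaps k A (P n) E, e ∘ₗ h = g := by
  obtain ⟨l, hl⟩ := LinearMap.exists_comp_eq_of_forall_mem_range e
    (g ∘ₗ i.equiv.toLinearMap ∘ₗ TensorProduct.mk k A (V ⊗[k] A) 1 ∘ₗ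
      (TensorProduct.mk k V A).flip 1) fun x => hr _
  let h : P n →ₗ[k] E := TensorProduct.lift
    ((Algebra.lsmul k k E : A →ₐ[k] Module.End k E).toLinearMap.compl₂
      (TensorProduct.lift (((Algebra.lsmul k k E : Aᵐᵒᵖ →ₐ[k] Module.End k E).toLinearMap ∘ₗ
        (opLinearEquiv k : A ≃ₗ[k] Aᵐᵒᵖ).toLinearMap).flip ∘ₗ l))) ∘ₗ i.equiv.symm.toLinearMap
  have hh : ∀ a v c, h (i.equiv (a ⊗ₜ (v ⊗ₜ c))) = a • op c • l v := fun a v c => by simp [h]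
  refine ⟨h, ⟨fun b x => ?_, fun b x => ?_⟩, ?_⟩
  · induction x using i.induction with
    | tmul a v c => rw [← i.map_left, hh, hh, mul_smul]
    | add x y hx hy => rw [smul_add, map_add, map_add, smul_add, hx, hy]
  · induction x using i.induction with
    | tmul a v c => rw [← i.map_right, hh, hh, op_mul, mul_smul, ← smul_comm a (op b)]
    | add x y hx hy => rw [smul_add, map_add, map_add, smul_add, hx, hy]
  · ext x
    induction x using i.induction with
    | tmul a v c =>
      rw [LinearMap.comp_apply, hh, he.1, he.2, hl, i.equiv_tmul, hg.1, hg.2]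
      rfl
    | add x y hx hy => rw [map_add, map_add, hx, hy]

/-- `P n ≃ (A ⊗ V) ⊗ A` is projective as a right module. -/
theorem GradedFreeIso.exists_right_lift (i : GradedFreeIso R n D)
    {e : E →ₗ[k] N} (he : e ∈ rightMaps k A E N) {g : P n →ₗ[k] N} (hg : g ∈ rightMaps k A (P n) N)
    (hr : ∀ x, g x ∈ LinearMap.range e) : ∃ h ∈ rightMaps k A (P n) E, e ∘ₗ h = g := by
  obtain ⟨l, hl⟩ := LinearMap.exists_comp_eq_of_forall_mem_range e
    (g ∘ₗ i.equiv.toLinearMap ∘ₗ LinearMap.lTensor A ((TensorProduct.mk k V A).flip 1))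
    fun x => hr _
  let h : P n →ₗ[k] E := TensorProduct.lift
    (((Algebra.lsmul k k E : Aᵐᵒᵖ →ₐ[k] Module.End k E).toLinearMap ∘ₗ
        (opLinearEquiv k : A ≃ₗ[k] Aᵐᵒᵖ).toLinearMap).flip ∘ₗ l) ∘ₗ
    (TensorProduct.assoc k A V A).symm.toLinearMap ∘ₗ i.equiv.symm.toLinearMap
  have hh : ∀ a v c, h (i.equiv (a ⊗ₜ (v ⊗ₜ c))) = op c • l (a ⊗ₜ v) := fun a v c => by simp [h]
  refine ⟨h, fun b x => ?_, ?_⟩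
  · induction x using i.induction with
    | tmul a v c => rw [← i.map_right, hh, hh, op_mul, mul_smul]
    | add x y hx hy => rw [smul_add, map_add, map_add, smul_add, hx, hy]
  · ext x
    induction x using i.induction with
    | tmul a v c =>
      rw [LinearMap.comp_apply, hh, he, hl]
      simp only [LinearMap.comp_apply, LinearMap.lTensor_tmul, LinearEquiv.coe_coe,
        LinearMap.flip_apply, TensorProduct.mk_apply]
      rw [← hg c, ← i.map_right, one_mul]
    | add x y hx hy => rw [map_add, map_add, hx, hy]

end Lifting

/-! ### Comparison of complexes with a free resolution -/

section

variable {k G A : Type*} [Field k] [Group G] [Ring A] [Algebra k A] [Coalgebra k A]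
  {YA : YetterDrinfeld k G A}
  {P : ℕ → Type*} [∀ n, AddCommGroup (P n)] [∀ n, Module k (P n)] [∀ n, Module A (P n)]
  [∀ n, Module Aᵐᵒᵖ (P n)] [∀ n, IsScalarTower k A (P n)] [∀ n, IsScalarTower k Aᵐᵒᵖ (P n)]
  [∀ n, SMulCommClass A Aᵐᵒᵖ (P n)] {R : YDResolution YA P}
  {V : ℕ → Type*} [∀ n, AddCommGroup (V n)] [∀ n, Module k (V n)] {D : ∀ n, G → Submodule k (V n)}

namespace YDResolution

theorem d_d (R : YDResolution YA P) (n : ℕ) (x : P (n + 2)) :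
    (R.d n).toLin ((R.d (n + 1)).toLin x) = 0 :=
  (R.exact_d n).apply_apply_eq_zero x

theorem aug_d (R : YDResolution YA P) (x : P 1) : R.aug.toLin ((R.d 0).toLin x) = 0 :=
  R.exact_aug.apply_apply_eq_zero x

theorem mem_range_d (R : YDResolution YA P) (n : ℕ) (x : P (n + 1)) (h : (R.d n).toLin x = 0) :
    x ∈ LinearMap.range (R.d (n + 1)).toLin :=
  (R.exact_d n x).1 h

theorem mem_range_d_zero (R : YDResolution YA P) (x : P 0) (h : R.aug.toLin x = 0) :
    x ∈ LinearMap.range (R.d 0).toLin :=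
  (R.exact_aug x).1 h

section Comparison

variable {T : ℕ → Type*} [∀ n, AddCommGroup (T n)] [∀ n, Module k (T n)] [∀ n, Module A (T n)]
  [∀ n, Module Aᵐᵒᵖ (T n)] [∀ n, IsScalarTower k A (T n)] [∀ n, IsScalarTower k Aᵐᵒᵖ (T n)]
  [∀ n, SMulCommClass A Aᵐᵒᵖ (T n)] {dT : ∀ n, T (n + 1) →ₗ[k] T n}

/-- Bimodule chain maps from `P` to an exact complex `T` are homotopic if they agree modulo
boundaries in degree `0`. -/
theorem exists_homotopy (hP : ∀ n, Nonempty (GradedFreeIso R n (D n)))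
    (hdT : ∀ n, dT n ∈ bimodMaps k A (T (n + 1)) (T n))
    (hex : ∀ m t, dT m t = 0 → t ∈ LinearMap.range (dT (m + 1)))
    (F F' : ∀ n, BimodHom k A (P n) (T n))
    (hF : ∀ n x, dT n ((F (n + 1)).toLin x) = (F n).toLin ((R.d n).toLin x))
    (hF' : ∀ n x, dT n ((F' (n + 1)).toLin x) = (F' n).toLin ((R.d n).toLin x))
    (h0 : ∀ x, (F 0).toLin x - (F' 0).toLin x ∈ LinearMap.range (dT 0)) :
    ∃ h : ∀ n, BimodHom k A (P n) (T (n + 1)),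
      (∀ x, (F 0).toLin x - (F' 0).toLin x = dT 0 ((h 0).toLin x)) ∧
      ∀ n x, (F (n + 1)).toLin x - (F' (n + 1)).toLin x =
        dT (n + 1) ((h (n + 1)).toLin x) + (h n).toLin ((R.d n).toLin x) := by
  obtain ⟨h, hh, e₀, e⟩ := exists_homotopy_of_lift (fun n => (R.d n).toLin) dT
    (fun n m => bimodMaps k A (P n) (T m)) R.d_d
    (fun n m f hf => ((bimodHomOfMem hf).comp (R.d n)).toLin_mem)
    (fun n m g hg hr => (hP n).some.exists_bimod_lift (hdT m) hg hr) hex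
    (fun n => (F n).toLin - (F' n).toLin) (fun n => sub_mem (F n).toLin_mem (F' n).toLin_mem)
    (fun n x => by simp [hF, hF']) (fun x => by simpa using h0 x)
  exact ⟨fun n => bimodHomOfMem (hh n), e₀, e⟩

/-- A bimodule map `g : A → Z` lifts to a chain map from `P` to any resolution `T` of a bimodule
that contains the image of `g`; here `eZ` is the augmentation of `T`. -/
theorem exists_chainMap (hP : ∀ n, Nonempty (GradedFreeIso R n (D n)))
    {Z : Type*} [AddCommGroup Z] [Module k Z] [Module A Z] [Module Aᵐᵒᵖ Z] [IsScalarTower k A Z]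
    [IsScalarTower k Aᵐᵒᵖ Z]
    (hdT : ∀ n, dT n ∈ bimodMaps k A (T (n + 1)) (T n))
    (hex : ∀ m t, dT m t = 0 → t ∈ LinearMap.range (dT (m + 1)))
    {eZ : T 0 →ₗ[k] Z} (heZ : eZ ∈ bimodMaps k A (T 0) Z)
    (hex₀ : ∀ t, eZ t = 0 → t ∈ LinearMap.range (dT 0)) {g : A →ₗ[k] Z}
    (hg : g ∈ bimodMaps k A A Z) (hr : ∀ a, g a ∈ LinearMap.range eZ) :
    ∃ F : ∀ n, BimodHom k A (P n) (T n), (∀ x, eZ ((F 0).toLin x) = g (R.aug.toLin x)) ∧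
      ∀ n x, dT n ((F (n + 1)).toLin x) = (F n).toLin ((R.d n).toLin x) := by
  obtain ⟨F₀, hF₀, e₀⟩ := (hP 0).some.exists_bimod_lift heZ
    ((bimodHomOfMem hg).comp R.aug).toLin_mem (fun x => hr _)
  have e₀' : ∀ x, eZ (F₀ x) = g (R.aug.toLin x) := LinearMap.congr_fun e₀
  obtain ⟨F, rfl, hF, e⟩ := exists_chainMap_of_lift (fun n => (R.d n).toLin) dT
    (fun n m => bimodMaps k A (P n) (T m)) R.d_d
    (fun n m f hf => ((bimodHomOfMem hf).comp (R.d n)).toLin_mem)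
    (fun n m g hg hr => (hP n).some.exists_bimod_lift (hdT m) hg hr) hex
    F₀ hF₀ (fun x => hex₀ _ (by rw [e₀', R.aug_d, map_zero]))
  exact ⟨fun n => bimodHomOfMem (hF n), e₀', fun n x => LinearMap.congr_fun (e n) x⟩

end Comparison

/-- A contracting homotopy of the augmented complex `P → A` by right `A`-linear maps; its component
`A → P 0` is `a ↦ u · a`. -/
structure RightContraction (R : YDResolution YA P) where
  u : P 0
  s : ∀ n, P n →ₗ[k] P (n + 1)
  s_right : ∀ n (a : A) x, s n (op a • x) = op a • s n x
  ds_zero : ∀ x, (R.d 0).toLin (s 0 x) + op (R.aug.toLin x) • u = x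
  ds_succ : ∀ n x, (R.d (n + 1)).toLin (s (n + 1) x) + s n ((R.d n).toLin x) = x

/-- The complexes `P` and `A` consist of projective right modules, so the augmented complex splits
over `A` on the right. -/
theorem nonempty_rightContraction (hP : ∀ n, Nonempty (GradedFreeIso R n (D n))) :
    Nonempty (RightContraction R) := by
  obtain ⟨u, hu⟩ := R.aug_surjective 1
  have hid : ∀ n, LinearMap.id ∈ rightMaps k A (P n) (P n) := fun n a x => rfl
  let p : P 0 →ₗ[k] P 0 := ((Algebra.lsmul k k (P 0) : Aᵐᵒᵖ →ₐ[k] Module.End k (P 0)).toLinearMap ∘ₗ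
        (opLinearEquiv k : A ≃ₗ[k] Aᵐᵒᵖ).toLinearMap).flip u ∘ₗ R.aug.toLin
  have hp : ∀ x, p x = op (R.aug.toLin x) • u := fun x => by simp [p]
  -- the chain endomorphism `id - p`, with `p` concentrated in degree `0`, vanishes on `A` and is
  -- therefore null-homotopic
  obtain ⟨s, hs, e₀, e⟩ := exists_homotopy_of_lift (fun n => (R.d n).toLin)
    (fun n => (R.d n).toLin)
    (fun n m => rightMaps k A (P n) (P m)) R.d_d
    (fun n m f hf a x => by simp [(R.d n).map_right, hf a])
    (fun n m g hg hr => (hP n).some.exists_right_lift (R.d m).map_right hg hr) R.mem_range_d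
    (fun n => match n with
      | 0 => LinearMap.id - p
      | _ + 1 => LinearMap.id)
    (fun n => match n with
      | 0 => sub_mem (hid 0) fun a x => by simp [hp, R.aug.map_right, mul_smul]
      | n + 1 => hid (n + 1))
    (fun n x => match n with
      | 0 => by simp [hp, R.aug_d]
      | _ + 1 => rfl)
    (fun x => R.mem_range_d_zero _ (by
      simp only [LinearMap.sub_apply, hp, map_sub, R.aug.map_right, hu]
      simp))
  refine ⟨⟨u, s, hs, fun x => ?_, fun n x => (e n x).symm⟩⟩
  rw [← e₀, ← hp]
  simp

namespace RightContraction

variable (c : RightContraction R) {N N' : Type*}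
  [AddCommGroup N] [Module k N] [Module A N] [Module Aᵐᵒᵖ N] [IsScalarTower k A N]
  [IsScalarTower k Aᵐᵒᵖ N] [SMulCommClass A Aᵐᵒᵖ N]
  [AddCommGroup N'] [Module k N'] [Module A N'] [Module Aᵐᵒᵖ N'] [IsScalarTower k A N']
  [IsScalarTower k Aᵐᵒᵖ N'] [SMulCommClass A Aᵐᵒᵖ N']

/-- The map `u ⊗ - : N → P 0 ⊗_A N`. -/
def unitTensor : N →ₗ[k] TensorOver k A (P 0) N :=
  TensorOver.mk k A (P 0) N ∘ₗ TensorProduct.mk k (P 0) N c.u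

/-- The map `s ⊗ id` on `P n ⊗_A N`. -/
def sTensor (n : ℕ) : TensorOver k A (P n) N →ₗ[k] TensorOver k A (P (n + 1)) N :=
  TensorOver.mapLin (c.s n) (c.s_right n) LinearMap.id fun _ _ => rfl

theorem ds_tensor_zero (t : TensorOver k A (P 0) N) :
    TensorOver.map (R.d 0) BimodHom.id (c.sTensor 0 t) +
      c.unitTensor (TensorOver.augLeft R.aug t) = t := by
  induction t using TensorOver.induction with
  | tmul x y =>
    simp only [sTensor, unitTensor, TensorOver.mapLin_mk, TensorOver.map_mk, TensorOver.augLeft_mk,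
      BimodHom.id, LinearMap.id_apply, LinearMap.comp_apply, TensorProduct.mk_apply]
    rw [← TensorOver.mk_balanced, ← map_add, ← TensorProduct.add_tmul, c.ds_zero]
  | add s t hs ht =>
    simp only [map_add]
    nth_rewrite 3 [← hs]
    nth_rewrite 3 [← ht]
    abel

theorem ds_tensor_succ (n : ℕ) (t : TensorOver k A (P (n + 1)) N) :
    TensorOver.map (R.d (n + 1)) BimodHom.id (c.sTensor (n + 1) t) +
      c.sTensor n (TensorOver.map (R.d n) BimodHom.id t) = t := by
  induction t using TensorOver.induction with
  | tmul x y =>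
    simp only [sTensor, TensorOver.mapLin_mk, TensorOver.map_mk, BimodHom.id, LinearMap.id_apply]
    rw [← map_add, ← TensorProduct.add_tmul, c.ds_succ]
  | add s t hs ht =>
    simp only [map_add]
    nth_rewrite 3 [← hs]
    nth_rewrite 3 [← ht]
    abel

theorem sTensor_map (g : BimodHom k A N N') (n : ℕ) (t : TensorOver k A (P n) N) :
    c.sTensor n (TensorOver.map BimodHom.id g t) =
      TensorOver.map BimodHom.id g (c.sTensor n t) := by
  induction t using TensorOver.induction with
  | tmul x y => simp [sTensor, BimodHom.id]
  | add s t hs ht => simp only [map_add, hs, ht]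

theorem unitTensor_map (g : BimodHom k A N N') (y : N) :
    c.unitTensor (g.toLin y) = TensorOver.map BimodHom.id g (c.unitTensor y) := by
  simp [unitTensor, BimodHom.id]

end RightContraction

theorem augLeft_map {N N' : Type*}
    [AddCommGroup N] [Module k N] [Module A N] [Module Aᵐᵒᵖ N] [IsScalarTower k A N]
    [AddCommGroup N'] [Module k N'] [Module A N'] [Module Aᵐᵒᵖ N'] [IsScalarTower k A N']
    (g : BimodHom k A N N') (t : TensorOver k A (P 0) N) :
    TensorOver.augLeft R.aug (TensorOver.map BimodHom.id g t) =
      g.toLin (TensorOver.augLeft R.aug t) := by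
  induction t using TensorOver.induction with
  | tmul x y => simp [BimodHom.id, g.map_left]
  | add s t hs ht => simp only [map_add, hs, ht]

theorem augLeft_map_d {N : Type*}
    [AddCommGroup N] [Module k N] [Module A N] [Module Aᵐᵒᵖ N] [IsScalarTower k A N]
    (t : TensorOver k A (P 1) N) :
    TensorOver.augLeft R.aug (TensorOver.map (R.d 0) BimodHom.id t) = 0 := by
  induction t using TensorOver.induction with
  | tmul x y => simp [R.aug_d]
  | add s t hs ht => simp only [map_add, hs, ht, add_zero]

variable (R) in
/-- The differential of the total complex of `P ⊗_A P`. -/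
abbrev dTensor (n : ℕ) : Tot (fun p q => TensorOver k A (P p) (P q)) (n + 1) →ₗ[k]
    Tot (fun p q => TensorOver k A (P p) (P q)) n :=
  totD (X := fun p q => TensorOver k A (P p) (P q))
    (fun p _ => TensorOver.map (R.d p) BimodHom.id)
    (fun _ q => TensorOver.map BimodHom.id (R.d q)) n

/-- The rows of `P ⊗_A P` are contracted onto `A ⊗_A P = P`. -/
def RightContraction.tensor (c : RightContraction R) :
    RowContraction (X := fun p q => TensorOver k A (P p) (P q))
      (fun p _ => TensorOver.map (R.d p) BimodHom.id)
      (fun _ q => TensorOver.map BimodHom.id (R.d q)) (fun q => (R.d q).toLin) where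
  e _ := TensorOver.augLeft R.aug
  u _ := c.unitTensor
  s p _ := c.sTensor p
  e_d₁ _ t := augLeft_map_d t
  e_d₂ q t := augLeft_map (R.d q) t
  u_d q y := c.unitTensor_map (R.d q) y
  s_d₂ p q t := c.sTensor_map (R.d q) p t
  ds_zero _ t := c.ds_tensor_zero t
  ds_succ p _ t := c.ds_tensor_succ p t

end YDResolution

end

/-! ### Homotopic products on cochains -/

section

variable {k A : Type*} [Field k] [Ring A] [Algebra k A]

theorem totD_mem_bimodMaps {X : ℕ → ℕ → Type*} [∀ p q, AddCommGroup (X p q)]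
    [∀ p q, Module k (X p q)] [∀ p q, Module A (X p q)] [∀ p q, Module Aᵐᵒᵖ (X p q)]
    [∀ p q, IsScalarTower k A (X p q)] [∀ p q, IsScalarTower k Aᵐᵒᵖ (X p q)]
    {d₁ : ∀ p q, X (p + 1) q →ₗ[k] X p q} {d₂ : ∀ p q, X p (q + 1) →ₗ[k] X p q}
    (h₁ : ∀ p q, d₁ p q ∈ bimodMaps k A _ _) (h₂ : ∀ p q, d₂ p q ∈ bimodMaps k A _ _) (n : ℕ) :
    totD d₁ d₂ n ∈ bimodMaps k A (Tot X (n + 1)) (Tot X n) := by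
  refine ⟨fun a t => ?_, fun a t => ?_⟩ <;> funext ⟨⟨p, q⟩, h⟩
  · rw [Pi.smul_apply, totD_apply, totD_apply, Pi.smul_apply, Pi.smul_apply, (h₁ p q).1,
      (h₂ p q).1, smul_add, smul_comm a]
  · rw [Pi.smul_apply, totD_apply, totD_apply, Pi.smul_apply, Pi.smul_apply, (h₁ p q).2,
      (h₂ p q).2, smul_add, smul_comm (op a)]

/-- The components of a bimodule morphism to a product. -/
def BimodHom.component {M : Type*} [AddCommGroup M] [Module k M] [Module A M] [Module Aᵐᵒᵖ M]
    {ι : Type*} {N : ι → Type*} [∀ i, AddCommGroup (N i)] [∀ i, Module k (N i)]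
    [∀ i, Module A (N i)] [∀ i, Module Aᵐᵒᵖ (N i)] (f : BimodHom k A M (∀ i, N i)) (i : ι) :
    BimodHom k A M (N i) :=
  ⟨LinearMap.proj i ∘ₗ f.toLin, fun a x => by simp [f.map_left], fun a x => by simp [f.map_right]⟩

/-- The bimodule morphism to a product with given components. -/
def BimodHom.pi {M : Type*} [AddCommGroup M] [Module k M] [Module A M] [Module Aᵐᵒᵖ M]
    {ι : Type*} {N : ι → Type*} [∀ i, AddCommGroup (N i)] [∀ i, Module k (N i)]
    [∀ i, Module A (N i)] [∀ i, Module Aᵐᵒᵖ (N i)] (f : ∀ i, BimodHom k A M (N i)) :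
    BimodHom k A M (∀ i, N i) :=
  ⟨LinearMap.pi fun i => (f i).toLin, fun a x => by ext i; simp [(f i).map_left],
    fun a x => by ext i; simp [(f i).map_right]⟩

end

theorem HomTriv.pairing_mk {k A M N : Type*} [Field k] [Ring A] [Algebra k A] [Coalgebra k A]
    [AddCommGroup M] [Module k M] [Module A M] [Module Aᵐᵒᵖ M]
    [AddCommGroup N] [Module k N] [Module A N] [Module Aᵐᵒᵖ N]
    (f : HomTriv k A M) (g : HomTriv k A N) (x : M) (y : N) :
    HomTriv.pairing k A M N f g (TensorOver.mk k A M N (x ⊗ₜ y)) = f.1 x * g.1 y := by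
  simp [HomTriv.pairing]

section HomTriv

variable {k A : Type*} [Field k] [Ring A] [Algebra k A] [Coalgebra k A]
variable {M N L : Type*}
  [AddCommGroup M] [Module k M] [Module A M] [Module Aᵐᵒᵖ M]
  [IsScalarTower k A M] [IsScalarTower k Aᵐᵒᵖ M] [SMulCommClass A Aᵐᵒᵖ M]
  [AddCommGroup N] [Module k N] [Module A N] [Module Aᵐᵒᵖ N]
  [IsScalarTower k A N] [IsScalarTower k Aᵐᵒᵖ N] [SMulCommClass A Aᵐᵒᵖ N]
  [AddCommGroup L] [Module k L] [Module A L] [Module Aᵐᵒᵖ L]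
  [IsScalarTower k A L] [IsScalarTower k Aᵐᵒᵖ L] [SMulCommClass A Aᵐᵒᵖ L]

/-- The pairing `f ⊗ g ↦ f ⊗_A g` takes values in the bimodule maps from `M ⊗_A N` to `k`. -/
def HomTriv.tensor (k A M N : Type*) [Field k] [Ring A] [Algebra k A] [Coalgebra k A]
    [AddCommGroup M] [Module k M] [Module A M] [Module Aᵐᵒᵖ M]
    [IsScalarTower k A M] [SMulCommClass A Aᵐᵒᵖ M]
    [AddCommGroup N] [Module k N] [Module A N] [Module Aᵐᵒᵖ N]
    [IsScalarTower k Aᵐᵒᵖ N] [SMulCommClass A Aᵐᵒᵖ N] :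
    HomTriv k A M ⊗[k] HomTriv k A N →ₗ[k] HomTriv k A (TensorOver k A M N) :=
  (TensorProduct.lift (HomTriv.pairing k A M N)).codRestrict _ fun t => by
    induction t with
    | zero => simp
    | add s t hs ht => rw [map_add]; exact add_mem hs ht
    | tmul f g =>
      refine ⟨fun a t => ?_, fun a t => ?_⟩
      · induction t using TensorOver.induction with
        | tmul x y =>
          simp [TensorOver.smul_mk, HomTriv.pairing_mk, f.2.1, mul_assoc]
        | add s t hs ht => rw [smul_add, map_add, map_add, hs, ht, mul_add]
      · induction t using TensorOver.induction with
        | tmul x y =>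
          simp [TensorOver.op_smul_mk, HomTriv.pairing_mk, g.2.2, mul_assoc]
        | add s t hs ht => rw [smul_add, map_add, map_add, hs, ht, add_mul]

@[simp]
theorem HomTriv.tensor_mk (f : HomTriv k A M) (g : HomTriv k A N) (x : M) (y : N) :
    (HomTriv.tensor k A M N (f ⊗ₜ g)).1 (TensorOver.mk k A M N (x ⊗ₜ y)) = f.1 x * g.1 y :=
  HomTriv.pairing_mk f g x y

@[simp]
theorem HomTriv.precomp_apply (φ : BimodHom k A M N) (f : HomTriv k A N) (x : M) :
    (HomTriv.precomp φ f).1 x = f.1 (φ.toLin x) := rfl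

variable {M' N' : Type*}
  [AddCommGroup M'] [Module k M'] [Module A M'] [Module Aᵐᵒᵖ M']
  [IsScalarTower k A M'] [IsScalarTower k Aᵐᵒᵖ M'] [SMulCommClass A Aᵐᵒᵖ M']
  [AddCommGroup N'] [Module k N'] [Module A N'] [Module Aᵐᵒᵖ N']
  [IsScalarTower k A N'] [IsScalarTower k Aᵐᵒᵖ N'] [SMulCommClass A Aᵐᵒᵖ N']

theorem HomTriv.tensor_precomp (u : BimodHom k A M M') (v : BimodHom k A N N')
    (f : HomTriv k A M') (g : HomTriv k A N') (t : TensorOver k A M N) :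
    (HomTriv.tensor k A M N (HomTriv.precomp u f ⊗ₜ HomTriv.precomp v g)).1 t =
      (HomTriv.tensor k A M' N' (f ⊗ₜ g)).1 (TensorOver.map u v t) := by
  induction t using TensorOver.induction with
  | tmul x y => simp
  | add s t hs ht => simp only [map_add, hs, ht]

@[simp]
theorem HomTriv.precomp_id (f : HomTriv k A M) : HomTriv.precomp BimodHom.id f = f := rfl

end HomTriv

namespace YDResolution

variable {k G A : Type*} [Field k] [Group G] [Ring A] [Algebra k A] [Coalgebra k A]
  {YA : YetterDrinfeld k G A}
  {P : ℕ → Type*} [∀ n, AddCommGroup (P n)] [∀ n, Module k (P n)] [∀ n, Module A (P n)]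
  [∀ n, Module Aᵐᵒᵖ (P n)] [∀ n, IsScalarTower k A (P n)] [∀ n, IsScalarTower k Aᵐᵒᵖ (P n)]
  [∀ n, SMulCommClass A Aᵐᵒᵖ (P n)] {R : YDResolution YA P}
  {V : ℕ → Type*} [∀ n, AddCommGroup (V n)] [∀ n, Module k (V n)] {D : ∀ n, G → Submodule k (V n)}

/-- Chain maps of bimodules from `P` to itself that agree after augmentation induce homotopic maps
on cochains. -/
theorem homotopic₁_precomp (hP : ∀ n, Nonempty (GradedFreeIso R n (D n)))
    (F F' : ∀ n, BimodHom k A (P n) (P n))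
    (hF : ∀ n x, (R.d n).toLin ((F (n + 1)).toLin x) = (F n).toLin ((R.d n).toLin x))
    (hF' : ∀ n x, (R.d n).toLin ((F' (n + 1)).toLin x) = (F' n).toLin ((R.d n).toLin x))
    (h0 : ∀ x, R.aug.toLin ((F 0).toLin x) = R.aug.toLin ((F' 0).toLin x)) :
    Homotopic₁ (C := fun n => HomTriv k A (P n)) R.homD
      (fun n => HomTriv.precomp (F n)) (fun n => HomTriv.precomp (F' n)) := by
  obtain ⟨H, H₀, H₁⟩ := exists_homotopy (dT := fun n => (R.d n).toLin) hP
    (fun n => (R.d n).toLin_mem) R.mem_range_d F F' hF hF'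
    (fun x => R.mem_range_d_zero _ (by rw [map_sub, h0, sub_self]))
  refine ⟨fun n => HomTriv.precomp (H n), ?_, fun n => ?_⟩
  · ext φ x
    change φ.1 _ - φ.1 _ = φ.1 _
    rw [← map_sub, H₀]
  · ext φ x
    change φ.1 _ - φ.1 _ = φ.1 _ + φ.1 _
    rw [← map_sub, H₁, map_add, add_comm]

/-- Let `X` be a double complex of bimodules with exact total complex, and let `B` pair the cochains
of `P` with `X`, compatibly with the differentials. Chain maps of bimodules from `P` to the
total complex of `X` that agree after augmentation induce homotopic products on cochains. -/
theorem homotopic₂_precomp (hP : ∀ n, Nonempty (GradedFreeIso R n (D n)))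
    {X : ℕ → ℕ → Type*} [∀ p q, AddCommGroup (X p q)]
    [∀ p q, Module k (X p q)] [∀ p q, Module A (X p q)] [∀ p q, Module Aᵐᵒᵖ (X p q)]
    [∀ p q, IsScalarTower k A (X p q)] [∀ p q, IsScalarTower k Aᵐᵒᵖ (X p q)]
    [∀ p q, SMulCommClass A Aᵐᵒᵖ (X p q)]
    {d₁ : ∀ p q, X (p + 1) q →ₗ[k] X p q} {d₂ : ∀ p q, X p (q + 1) →ₗ[k] X p q}
    (h₁ : ∀ p q, d₁ p q ∈ bimodMaps k A _ _) (h₂ : ∀ p q, d₂ p q ∈ bimodMaps k A _ _)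
    (hex : ∀ m t, totD d₁ d₂ m t = 0 → t ∈ LinearMap.range (totD d₁ d₂ (m + 1)))
    (F F' : ∀ n, BimodHom k A (P n) (Tot X n))
    (hF : ∀ n x, totD d₁ d₂ n ((F (n + 1)).toLin x) = (F n).toLin ((R.d n).toLin x))
    (hF' : ∀ n x, totD d₁ d₂ n ((F' (n + 1)).toLin x) = (F' n).toLin ((R.d n).toLin x))
    (h0 : ∀ x, (F 0).toLin x - (F' 0).toLin x ∈ LinearMap.range (totD d₁ d₂ 0))
    (B : ∀ p q, HomTriv k A (P p) ⊗[k] HomTriv k A (P q) →ₗ[k] HomTriv k A (X p q))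
    (hB₁ : ∀ p q f g x, (B (p + 1) q (R.homD p f ⊗ₜ g)).1 x = (B p q (f ⊗ₜ g)).1 (d₁ p q x))
    (hB₂ : ∀ p q f g x, (B p (q + 1) (f ⊗ₜ R.homD q g)).1 x = (B p q (f ⊗ₜ g)).1 (d₂ p q x)) :
    Homotopic₂ (C := fun n => HomTriv k A (P n)) R.homD
      (fun p q n h => HomTriv.precomp ((F n).component ⟨(p, q), h⟩) ∘ₗ B p q)
      (fun p q n h => HomTriv.precomp ((F' n).component ⟨(p, q), h⟩) ∘ₗ B p q) := by
  obtain ⟨H, H₀, H₁⟩ := exists_homotopy hP (totD_mem_bimodMaps h₁ h₂) hex F F' hF hF' h0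
  refine ⟨fun p q n h => HomTriv.precomp ((H n).component ⟨(p, q), h⟩) ∘ₗ B p q, ?_,
    fun p q n h => ?_⟩
  · refine TensorProduct.ext' fun f g => Subtype.ext (LinearMap.ext fun x => ?_)
    have e := congrFun (H₀ x) ⟨(0, 0), rfl⟩
    rw [totD_apply, pow_zero, one_smul] at e
    have e' := congrArg (B 0 0 (f ⊗ₜ g)).1 e
    rw [map_add, ← hB₁, ← hB₂, Pi.sub_apply, map_sub] at e'
    exact e'
  · refine TensorProduct.ext' fun f g => Subtype.ext (LinearMap.ext fun x => ?_)
    have e := congrFun (H₁ n x) ⟨(p, q), h⟩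
    rw [Pi.add_apply, totD_apply] at e
    have e' := congrArg (B p q (f ⊗ₜ g)).1 e
    rw [map_add, map_add, map_smul, ← hB₁, ← hB₂, Pi.sub_apply, map_sub] at e'
    exact (e'.trans (add_comm _ _)).trans (add_assoc _ _ _).symm

end YDResolution

section HomotopyAlgebra

variable {k : Type*} [Field k] {C : ℕ → Type*} [∀ n, AddCommGroup (C n)] [∀ n, Module k (C n)]
  {d : ∀ n, C n →ₗ[k] C (n + 1)}

theorem Homotopic₂.congr {f f' g g' : ∀ p q n, p + q = n → C p ⊗[k] C q →ₗ[k] C n}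
    (h : Homotopic₂ d f f') (hg : ∀ p q n h, g p q n h = f p q n h)
    (hg' : ∀ p q n h, g' p q n h = f' p q n h) : Homotopic₂ d g g' := by
  obtain rfl : g = f := by funext p q n h; exact hg p q n h
  obtain rfl : g' = f' := by funext p q n h; exact hg' p q n h
  exact h

theorem Homotopic₂.symm {f f' : ∀ p q n, p + q = n → C p ⊗[k] C q →ₗ[k] C n}
    (h : Homotopic₂ d f f') : Homotopic₂ d f' f := by
  obtain ⟨s, h0, h1⟩ := h
  refine ⟨fun p q n h => -s p q n h, ?_, fun p q n h => ?_⟩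
  · rw [← neg_sub, h0, neg_add, LinearMap.neg_comp, LinearMap.neg_comp]
  · rw [← neg_sub, h1, LinearMap.neg_comp, LinearMap.neg_comp, LinearMap.comp_neg, smul_neg,
      neg_add, neg_add]

theorem Homotopic₂.trans {f f' f'' : ∀ p q n, p + q = n → C p ⊗[k] C q →ₗ[k] C n}
    (h : Homotopic₂ d f f') (h' : Homotopic₂ d f' f'') : Homotopic₂ d f f'' := by
  obtain ⟨s, h0, h1⟩ := h
  obtain ⟨s', h0', h1'⟩ := h'
  refine ⟨fun p q n h => s p q n h + s' p q n h, ?_, fun p q n h => ?_⟩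
  · rw [← sub_add_sub_cancel (f 0 0 0 rfl) (f' 0 0 0 rfl), h0, h0', LinearMap.add_comp,
      LinearMap.add_comp]
    abel
  · rw [← sub_add_sub_cancel (f p q (n + 1) h) (f' p q (n + 1) h), h1, h1', LinearMap.add_comp,
      LinearMap.add_comp, LinearMap.comp_add, smul_add]
    abel

/-- Homotopies may be precomposed with cochain endomorphisms of `C ⊗ C` of bidegree `(0, 0)`. -/
theorem Homotopic₂.comp {f f' : ∀ p q n, p + q = n → C p ⊗[k] C q →ₗ[k] C n}
    (h : Homotopic₂ d f f') (b : ∀ p q, C p ⊗[k] C q →ₗ[k] C p ⊗[k] C q)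
    (hb₁ : ∀ p q, b (p + 1) q ∘ₗ LinearMap.rTensor (C q) (d p) =
      LinearMap.rTensor (C q) (d p) ∘ₗ b p q)
    (hb₂ : ∀ p q, b p (q + 1) ∘ₗ LinearMap.lTensor (C p) (d q) =
      LinearMap.lTensor (C p) (d q) ∘ₗ b p q) :
    Homotopic₂ d (fun p q n h => f p q n h ∘ₗ b p q) (fun p q n h => f' p q n h ∘ₗ b p q) := by
  obtain ⟨s, h0, h1⟩ := h
  refine ⟨fun p q n h => s p q n h ∘ₗ b p q, ?_, fun p q n h => ?_⟩
  · rw [← LinearMap.sub_comp, h0, LinearMap.add_comp]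
    simp only [LinearMap.comp_assoc, hb₁, hb₂]
  · rw [← LinearMap.sub_comp, h1, LinearMap.add_comp, LinearMap.add_comp, LinearMap.smul_comp]
    simp only [LinearMap.comp_assoc, hb₁, hb₂]

/-- Homotopies may be precomposed with the graded swap `x ⊗ y ↦ (-1) ^ (p * q) • y ⊗ x`. -/
theorem Homotopic₂.swap {f f' : ∀ p q n, p + q = n → C p ⊗[k] C q →ₗ[k] C n}
    (h : Homotopic₂ d f f') :
    Homotopic₂ d
      (fun p q n h => (-1 : k) ^ (p * q) • f q p n (by omega) ∘ₗ
        (TensorProduct.comm k (C p) (C q)).toLinearMap)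
      (fun p q n h => (-1 : k) ^ (p * q) • f' q p n (by omega) ∘ₗ
        (TensorProduct.comm k (C p) (C q)).toLinearMap) := by
  obtain ⟨s, h0, h1⟩ := h
  refine ⟨fun p q n h => (-1 : k) ^ (p * q) • s q p n (by omega) ∘ₗ
    (TensorProduct.comm k (C p) (C q)).toLinearMap, ?_, fun p q n h => ?_⟩
  · refine TensorProduct.ext' fun x y => ?_
    have e := LinearMap.congr_fun h0 (y ⊗ₜ x)
    simp only [LinearMap.sub_apply, LinearMap.add_apply, LinearMap.comp_apply,
      LinearMap.rTensor_tmul, LinearMap.lTensor_tmul] at e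
    simp [e, add_comm]
  · refine TensorProduct.ext' fun x y => ?_
    have e := LinearMap.congr_fun (h1 q p n (by omega)) (y ⊗ₜ x)
    simp only [LinearMap.sub_apply, LinearMap.add_apply, LinearMap.comp_apply, LinearMap.smul_apply,
      LinearMap.rTensor_tmul, LinearMap.lTensor_tmul] at e
    simp only [LinearMap.sub_apply, LinearMap.add_apply, LinearMap.comp_apply, LinearMap.smul_apply,
      LinearMap.rTensor_tmul, LinearMap.lTensor_tmul, LinearEquiv.coe_coe, TensorProduct.comm_tmul,
      map_smul, ← smul_sub, e, smul_add, smul_smul, ← pow_add]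
    have e₁ : (-1 : k) ^ ((p + 1) * q) = (-1 : k) ^ (p * q + q) := by ring
    have e₂ : (-1 : k) ^ (p + p * (q + 1)) = (-1 : k) ^ (p * q) := by
      rw [show p + p * (q + 1) = p * q + 2 * p by ring, pow_add, pow_mul _ 2]
      simp
    rw [e₁, e₂]
    abel

end HomotopyAlgebra

/-! ### Diagonals and the unit -/

namespace TensorOver

variable {k A : Type*} [Field k] [Ring A] [Algebra k A]
variable {M N M' N' L : Type*}
  [AddCommGroup M] [Module k M] [Module A M] [Module Aᵐᵒᵖ M]
  [IsScalarTower k A M] [IsScalarTower k Aᵐᵒᵖ M] [SMulCommClass A Aᵐᵒᵖ M]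
  [AddCommGroup N] [Module k N] [Module A N] [Module Aᵐᵒᵖ N]
  [IsScalarTower k A N] [IsScalarTower k Aᵐᵒᵖ N] [SMulCommClass A Aᵐᵒᵖ N]
  [AddCommGroup L] [Module k L] [Module A L] [Module Aᵐᵒᵖ L]
  [IsScalarTower k A L] [IsScalarTower k Aᵐᵒᵖ L] [SMulCommClass A Aᵐᵒᵖ L]

/-- `TensorOver.augLeft` as a bimodule morphism. -/
def augLeftBimod (f : BimodHom k A M A) : BimodHom k A (TensorOver k A M N) N :=
  bimodHomOfMk (augLeft f)
    (fun a x y => by rw [augLeft_mk, augLeft_mk, f.map_left, smul_eq_mul, mul_smul])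
    fun a x y => by rw [augLeft_mk, augLeft_mk, smul_comm]

/-- `TensorOver.augRight` as a bimodule morphism. -/
def augRightBimod (f : BimodHom k A N A) : BimodHom k A (TensorOver k A M N) M :=
  bimodHomOfMk (augRight f)
    (fun a x y => by rw [augRight_mk, augRight_mk, ← smul_comm a])
    fun a x y => by
      rw [augRight_mk, augRight_mk, f.map_right, op_smul_eq_mul, op_mul, mul_smul]

/-- The associativity map `(M ⊗_A N) ⊗_A L → M ⊗_A (N ⊗_A L)`. -/
def assoc (k A M N L : Type*) [Field k] [Ring A] [Algebra k A]
    [AddCommGroup M] [Module k M] [Module A M] [Module Aᵐᵒᵖ M]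
    [IsScalarTower k A M] [IsScalarTower k Aᵐᵒᵖ M] [SMulCommClass A Aᵐᵒᵖ M]
    [AddCommGroup N] [Module k N] [Module A N] [Module Aᵐᵒᵖ N]
    [IsScalarTower k A N] [IsScalarTower k Aᵐᵒᵖ N] [SMulCommClass A Aᵐᵒᵖ N]
    [AddCommGroup L] [Module k L] [Module A L] [Module Aᵐᵒᵖ L]
    [IsScalarTower k A L] [IsScalarTower k Aᵐᵒᵖ L] [SMulCommClass A Aᵐᵒᵖ L] :
    TensorOver k A (TensorOver k A M N) L →ₗ[k] TensorOver k A M (TensorOver k A N L) :=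
  desc (TensorProduct.lift (desc (TensorProduct.curry (mk k A M (TensorOver k A N L) ∘ₗ
      LinearMap.lTensor M (mk k A N L) ∘ₗ (TensorProduct.assoc k M N L).toLinearMap))
    fun x a y => by
      ext z
      simp [mk_balanced, smul_mk]))
    fun t a z => by
      induction t using TensorOver.induction with
      | tmul x y => simp [op_smul_mk, mk_balanced]
      | add s t hs ht => rw [smul_add, TensorProduct.add_tmul, TensorProduct.add_tmul, map_add,
          map_add, hs, ht]

theorem assoc_mk (x : M) (y : N) (z : L) :
    assoc k A M N L (mk k A _ L (mk k A M N (x ⊗ₜ y) ⊗ₜ z)) =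
      mk k A M _ (x ⊗ₜ mk k A N L (y ⊗ₜ z)) := by
  simp [assoc]

theorem induction_left {p : TensorOver k A (TensorOver k A M N) L → Prop}
    (t : TensorOver k A (TensorOver k A M N) L)
    (tmul : ∀ x y z, p (mk k A _ L (mk k A M N (x ⊗ₜ y) ⊗ₜ z)))
    (add : ∀ s t, p s → p t → p (s + t)) : p t := by
  induction t using TensorOver.induction with
  | add s t hs ht => exact add s t hs ht
  | tmul t z =>
    induction t using TensorOver.induction with
    | tmul x y => exact tmul x y z
    | add s t hs ht => rw [TensorProduct.add_tmul, map_add]; exact add _ _ hs ht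

/-- `TensorOver.assoc` as a bimodule morphism. -/
def assocBimod (k A M N L : Type*) [Field k] [Ring A] [Algebra k A]
    [AddCommGroup M] [Module k M] [Module A M] [Module Aᵐᵒᵖ M]
    [IsScalarTower k A M] [IsScalarTower k Aᵐᵒᵖ M] [SMulCommClass A Aᵐᵒᵖ M]
    [AddCommGroup N] [Module k N] [Module A N] [Module Aᵐᵒᵖ N]
    [IsScalarTower k A N] [IsScalarTower k Aᵐᵒᵖ N] [SMulCommClass A Aᵐᵒᵖ N]
    [AddCommGroup L] [Module k L] [Module A L] [Module Aᵐᵒᵖ L]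
    [IsScalarTower k A L] [IsScalarTower k Aᵐᵒᵖ L] [SMulCommClass A Aᵐᵒᵖ L] :
    BimodHom k A (TensorOver k A (TensorOver k A M N) L)
      (TensorOver k A M (TensorOver k A N L)) where
  toLin := assoc k A M N L
  map_left a t := by
    induction t using TensorOver.induction_left with
    | tmul x y z => simp only [smul_mk, assoc_mk]
    | add s t hs ht => rw [smul_add, map_add, map_add, smul_add, hs, ht]
  map_right a t := by
    induction t using TensorOver.induction_left with
    | tmul x y z => simp only [op_smul_mk, assoc_mk]
    | add s t hs ht => rw [smul_add, map_add, map_add, smul_add, hs, ht]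

variable {M₂ N₂ L₂ : Type*}
  [AddCommGroup M₂] [Module k M₂] [Module A M₂] [Module Aᵐᵒᵖ M₂]
  [IsScalarTower k A M₂] [IsScalarTower k Aᵐᵒᵖ M₂] [SMulCommClass A Aᵐᵒᵖ M₂]
  [AddCommGroup N₂] [Module k N₂] [Module A N₂] [Module Aᵐᵒᵖ N₂]
  [IsScalarTower k A N₂] [IsScalarTower k Aᵐᵒᵖ N₂] [SMulCommClass A Aᵐᵒᵖ N₂]
  [AddCommGroup L₂] [Module k L₂] [Module A L₂] [Module Aᵐᵒᵖ L₂]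
  [IsScalarTower k A L₂] [IsScalarTower k Aᵐᵒᵖ L₂] [SMulCommClass A Aᵐᵒᵖ L₂]

theorem assoc_map (f : BimodHom k A M M₂) (g : BimodHom k A N N₂) (h : BimodHom k A L L₂)
    (t : TensorOver k A (TensorOver k A M N) L) :
    map f (mapBimod g h) (assoc k A M N L t) = assoc k A M₂ N₂ L₂ (map (mapBimod f g) h t) := by
  induction t using TensorOver.induction_left with
  | tmul x y z => simp [assoc_mk]
  | add s t hs ht => rw [map_add, map_add, map_add, map_add, hs, ht]

end TensorOver

namespace YDResolution

variable {k G A : Type*} [Field k] [Group G] [Ring A] [Algebra k A] [Coalgebra k A]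
  {YA : YetterDrinfeld k G A}
  {P : ℕ → Type*} [∀ n, AddCommGroup (P n)] [∀ n, Module k (P n)] [∀ n, Module A (P n)]
  [∀ n, Module Aᵐᵒᵖ (P n)] [∀ n, IsScalarTower k A (P n)] [∀ n, IsScalarTower k Aᵐᵒᵖ (P n)]
  [∀ n, SMulCommClass A Aᵐᵒᵖ (P n)] {R : YDResolution YA P}
  {V : ℕ → Type*} [∀ n, AddCommGroup (V n)] [∀ n, Module k (V n)] {D : ∀ n, G → Submodule k (V n)}

section Diagonal

variable (R) in
theorem dTensor_mem (n : ℕ) : dTensor R n ∈ bimodMaps k A _ _ :=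
  totD_mem_bimodMaps
    (fun p q => (TensorOver.mapBimod (R.d p) (BimodHom.id (M := P q))).toLin_mem)
    (fun p q => (TensorOver.mapBimod (BimodHom.id (M := P p)) (R.d q)).toLin_mem) n

theorem mem_range_dTensor (hP : ∀ n, Nonempty (GradedFreeIso R n (D n))) (m : ℕ)
    (t : Tot (fun p q => TensorOver k A (P p) (P q)) (m + 1)) (ht : dTensor R m t = 0) :
    t ∈ LinearMap.range (dTensor R (m + 1)) :=
  (nonempty_rightContraction hP).some.tensor.exact R.mem_range_d m t ht

variable (R) in
/-- The augmentation `P 0 ⊗_A P 0 → A` of the total complex of `P ⊗_A P`. -/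
def augTensor : TensorOver k A (P 0) (P 0) →ₗ[k] A :=
  R.aug.toLin ∘ₗ TensorOver.augLeft R.aug

theorem mem_range_dTensor_zero (hP : ∀ n, Nonempty (GradedFreeIso R n (D n)))
    (t : Tot (fun p q => TensorOver k A (P p) (P q)) 0)
    (ht : R.augTensor (t ⟨(0, 0), rfl⟩) = 0) : t ∈ LinearMap.range (dTensor R 0) :=
  (nonempty_rightContraction hP).some.tensor.exact_zero R.aug.toLin R.mem_range_d_zero t ht

theorem map_aug_aug (t : TensorOver k A (P 0) (P 0)) :
    TensorOver.map R.aug R.aug t = TensorOver.mk k A A A (1 ⊗ₜ R.augTensor t) := by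
  induction t using TensorOver.induction with
  | tmul x y =>
    have := TensorOver.mk_balanced (k := k) (1 : A) (R.aug.toLin x) (R.aug.toLin y)
    simpa [augTensor, R.aug.map_left] using this
  | add s t hs ht => rw [map_add, map_add, hs, ht, TensorProduct.tmul_add, map_add]

theorem augTensor_eq (t : TensorOver k A (P 0) (P 0)) :
    R.augTensor t = TensorOver.augLeft BimodHom.id (TensorOver.map R.aug R.aug t) := by
  rw [map_aug_aug]
  simp [BimodHom.id]

/-- Since the total complex of `P ⊗_A P` is a resolution of `A`, the identity of `A` lifts. -/
theorem nonempty_diagonal (hP : ∀ n, Nonempty (GradedFreeIso R n (D n))) :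
    Nonempty (Diagonal R) := by
  obtain ⟨u, hu⟩ := R.aug_surjective 1
  let e : BimodHom k A (Tot (fun p q => TensorOver k A (P p) (P q)) 0) A :=
    (R.aug.comp (TensorOver.augLeftBimod R.aug)).comp
      (BimodHom.component (N := fun i : {i : ℕ × ℕ // i.1 + i.2 = 0} =>
        TensorOver k A (P i.1.1) (P i.1.2)) BimodHom.id ⟨(0, 0), rfl⟩)
  have he : ∀ a : A, a ∈ LinearMap.range e.toLin := fun a => by
    refine ⟨fun i => match i with
      | ⟨(0, 0), _⟩ => TensorOver.mk k A _ _ (u ⊗ₜ (a • u))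
      | _ => 0, ?_⟩
    change R.augTensor (TensorOver.mk k A _ _ (u ⊗ₜ (a • u))) = a
    simp [augTensor, hu, R.aug.map_left]
  obtain ⟨F, F₀, hF⟩ := exists_chainMap hP (R.dTensor_mem) (mem_range_dTensor hP) e.toLin_mem
    (mem_range_dTensor_zero hP) (BimodHom.id (k := k) (A := A) (M := A)).toLin_mem he
  exact ⟨{
    comp := fun p q n h => (F n).component ⟨(p, q), h⟩
    comm := fun p q n h x => (congrFun (hF n x) ⟨(p, q), h⟩).symm
    lift := fun x => (map_aug_aug _).trans (congrArg
      (fun a => TensorOver.mk k A A A (1 ⊗ₜ a)) (F₀ x)) }⟩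

end Diagonal

end YDResolution

namespace Diagonal

open YDResolution

variable {k G A : Type*} [Field k] [Group G] [Ring A] [Algebra k A] [Coalgebra k A]
  {YA : YetterDrinfeld k G A}
  {P : ℕ → Type*} [∀ n, AddCommGroup (P n)] [∀ n, Module k (P n)] [∀ n, Module A (P n)]
  [∀ n, Module Aᵐᵒᵖ (P n)] [∀ n, IsScalarTower k A (P n)] [∀ n, IsScalarTower k Aᵐᵒᵖ (P n)]
  [∀ n, SMulCommClass A Aᵐᵒᵖ (P n)] {R : YDResolution YA P} (ω : Diagonal R)
  {V : ℕ → Type*} [∀ n, AddCommGroup (V n)] [∀ n, Module k (V n)] {D : ∀ n, G → Submodule k (V n)}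

/-- A diagonal, as a sequence of morphisms to the total complex of `P ⊗_A P`. -/
def toTot (n : ℕ) : BimodHom k A (P n) (Tot (fun p q => TensorOver k A (P p) (P q)) n) :=
  BimodHom.pi fun i => ω.comp i.1.1 i.1.2 n i.2

theorem dTensor_toTot (n : ℕ) (x : P (n + 1)) :
    dTensor R n ((ω.toTot (n + 1)).toLin x) = (ω.toTot n).toLin ((R.d n).toLin x) := by
  funext ⟨⟨p, q⟩, h⟩
  exact (ω.comm p q n h x).symm

theorem augTensor_comp (x : P 0) :
    R.augTensor ((ω.comp 0 0 0 rfl).toLin x) = R.aug.toLin x := by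
  rw [augTensor_eq, ω.lift]
  simp [BimodHom.id]

/-- Changing a diagonal by chain maps `u` and `v` lifting the identity of `A` does not change the
cup product up to homotopy. -/
theorem homotopic₂_map (hP : ∀ n, Nonempty (GradedFreeIso R n (D n)))
    (u v : ∀ n, BimodHom k A (P n) (P n))
    (hu : ∀ n x, (R.d n).toLin ((u (n + 1)).toLin x) = (u n).toLin ((R.d n).toLin x))
    (hv : ∀ n x, (R.d n).toLin ((v (n + 1)).toLin x) = (v n).toLin ((R.d n).toLin x))
    (hu0 : ∀ x, R.aug.toLin ((u 0).toLin x) = R.aug.toLin x)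
    (hv0 : ∀ x, R.aug.toLin ((v 0).toLin x) = R.aug.toLin x) :
    Homotopic₂ (C := fun n => HomTriv k A (P n)) R.homD
      (fun p q n h => TensorProduct.lift (cup ω p q n h))
      (fun p q n h => TensorProduct.lift (cup ω p q n h) ∘ₗ
        TensorProduct.map (HomTriv.precomp (u p)) (HomTriv.precomp (v q))) := by
  have key := homotopic₂_precomp hP (X := fun p q => TensorOver k A (P p) (P q))
    (fun p q => (TensorOver.mapBimod (R.d p) (BimodHom.id (M := P q))).toLin_mem)
    (fun p q => (TensorOver.mapBimod (BimodHom.id (M := P p)) (R.d q)).toLin_mem)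
    (mem_range_dTensor hP) ω.toTot
    (fun n => BimodHom.pi fun i =>
      (TensorOver.mapBimod (u i.1.1) (v i.1.2)).comp (ω.comp i.1.1 i.1.2 n i.2))
    ω.dTensor_toTot (fun n x => ?_) (fun x => mem_range_dTensor_zero hP _ ?_)
    (fun p q => HomTriv.tensor k A (P p) (P q)) (fun p q f g x => ?_) (fun p q f g x => ?_)
  · exact key.congr (fun p q n h => TensorProduct.ext' fun f g => rfl) fun p q n h =>
      TensorProduct.ext' fun f g => Subtype.ext <| LinearMap.ext fun x =>
        HomTriv.tensor_precomp (u p) (v q) f g _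
  · funext ⟨⟨p, q⟩, h⟩
    rw [totD_apply]
    have key : ∀ (t : TensorOver k A (P (p + 1)) (P q)),
        TensorOver.map (R.d p) BimodHom.id (TensorOver.map (u (p + 1)) (v q) t) =
          TensorOver.map (u p) (v q) (TensorOver.map (R.d p) BimodHom.id t) := fun t => by
      induction t using TensorOver.induction with
      | tmul x y => simp [BimodHom.id, hu]
      | add s t hs ht => simp only [map_add, hs, ht]
    have key' : ∀ (t : TensorOver k A (P p) (P (q + 1))),
        TensorOver.map BimodHom.id (R.d q) (TensorOver.map (u p) (v (q + 1)) t) =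
          TensorOver.map (u p) (v q) (TensorOver.map BimodHom.id (R.d q) t) := fun t => by
      induction t using TensorOver.induction with
      | tmul x y => simp [BimodHom.id, hv]
      | add s t hs ht => simp only [map_add, hs, ht]
    refine (congrArg₂ (· + (-1 : k) ^ p • ·) (key _) (key' _)).trans ?_
    change _ = TensorOver.map (u p) (v q) _
    rw [ω.comm p q n h x, map_add, map_smul]
  · have key : ∀ t : TensorOver k A (P 0) (P 0), R.augTensor (TensorOver.map (u 0) (v 0) t) =
        R.augTensor t := fun t => by
      induction t using TensorOver.induction with
      | tmul x y => simp [augTensor, R.aug.map_left, hu0, hv0]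
      | add s t hs ht => simp only [map_add, hs, ht]
    rw [Pi.sub_apply, map_sub, sub_eq_zero]
    exact (key _).symm
  · exact HomTriv.tensor_precomp (R.d p) BimodHom.id f g x
  · exact HomTriv.tensor_precomp BimodHom.id (R.d q) f g x

/-- `- ∪ (ε ∘ aug)` is induced by the chain map `(id ⊗_A aug) ∘ ω`, which lifts the identity. -/
theorem cup_homOne (hP : ∀ n, Nonempty (GradedFreeIso R n (D n))) (hA : IsBimonoid YA) :
    Homotopic₁ (C := fun n => HomTriv k A (P n)) R.homD
      (fun n => (cup ω n 0 n (Nat.add_zero n)).flip (R.homOne hA)) (fun _ => LinearMap.id) := by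
  have key := homotopic₁_precomp hP
    (fun n => (TensorOver.augRightBimod R.aug).comp (ω.comp n 0 n (Nat.add_zero n)))
    (fun n => BimodHom.id) (fun n x => ?_) (fun n x => rfl) (fun x => ?_)
  · refine Eq.subst (motive := fun F => Homotopic₁ (C := fun n => HomTriv k A (P n)) R.homD F
      fun _ => LinearMap.id) (funext fun n => ?_) key
    ext φ x
    symm
    change (HomTriv.tensor k A _ _ (φ ⊗ₜ R.homOne hA)).1 _ = φ.1 (TensorOver.augRight R.aug _)
    generalize (ω.comp n 0 n (Nat.add_zero n)).toLin x = t
    induction t using TensorOver.induction with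
    | tmul x y =>
      rw [HomTriv.tensor_mk, TensorOver.augRight_mk, φ.2.2]
      rfl
    | add s t hs ht => rw [map_add, map_add, map_add, hs, ht]
  · have e₁ : ∀ t : TensorOver k A (P (n + 1)) (P 0), (R.d n).toLin (TensorOver.augRight R.aug t) =
        TensorOver.augRight R.aug (TensorOver.map (R.d n) BimodHom.id t) := fun t => by
      induction t using TensorOver.induction with
      | tmul x y => simp [BimodHom.id, (R.d n).map_right]
      | add s t hs ht => simp only [map_add, hs, ht]
    have e₂ : ∀ t : TensorOver k A (P n) (P 1),
        TensorOver.augRight R.aug (TensorOver.map BimodHom.id (R.d 0) t) = 0 := fun t => by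
      induction t using TensorOver.induction with
      | tmul x y => simp [R.aug_d]
      | add s t hs ht => simp only [map_add, hs, ht, add_zero]
    refine (e₁ _).trans ?_
    change _ = TensorOver.augRight R.aug _
    rw [ω.comm n 0 n (Nat.add_zero n) x, map_add, map_smul, e₂, smul_zero, add_zero]
  · refine Eq.trans ?_ (ω.augTensor_comp x)
    change R.aug.toLin (TensorOver.augRight R.aug _) = R.augTensor _
    generalize (ω.comp 0 0 0 (Nat.add_zero 0)).toLin x = t
    induction t using TensorOver.induction with
    | tmul x y => simp [augTensor, R.aug.map_left, R.aug.map_right]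
    | add s t hs ht => simp only [map_add, hs, ht]

/-- `(ε ∘ aug) ∪ -` is induced by the chain map `(aug ⊗_A id) ∘ ω`, which lifts the identity. -/
theorem homOne_cup (hP : ∀ n, Nonempty (GradedFreeIso R n (D n))) (hA : IsBimonoid YA) :
    Homotopic₁ (C := fun n => HomTriv k A (P n)) R.homD
      (fun n => cup ω 0 n n (Nat.zero_add n) (R.homOne hA)) (fun _ => LinearMap.id) := by
  have key := homotopic₁_precomp hP
    (fun n => (TensorOver.augLeftBimod R.aug).comp (ω.comp 0 n n (Nat.zero_add n)))
    (fun n => BimodHom.id) (fun n x => ?_) (fun n x => rfl) (fun x => ω.augTensor_comp x)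
  · refine Eq.subst (motive := fun F => Homotopic₁ (C := fun n => HomTriv k A (P n)) R.homD F
      fun _ => LinearMap.id) (funext fun n => ?_) key
    ext φ x
    symm
    change (HomTriv.tensor k A _ _ (R.homOne hA ⊗ₜ φ)).1 _ = φ.1 (TensorOver.augLeft R.aug _)
    generalize (ω.comp 0 n n (Nat.zero_add n)).toLin x = t
    induction t using TensorOver.induction with
    | tmul x y =>
      rw [HomTriv.tensor_mk, TensorOver.augLeft_mk, φ.2.1]
      rfl
    | add s t hs ht => rw [map_add, map_add, map_add, hs, ht]
  · refine (augLeft_map (R.d n) _).symm.trans ?_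
    change _ = TensorOver.augLeft R.aug _
    rw [ω.comm 0 n n (Nat.zero_add n) x, map_add, map_smul, augLeft_map_d, zero_add, pow_zero,
      one_smul]

end Diagonal

/-! ### Associativity -/

theorem Homotopic₃.congr {k : Type*} [Field k] {C : ℕ → Type*} [∀ n, AddCommGroup (C n)]
    [∀ n, Module k (C n)] {d : ∀ n, C n →ₗ[k] C (n + 1)}
    {f f' g g' : ∀ p q r n, p + q + r = n → C p ⊗[k] (C q ⊗[k] C r) →ₗ[k] C n}
    (h : Homotopic₃ d f f') (hg : ∀ p q r n h, g p q r n h = f p q r n h)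
    (hg' : ∀ p q r n h, g' p q r n h = f' p q r n h) : Homotopic₃ d g g' := by
  obtain rfl : g = f := by funext p q r n h; exact hg p q r n h
  obtain rfl : g' = f' := by funext p q r n h; exact hg' p q r n h
  exact h

section Associativity

variable {k G A : Type*} [Field k] [Group G] [Ring A] [Algebra k A] [Coalgebra k A]
  {YA : YetterDrinfeld k G A}
  {P : ℕ → Type*} [∀ n, AddCommGroup (P n)] [∀ n, Module k (P n)] [∀ n, Module A (P n)]
  [∀ n, Module Aᵐᵒᵖ (P n)] [∀ n, IsScalarTower k A (P n)] [∀ n, IsScalarTower k Aᵐᵒᵖ (P n)]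
  [∀ n, SMulCommClass A Aᵐᵒᵖ (P n)] {R : YDResolution YA P}
  {V : ℕ → Type*} [∀ n, AddCommGroup (V n)] [∀ n, Module k (V n)] {D : ∀ n, G → Submodule k (V n)}

variable (k A P) in
/-- The bimodules of the double complex `P ⊗_A (P ⊗_A P)`, where the second index is the total
degree in the last two factors. -/
abbrev TripleTensor (p m : ℕ) : Type _ :=
  Tot (fun q r => TensorOver k A (P p) (TensorOver k A (P q) (P r))) m

namespace YDResolution

variable (R) in
/-- The differential of `P ⊗_A (P ⊗_A P)` in the first factor. -/
def tripleD₁ (p m : ℕ) : TripleTensor k A P (p + 1) m →ₗ[k] TripleTensor k A P p m :=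
  LinearMap.pi fun j => TensorOver.map (R.d p) BimodHom.id ∘ₗ LinearMap.proj j

variable (R) in
/-- The differential of `P ⊗_A (P ⊗_A P)` in the last two factors. -/
def tripleD₂ (p m : ℕ) : TripleTensor k A P p (m + 1) →ₗ[k] TripleTensor k A P p m :=
  totD (X := fun q r => TensorOver k A (P p) (TensorOver k A (P q) (P r)))
    (fun q _ => TensorOver.map BimodHom.id (TensorOver.mapBimod (R.d q) BimodHom.id))
    (fun _ r => TensorOver.map BimodHom.id (TensorOver.mapBimod BimodHom.id (R.d r))) m

variable (R) in
theorem tripleD₁_mem (p m : ℕ) : R.tripleD₁ p m ∈ bimodMaps k A _ _ :=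
  (BimodHom.pi fun j : {j : ℕ × ℕ // j.1 + j.2 = m} => (TensorOver.mapBimod (R.d p)
    (BimodHom.id (M := TensorOver k A (P j.1.1) (P j.1.2)))).comp
      (BimodHom.component (N := fun j : {j : ℕ × ℕ // j.1 + j.2 = m} =>
        TensorOver k A (P (p + 1)) (TensorOver k A (P j.1.1) (P j.1.2)))
        BimodHom.id j)).toLin_mem

variable (R) in
theorem tripleD₂_mem (p m : ℕ) : R.tripleD₂ p m ∈ bimodMaps k A _ _ :=
  totD_mem_bimodMaps
    (fun q r => (TensorOver.mapBimod (BimodHom.id (M := P p))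
      (TensorOver.mapBimod (R.d q) (BimodHom.id (M := P r)))).toLin_mem)
    (fun q r => (TensorOver.mapBimod (BimodHom.id (M := P p))
      (TensorOver.mapBimod (BimodHom.id (M := P q)) (R.d r))).toLin_mem) m

/-- The rows of `P ⊗_A (P ⊗_A P)` are contracted onto `A ⊗_A (P ⊗_A P) = P ⊗_A P`. -/
def RightContraction.triple (c : RightContraction R) :
    RowContraction R.tripleD₁ R.tripleD₂ R.dTensor where
  e _ := LinearMap.pi fun j => TensorOver.augLeft R.aug ∘ₗ LinearMap.proj j
  u _ := LinearMap.pi fun j => c.unitTensor ∘ₗ LinearMap.proj j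
  s p _ := LinearMap.pi fun j => c.sTensor p ∘ₗ LinearMap.proj j
  e_d₁ _ _ := funext fun _ => augLeft_map_d _
  e_d₂ _ _ := funext fun ⟨⟨q, r⟩, _⟩ =>
    ((map_add _ _ _).trans (congrArg _ (map_smul _ _ _))).trans <|
      congrArg₂ (· + (-1 : k) ^ q • ·)
        (augLeft_map (TensorOver.mapBimod (R.d q) (BimodHom.id (M := P r))) _)
        (augLeft_map (TensorOver.mapBimod (BimodHom.id (M := P q)) (R.d r)) _)
  u_d _ _ := funext fun ⟨⟨q, r⟩, _⟩ =>
    ((map_add _ _ _).trans (congrArg _ (map_smul _ _ _))).trans <|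
      congrArg₂ (· + (-1 : k) ^ q • ·)
        (c.unitTensor_map (TensorOver.mapBimod (R.d q) (BimodHom.id (M := P r))) _)
        (c.unitTensor_map (TensorOver.mapBimod (BimodHom.id (M := P q)) (R.d r)) _)
  s_d₂ p _ _ := funext fun ⟨⟨q, r⟩, _⟩ =>
    ((map_add _ _ _).trans (congrArg _ (map_smul _ _ _))).trans <|
      congrArg₂ (· + (-1 : k) ^ q • ·)
        (c.sTensor_map (TensorOver.mapBimod (R.d q) (BimodHom.id (M := P r))) p _)
        (c.sTensor_map (TensorOver.mapBimod (BimodHom.id (M := P q)) (R.d r)) p _)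
  ds_zero _ _ := funext fun _ => c.ds_tensor_zero _
  ds_succ p _ _ := funext fun _ => c.ds_tensor_succ p _

variable (R) in
/-- The differential of the total complex of `P ⊗_A (P ⊗_A P)`. -/
abbrev dTriple (n : ℕ) : Tot (TripleTensor k A P) (n + 1) →ₗ[k] Tot (TripleTensor k A P) n :=
  totD R.tripleD₁ R.tripleD₂ n

/-- The component of an element of the total complex in `P p ⊗_A (P q ⊗_A P r)`; the total degree
`m` in the last two factors is kept as a separate argument. -/
def get₃ {n : ℕ} (t : Tot (TripleTensor k A P) n) (p m q r : ℕ) (h : p + m = n) (h' : q + r = m) :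
    TensorOver k A (P p) (TensorOver k A (P q) (P r)) :=
  t ⟨(p, m), h⟩ ⟨(q, r), h'⟩

theorem get₃_ext {n : ℕ} {s t : Tot (TripleTensor k A P) n}
    (H : ∀ p m q r h h', get₃ s p m q r h h' = get₃ t p m q r h h') : s = t := by
  funext ⟨⟨p, m⟩, h⟩ ⟨⟨q, r⟩, h'⟩
  exact H p m q r h h'

theorem get₃_add {n : ℕ} (s t : Tot (TripleTensor k A P) n) (p m q r : ℕ) (h : p + m = n)
    (h' : q + r = m) : get₃ (s + t) p m q r h h' = get₃ s p m q r h h' + get₃ t p m q r h h' := rfl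

theorem get₃_sub {n : ℕ} (s t : Tot (TripleTensor k A P) n) (p m q r : ℕ) (h : p + m = n)
    (h' : q + r = m) : get₃ (s - t) p m q r h h' = get₃ s p m q r h h' - get₃ t p m q r h h' := rfl

theorem get₃_dTriple {n : ℕ} (t : Tot (TripleTensor k A P) (n + 1)) (p m q r : ℕ)
    (h : p + m = n) (h' : q + r = m) :
    get₃ (R.dTriple n t) p m q r h h' =
      TensorOver.map (R.d p) BimodHom.id (get₃ t (p + 1) m q r (by omega) h') +
      (-1 : k) ^ p • (TensorOver.map BimodHom.id (TensorOver.mapBimod (R.d q) BimodHom.id)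
          (get₃ t p (m + 1) (q + 1) r (by omega) (by omega)) +
        (-1 : k) ^ q • TensorOver.map BimodHom.id (TensorOver.mapBimod BimodHom.id (R.d r))
          (get₃ t p (m + 1) q (r + 1) (by omega) (by omega))) := rfl

theorem mem_range_dTriple (hP : ∀ n, Nonempty (GradedFreeIso R n (D n))) (m : ℕ)
    (t : Tot (TripleTensor k A P) (m + 1)) (ht : R.dTriple m t = 0) :
    t ∈ LinearMap.range (R.dTriple (m + 1)) :=
  (nonempty_rightContraction hP).some.triple.exact (mem_range_dTensor hP) m t ht

theorem mem_range_dTriple_zero (hP : ∀ n, Nonempty (GradedFreeIso R n (D n)))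
    (t : Tot (TripleTensor k A P) 0)
    (ht : R.augTensor (TensorOver.augLeft R.aug (get₃ t 0 0 0 0 rfl rfl)) = 0) :
    t ∈ LinearMap.range (R.dTriple 0) :=
  (nonempty_rightContraction hP).some.triple.exact_zero
    (R.augTensor ∘ₗ LinearMap.proj (φ := fun i : {i : ℕ × ℕ // i.1 + i.2 = 0} =>
      TensorOver k A (P i.1.1) (P i.1.2)) ⟨(0, 0), rfl⟩)
    (mem_range_dTensor_zero hP) t ht

/-- The component in `P p ⊗_A (P q ⊗_A P r)` of a morphism to the total complex. -/
def component₃ {M : Type*} [AddCommGroup M] [Module k M] [Module A M] [Module Aᵐᵒᵖ M] {n : ℕ}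
    (F : BimodHom k A M (Tot (TripleTensor k A P) n)) (p q r : ℕ) (h : p + q + r = n) :
    BimodHom k A M (TensorOver k A (P p) (TensorOver k A (P q) (P r))) :=
  (F.component ⟨(p, q + r), by omega⟩).component ⟨(q, r), rfl⟩

/-- The pairing `f ⊗ (g ⊗ h) ↦ h ⊗_A (g ⊗_A f)`. -/
def tensorRev (k A M N L : Type*) [Field k] [Ring A] [Algebra k A] [Coalgebra k A]
    [AddCommGroup M] [Module k M] [Module A M] [Module Aᵐᵒᵖ M]
    [IsScalarTower k A M] [IsScalarTower k Aᵐᵒᵖ M] [SMulCommClass A Aᵐᵒᵖ M]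
    [AddCommGroup N] [Module k N] [Module A N] [Module Aᵐᵒᵖ N]
    [IsScalarTower k A N] [IsScalarTower k Aᵐᵒᵖ N] [SMulCommClass A Aᵐᵒᵖ N]
    [AddCommGroup L] [Module k L] [Module A L] [Module Aᵐᵒᵖ L]
    [IsScalarTower k A L] [IsScalarTower k Aᵐᵒᵖ L] [SMulCommClass A Aᵐᵒᵖ L] :
    HomTriv k A M ⊗[k] (HomTriv k A N ⊗[k] HomTriv k A L) →ₗ[k]
      HomTriv k A (TensorOver k A L (TensorOver k A N M)) :=
  HomTriv.tensor k A L (TensorOver k A N M) ∘ₗ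
    LinearMap.lTensor _ (HomTriv.tensor k A N M) ∘ₗ
    (TensorProduct.assoc k _ _ _).toLinearMap ∘ₗ
    LinearMap.rTensor _ (TensorProduct.comm k (HomTriv k A N) (HomTriv k A L)).toLinearMap ∘ₗ
    (TensorProduct.comm k _ _).toLinearMap

theorem tensorRev_tmul (p q r : ℕ) (f : HomTriv k A (P p)) (g : HomTriv k A (P q))
    (h : HomTriv k A (P r)) :
    tensorRev k A (P p) (P q) (P r) (f ⊗ₜ (g ⊗ₜ h)) =
      HomTriv.tensor k A _ _ (h ⊗ₜ HomTriv.tensor k A _ _ (g ⊗ₜ f)) := by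
  simp [tensorRev]

theorem tensorRev_map_d₁ (p q r : ℕ) (f : HomTriv k A (P p)) (g : HomTriv k A (P q))
    (h : HomTriv k A (P r)) (t : TensorOver k A (P (r + 1)) (TensorOver k A (P q) (P p))) :
      (tensorRev k A _ _ _ (f ⊗ₜ (g ⊗ₜ h))).1 (TensorOver.map (R.d r) BimodHom.id t) =
        (tensorRev k A _ _ _ (f ⊗ₜ (g ⊗ₜ R.homD r h))).1 t := by
  rw [tensorRev_tmul, tensorRev_tmul, ← HomTriv.tensor_precomp]
  rfl

theorem tensorRev_map_d₂ (p q r : ℕ) (f : HomTriv k A (P p)) (g : HomTriv k A (P q))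
    (h : HomTriv k A (P r)) (t : TensorOver k A (P r) (TensorOver k A (P (q + 1)) (P p))) :
      (tensorRev k A _ _ _ (f ⊗ₜ (g ⊗ₜ h))).1
        (TensorOver.map BimodHom.id (TensorOver.mapBimod (R.d q) BimodHom.id) t) =
        (tensorRev k A _ _ _ (f ⊗ₜ (R.homD q g ⊗ₜ h))).1 t := by
  rw [tensorRev_tmul, tensorRev_tmul, ← HomTriv.tensor_precomp]
  refine congrArg (fun z => (HomTriv.tensor k A _ _ (h ⊗ₜ z)).1 t) (Subtype.ext ?_)
  exact LinearMap.ext fun x => (HomTriv.tensor_precomp (R.d q) BimodHom.id g f x).symm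

theorem tensorRev_map_d₃ (p q r : ℕ) (f : HomTriv k A (P p)) (g : HomTriv k A (P q))
    (h : HomTriv k A (P r)) (t : TensorOver k A (P r) (TensorOver k A (P q) (P (p + 1)))) :
      (tensorRev k A _ _ _ (f ⊗ₜ (g ⊗ₜ h))).1
        (TensorOver.map BimodHom.id (TensorOver.mapBimod BimodHom.id (R.d p)) t) =
        (tensorRev k A _ _ _ (R.homD p f ⊗ₜ (g ⊗ₜ h))).1 t := by
  rw [tensorRev_tmul, tensorRev_tmul, ← HomTriv.tensor_precomp]
  refine congrArg (fun z => (HomTriv.tensor k A _ _ (h ⊗ₜ z)).1 t) (Subtype.ext ?_)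
  exact LinearMap.ext fun x => (HomTriv.tensor_precomp BimodHom.id (R.d p) g f x).symm

theorem neg_one_pow_eq {m n : ℕ} (c : ℕ) (h : m = n + 2 * c) : (-1 : k) ^ m = (-1) ^ n := by
  rw [h, pow_add, pow_mul]
  simp

/-- The triple product of cochains defined by a morphism to the total complex of
`P ⊗_A (P ⊗_A P)`. The order of the factors is reversed, with the corresponding sign, as is
appropriate for the opposite of the cup product. -/
def revProd {n n' : ℕ} (F : BimodHom k A (P n) (Tot (TripleTensor k A P) n')) (p q r : ℕ)
    (h : p + q + r = n') :
    HomTriv k A (P p) ⊗[k] (HomTriv k A (P q) ⊗[k] HomTriv k A (P r)) →ₗ[k] HomTriv k A (P n) :=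
  (-1 : k) ^ (p * q + p * r + q * r) •
    HomTriv.precomp (component₃ F r q p (by omega)) ∘ₗ tensorRev k A (P p) (P q) (P r)

theorem revProd_apply {n n' : ℕ} (F : BimodHom k A (P n) (Tot (TripleTensor k A P) n'))
    (p q r m : ℕ) (h : p + q + r = n') (hm : q + p = m) (f : HomTriv k A (P p))
    (g : HomTriv k A (P q)) (g' : HomTriv k A (P r)) (x : P n) :
    (revProd F p q r h (f ⊗ₜ (g ⊗ₜ g'))).1 x = (-1 : k) ^ (p * q + p * r + q * r) •
      (tensorRev k A _ _ _ (f ⊗ₜ (g ⊗ₜ g'))).1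
        (get₃ (F.toLin x) r m q p (by omega) (by omega)) := by
  subst hm
  rfl

set_option maxHeartbeats 1000000 in
/-- The analogue of `homotopic₂_precomp` for triple products. -/
theorem homotopic₃_revProd (hP : ∀ n, Nonempty (GradedFreeIso R n (D n)))
    (F F' : ∀ n, BimodHom k A (P n) (Tot (TripleTensor k A P) n))
    (hF : ∀ n x, R.dTriple n ((F (n + 1)).toLin x) = (F n).toLin ((R.d n).toLin x))
    (hF' : ∀ n x, R.dTriple n ((F' (n + 1)).toLin x) = (F' n).toLin ((R.d n).toLin x))
    (h0 : ∀ x, (F 0).toLin x - (F' 0).toLin x ∈ LinearMap.range (R.dTriple 0)) :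
    Homotopic₃ (C := fun n => HomTriv k A (P n)) R.homD
      (fun p q r n h => revProd (F n) p q r h) (fun p q r n h => revProd (F' n) p q r h) := by
  obtain ⟨H, H₀, H₁⟩ := exists_homotopy hP (totD_mem_bimodMaps R.tripleD₁_mem R.tripleD₂_mem)
    (mem_range_dTriple hP) F F' hF hF' h0
  refine ⟨fun p q r n h => revProd (H n) p q r h, ?_, fun p q r n hn => ?_⟩
  · refine TensorProduct.ext (LinearMap.ext fun f => TensorProduct.ext' fun g h =>
      Subtype.ext (LinearMap.ext fun x => ?_))
    have e := congrArg (fun t => get₃ t 0 0 0 0 rfl rfl) (H₀ x)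
    simp only [get₃_dTriple, get₃_sub] at e
    have e' := congrArg (tensorRev k A _ _ _ (f ⊗ₜ (g ⊗ₜ h))).1 e
    simp only [map_sub, pow_zero, one_smul, map_add, tensorRev_map_d₁, tensorRev_map_d₂,
      tensorRev_map_d₃] at e'
    change (revProd (F 0) 0 0 0 rfl (f ⊗ₜ (g ⊗ₜ h))).1 x -
      (revProd (F' 0) 0 0 0 rfl (f ⊗ₜ (g ⊗ₜ h))).1 x =
      (revProd (H 0) 1 0 0 rfl (R.homD 0 f ⊗ₜ (g ⊗ₜ h))).1 x +
      (revProd (H 0) 0 1 0 rfl (f ⊗ₜ (R.homD 0 g ⊗ₜ h))).1 x +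
      (revProd (H 0) 0 0 1 rfl (f ⊗ₜ (g ⊗ₜ R.homD 0 h))).1 x
    rw [revProd_apply (F 0) 0 0 0 0 rfl rfl, revProd_apply (F' 0) 0 0 0 0 rfl rfl,
      revProd_apply (H 0) 1 0 0 1 rfl rfl, revProd_apply (H 0) 0 1 0 1 rfl rfl,
      revProd_apply (H 0) 0 0 1 0 rfl rfl]
    simp only [Nat.mul_zero, Nat.zero_mul, Nat.add_zero, pow_zero, one_smul, e']
    abel
  · refine TensorProduct.ext (LinearMap.ext fun f => TensorProduct.ext' fun g h =>
      Subtype.ext (LinearMap.ext fun x => ?_))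
    have e := congrArg (fun t => get₃ t r (q + p) q p (by omega) rfl) (H₁ n x)
    simp only [get₃_dTriple, get₃_sub, get₃_add] at e
    have e' := congrArg (tensorRev k A _ _ _ (f ⊗ₜ (g ⊗ₜ h))).1 e
    simp only [map_sub, map_add, map_smul, tensorRev_map_d₁, tensorRev_map_d₂,
      tensorRev_map_d₃] at e'
    change (revProd (F (n + 1)) p q r hn (f ⊗ₜ (g ⊗ₜ h))).1 x -
      (revProd (F' (n + 1)) p q r hn (f ⊗ₜ (g ⊗ₜ h))).1 x =
      (revProd (H n) p q r hn (f ⊗ₜ (g ⊗ₜ h))).1 ((R.d n).toLin x) +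
      (revProd (H (n + 1)) (p + 1) q r (by omega) (R.homD p f ⊗ₜ (g ⊗ₜ h))).1 x +
      (-1 : k) ^ p • (revProd (H (n + 1)) p (q + 1) r (by omega) (f ⊗ₜ (R.homD q g ⊗ₜ h))).1 x +
      (-1 : k) ^ (p + q) •
        (revProd (H (n + 1)) p q (r + 1) (by omega) (f ⊗ₜ (g ⊗ₜ R.homD r h))).1 x
    rw [revProd_apply (F (n + 1)) p q r (q + p) hn rfl,
      revProd_apply (F' (n + 1)) p q r (q + p) hn rfl,
      revProd_apply (H n) p q r (q + p) hn rfl,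
      revProd_apply (H (n + 1)) (p + 1) q r (q + p + 1) _ (by omega),
      revProd_apply (H (n + 1)) p (q + 1) r (q + p + 1) _ (by omega),
      revProd_apply (H (n + 1)) p q (r + 1) (q + p) _ rfl, ← smul_sub, e']
    simp only [smul_add, smul_smul, ← pow_add]
    rw [neg_one_pow_eq (k := k) (m := p + (p * (q + 1) + p * r + (q + 1) * r))
        (n := p * q + p * r + q * r + r) p (by ring),
      neg_one_pow_eq (k := k) (m := p + q + (p * q + p * (r + 1) + q * (r + 1)))
        (n := p * q + p * r + q * r) (p + q) (by ring),
      show (p + 1) * q + (p + 1) * r + q * r = p * q + p * r + q * r + (r + q) by ring]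
    abel

end YDResolution

namespace Diagonal

open YDResolution

variable (ω : Diagonal R)

/-- The chain map `(id ⊗ ω) ∘ ω` to the total complex of `P ⊗_A (P ⊗_A P)`. -/
def iterRight (n : ℕ) : BimodHom k A (P n) (Tot (TripleTensor k A P) n) :=
  BimodHom.pi fun i => BimodHom.pi fun j =>
    (TensorOver.mapBimod BimodHom.id (ω.comp j.1.1 j.1.2 i.1.2 j.2)).comp
      (ω.comp i.1.1 i.1.2 n i.2)

/-- The chain map `(ω ⊗ id) ∘ ω`, followed by the associativity isomorphism. -/
def iterLeft (n : ℕ) : BimodHom k A (P n) (Tot (TripleTensor k A P) n) :=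
  BimodHom.pi fun i => BimodHom.pi fun j =>
    (TensorOver.assocBimod k A _ _ _).comp <|
      (TensorOver.mapBimod (ω.comp i.1.1 j.1.1 (i.1.1 + j.1.1) rfl) BimodHom.id).comp
        (ω.comp (i.1.1 + j.1.1) j.1.2 n (by have := i.2; have := j.2; omega))

theorem get₃_iterRight (p m q r n : ℕ) (h : p + m = n) (h' : q + r = m) (x : P n) :
    get₃ ((ω.iterRight n).toLin x) p m q r h h' =
      TensorOver.map BimodHom.id (ω.comp q r m h') ((ω.comp p m n h).toLin x) := rfl

theorem get₃_iterLeft (p m q r N n : ℕ) (h : p + m = n) (h' : q + r = m) (hN : p + q = N)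
    (x : P n) :
    get₃ ((ω.iterLeft n).toLin x) p m q r h h' = TensorOver.assoc k A _ _ _
      (TensorOver.map (ω.comp p q N hN) BimodHom.id ((ω.comp N r n (by omega)).toLin x)) := by
  subst hN
  rfl

theorem dTriple_iterRight (n : ℕ) (x : P (n + 1)) :
    R.dTriple n ((ω.iterRight (n + 1)).toLin x) = (ω.iterRight n).toLin ((R.d n).toLin x) := by
  refine get₃_ext fun p m q r h h' => ?_
  rw [get₃_dTriple, get₃_iterRight, get₃_iterRight, get₃_iterRight, get₃_iterRight]
  rw [ω.comm p m n h x, map_add, map_smul]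
  congr 1
  · generalize (ω.comp (p + 1) m (n + 1) _).toLin x = t
    induction t using TensorOver.induction with
    | tmul x y => simp [BimodHom.id]
    | add s t hs ht => simp only [map_add, hs, ht]
  · congr 1
    generalize (ω.comp p (m + 1) (n + 1) _).toLin x = t
    induction t using TensorOver.induction with
    | tmul x y =>
      simp only [TensorOver.map_mk, BimodHom.id, LinearMap.id_apply, TensorOver.mapBimod_toLin]
      rw [ω.comm q r m h' y, TensorProduct.tmul_add, TensorProduct.tmul_smul, map_add, map_smul]
      rfl
    | add s t hs ht =>
      simp only [map_add, smul_add, ← hs, ← ht]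
      abel

theorem dTriple_iterLeft (n : ℕ) (x : P (n + 1)) :
    R.dTriple n ((ω.iterLeft (n + 1)).toLin x) = (ω.iterLeft n).toLin ((R.d n).toLin x) := by
  refine get₃_ext fun p m q r h h' => ?_
  rw [get₃_dTriple, get₃_iterLeft ω (p + 1) m q r (p + q + 1) _ _ _ (by omega),
    get₃_iterLeft ω p (m + 1) (q + 1) r (p + q + 1) _ _ _ (by omega),
    get₃_iterLeft ω p (m + 1) q (r + 1) (p + q) _ _ _ rfl,
    get₃_iterLeft ω p m q r (p + q) _ _ _ rfl, ω.comm (p + q) r n (by omega) x]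
  have e : ∀ t : TensorOver k A (P (p + q + 1)) (P r),
      TensorOver.map (R.d p) BimodHom.id (TensorOver.assoc k A _ _ _
        (TensorOver.map (ω.comp (p + 1) q (p + q + 1) (by omega)) BimodHom.id t)) +
      (-1 : k) ^ p • TensorOver.map BimodHom.id (TensorOver.mapBimod (R.d q) BimodHom.id)
        (TensorOver.assoc k A _ _ _
          (TensorOver.map (ω.comp p (q + 1) (p + q + 1) (by omega)) BimodHom.id t)) =
      TensorOver.assoc k A _ _ _ (TensorOver.map (ω.comp p q (p + q) rfl) BimodHom.id
        (TensorOver.map (R.d (p + q)) BimodHom.id t)) := fun t => by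
    induction t using TensorOver.induction with
    | tmul y z =>
      have e₁ : ∀ s : TensorOver k A (P (p + 1)) (P q),
          TensorOver.map (R.d p) BimodHom.id (TensorOver.assoc k A _ _ _
            (TensorOver.mk k A _ (P r) (s ⊗ₜ z))) = TensorOver.assoc k A _ _ _
              (TensorOver.mk k A _ _ (TensorOver.map (R.d p) BimodHom.id s ⊗ₜ z)) := fun s => by
        induction s using TensorOver.induction with
        | tmul x y => simp [TensorOver.assoc_mk, BimodHom.id]
        | add s t hs ht => simp only [TensorProduct.add_tmul, map_add, hs, ht]
      simp only [TensorOver.map_mk, BimodHom.id, LinearMap.id_apply] at e₁ ⊢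
      rw [ω.comm p q (p + q) rfl y, TensorProduct.add_tmul, ← TensorProduct.smul_tmul', map_add,
        map_add, map_smul, map_smul]
      congr 1
      · exact e₁ _
      · exact congrArg _ (TensorOver.assoc_map BimodHom.id (R.d q) BimodHom.id _)
    | add s t hs ht =>
      simp only [map_add, smul_add, ← hs, ← ht]
      abel
  have e' : ∀ t : TensorOver k A (P (p + q)) (P (r + 1)),
      TensorOver.map BimodHom.id (TensorOver.mapBimod BimodHom.id (R.d r))
        (TensorOver.assoc k A _ _ _ (TensorOver.map (ω.comp p q (p + q) rfl) BimodHom.id t)) =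
      TensorOver.assoc k A _ _ _ (TensorOver.map (ω.comp p q (p + q) rfl) BimodHom.id
        (TensorOver.map BimodHom.id (R.d r) t)) := fun t => by
    induction t using TensorOver.induction with
    | tmul y z =>
      simp only [TensorOver.map_mk, BimodHom.id, LinearMap.id_apply]
      generalize (ω.comp p q (p + q) rfl).toLin y = s
      induction s using TensorOver.induction with
      | tmul x y => simp [TensorOver.assoc_mk]
      | add s t hs ht => simp only [TensorProduct.add_tmul, map_add, hs, ht]
    | add s t hs ht => simp only [map_add, hs, ht]
  rw [map_add, map_add, map_smul, map_smul, ← e, ← e', smul_add, smul_smul, ← pow_add]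
  exact (add_assoc _ _ _).symm

theorem opCup_tmul (p q n : ℕ) (h : p + q = n) (f : HomTriv k A (P p))
    (g : HomTriv k A (P q)) :
    opCup ω p q n h (f ⊗ₜ g) = (-1 : k) ^ (p * q) • HomTriv.precomp (ω.comp q p n (by omega))
      (HomTriv.tensor k A (P q) (P p) (g ⊗ₜ f)) := rfl

theorem opCup_apply (p q n : ℕ) (h : p + q = n) (f : HomTriv k A (P p)) (g : HomTriv k A (P q))
    (x : P n) : (opCup ω p q n h (f ⊗ₜ g)).1 x = (-1 : k) ^ (p * q) •
      (HomTriv.tensor k A (P q) (P p) (g ⊗ₜ f)).1 ((ω.comp q p n (by omega)).toLin x) := rfl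

theorem revProd_iterRight (p q r n : ℕ) (hn : p + q + r = n) :
    revProd (ω.iterRight n) p q r hn = opCup ω (p + q) r n hn ∘ₗ
      LinearMap.rTensor (HomTriv k A (P r)) (opCup ω p q (p + q) rfl) ∘ₗ
      (TensorProduct.assoc k _ _ _).symm.toLinearMap := by
  refine TensorProduct.ext (LinearMap.ext fun f => TensorProduct.ext' fun g h =>
    Subtype.ext (LinearMap.ext fun x => ?_))
  refine (revProd_apply (ω.iterRight n) p q r (p + q) hn (by omega) f g h x).trans ?_
  rw [get₃_iterRight, tensorRev_tmul, ← HomTriv.tensor_precomp]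
  change _ = ((opCup ω (p + q) r n hn) (opCup ω p q (p + q) rfl (f ⊗ₜ g) ⊗ₜ h)).1 x
  rw [opCup_apply, opCup_tmul, TensorProduct.tmul_smul, map_smul, Submodule.coe_smul,
    LinearMap.smul_apply, smul_smul, ← pow_add]
  congr 2
  ring

theorem revProd_iterLeft (p q r n : ℕ) (hn : p + q + r = n) :
    revProd (ω.iterLeft n) p q r hn = opCup ω p (q + r) n (by omega) ∘ₗ
      LinearMap.lTensor (HomTriv k A (P p)) (opCup ω q r (q + r) rfl) := by
  refine TensorProduct.ext (LinearMap.ext fun f => TensorProduct.ext' fun g h =>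
    Subtype.ext (LinearMap.ext fun x => ?_))
  refine (revProd_apply (ω.iterLeft n) p q r (p + q) hn (by omega) f g h x).trans ?_
  rw [get₃_iterLeft ω r (p + q) q p (q + r) n _ _ (by omega), tensorRev_tmul]
  change _ = ((opCup ω p (q + r) n (by omega)) (f ⊗ₜ opCup ω q r (q + r) rfl (g ⊗ₜ h))).1 x
  rw [opCup_apply, opCup_tmul, ← TensorProduct.smul_tmul', map_smul, Submodule.coe_smul,
    LinearMap.smul_apply, smul_smul, ← pow_add, ← HomTriv.precomp_id f, HomTriv.tensor_precomp,
    HomTriv.precomp_id]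
  congr 1
  · congr 1
    ring
  · generalize TensorOver.map (ω.comp r q (q + r) (by omega)) (BimodHom.id (M := P p)) _ = t
    induction t using TensorOver.induction_left with
    | tmul x y z => simp [TensorOver.assoc_mk, mul_assoc]
    | add s t hs ht => simp only [map_add, hs, ht]

/-- The two iterated products come from `(id ⊗ ω) ∘ ω` and `(ω ⊗ id) ∘ ω`, and both of these chain
maps lift the identity of `A`. -/
theorem homotopic₃_opCup (hP : ∀ n, Nonempty (GradedFreeIso R n (D n))) :
    Homotopic₃ (C := fun n => HomTriv k A (P n)) R.homD
      (fun p q r n h => opCup ω (p + q) r n h ∘ₗ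
        LinearMap.rTensor (HomTriv k A (P r)) (opCup ω p q (p + q) rfl) ∘ₗ
        (TensorProduct.assoc k _ _ _).symm.toLinearMap)
      (fun p q r n h => opCup ω p (q + r) n (by omega) ∘ₗ
        LinearMap.lTensor (HomTriv k A (P p)) (opCup ω q r (q + r) rfl)) := by
  refine (homotopic₃_revProd hP ω.iterRight ω.iterLeft ω.dTriple_iterRight ω.dTriple_iterLeft
    (fun x => mem_range_dTriple_zero hP _ ?_)).congr
    (fun p q r n h => (ω.revProd_iterRight p q r n h).symm)
    (fun p q r n h => (ω.revProd_iterLeft p q r n h).symm)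
  rw [get₃_sub, map_sub, map_sub, sub_eq_zero, get₃_iterRight,
      get₃_iterLeft ω 0 0 0 0 0 0 rfl rfl rfl]
  trans R.aug.toLin x
  · refine (congrArg R.augTensor (augLeft_map (ω.comp 0 0 0 rfl) _)).trans ?_
    rw [ω.augTensor_comp]
    exact ω.augTensor_comp x
  · have e : ∀ (s : TensorOver k A (P 0) (P 0)) (z : P 0),
        R.augTensor (TensorOver.augLeft R.aug (TensorOver.assoc k A _ _ _
          (TensorOver.mk k A _ _ (s ⊗ₜ z)))) = R.augTensor s * R.aug.toLin z := fun s z => by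
      induction s using TensorOver.induction with
      | tmul x y =>
        simp [augTensor, TensorOver.assoc_mk, R.aug.map_left, TensorOver.smul_mk, mul_assoc]
      | add s t hs ht => simp only [TensorProduct.add_tmul, map_add, hs, ht, add_mul]
    have e' : ∀ t : TensorOver k A (P 0) (P 0),
        R.augTensor (TensorOver.augLeft R.aug (TensorOver.assoc k A _ _ _
          (TensorOver.map (ω.comp 0 0 0 rfl) BimodHom.id t))) = R.augTensor t := fun t => by
      induction t using TensorOver.induction with
      | tmul y z =>
        rw [TensorOver.map_mk, e, ω.augTensor_comp]
        simp [augTensor, BimodHom.id, R.aug.map_left]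
      | add s t hs ht => simp only [map_add, hs, ht]
    exact ((e' _).trans (ω.augTensor_comp x)).symm

end Diagonal

end Associativity

/-! ### Braided products -/

namespace YetterDrinfeld

section BraidedProduct

variable {k G : Type*} [Field k] [Group G]

theorem induction {V : Type*} [AddCommGroup V] [Module k V] (Y : YetterDrinfeld k G V)
    {p : V → Prop} (v : V) (mem : ∀ g, ∀ v ∈ Y.deg g, p v)
    (add : ∀ v w, p v → p w → p (v + w)) : p v := by
  have hv : v ∈ ⨆ g, Y.deg g := Y.isGrading.span ▸ Submodule.mem_top
  induction hv using Submodule.iSup_induction' with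
  | mem g v hv => exact mem g v hv
  | zero => exact mem 1 0 (zero_mem _)
  | add v w _ _ hv hw => exact add v w hv hw

theorem tmul_induction {M N : Type*} [AddCommGroup M] [Module k M] [AddCommGroup N] [Module k N]
    (Y : YetterDrinfeld k G N) {p : M ⊗[k] N → Prop} (t : M ⊗[k] N)
    (tmul : ∀ m g, ∀ n ∈ Y.deg g, p (m ⊗ₜ n)) (add : ∀ s t, p s → p t → p (s + t)) : p t := by
  induction t with
  | zero => simpa using tmul 0 1 0 (zero_mem _)
  | add s t hs ht => exact add s t hs ht
  | tmul m n =>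
    induction n using Y.induction with
    | mem g n hn => exact tmul m g n hn
    | add v w hv hw => rw [TensorProduct.tmul_add]; exact add _ _ hv hw

variable {M N K L X Z : Type*} [AddCommGroup M] [Module k M] [AddCommGroup N] [Module k N]
  [AddCommGroup K] [Module k K] [AddCommGroup L] [Module k L]
  [AddCommGroup X] [Module k X] [AddCommGroup Z] [Module k Z]

/-- The braided product `(m ⊗ n) (x ⊗ l) = α m (n₋₁ • x) ⊗ β n₀ l` of two pairings `α` and `β`. -/
def brMul (YN : YetterDrinfeld k G N) (YK : YetterDrinfeld k G K) (α : M →ₗ[k] K →ₗ[k] X)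
    (β : N →ₗ[k] L →ₗ[k] Z) : M ⊗[k] N →ₗ[k] K ⊗[k] L →ₗ[k] X ⊗[k] Z :=
  TensorProduct.curry (TensorProduct.map (TensorProduct.lift α) (TensorProduct.lift β) ∘ₗ
    middleMap M L (YN.braid YK))

theorem brMul_tmul {YN : YetterDrinfeld k G N} {YK : YetterDrinfeld k G K}
    {α : M →ₗ[k] K →ₗ[k] X} {β : N →ₗ[k] L →ₗ[k] Z} {g : G} {n : N} (hn : n ∈ YN.deg g)
    (m : M) (x : K) (l : L) :
    brMul YN YK α β (m ⊗ₜ n) (x ⊗ₜ l) = α m (YK.act g x) ⊗ₜ β n l := by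
  simp [brMul, middleMap, braid_tmul YN YK hn]

/-- Associativity of braided products, for pairings `α` and `β` that are associative separately. The
compatibility with the braiding only uses that `β₁₂` preserves degrees and that `α₂₃` is
equivariant. -/
theorem brMul_assoc {M₁ N₁ M₂ N₂ M₃ N₃ M₁₂ N₁₂ M₂₃ N₂₃ : Type*}
    [AddCommGroup M₁] [Module k M₁] [AddCommGroup N₁] [Module k N₁]
    [AddCommGroup M₂] [Module k M₂] [AddCommGroup N₂] [Module k N₂]
    [AddCommGroup M₃] [Module k M₃] [AddCommGroup N₃] [Module k N₃]
    [AddCommGroup M₁₂] [Module k M₁₂] [AddCommGroup N₁₂] [Module k N₁₂]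
    [AddCommGroup M₂₃] [Module k M₂₃] [AddCommGroup N₂₃] [Module k N₂₃]
    {YN₁ : YetterDrinfeld k G N₁} {YM₂ : YetterDrinfeld k G M₂} {YN₂ : YetterDrinfeld k G N₂}
    {YM₃ : YetterDrinfeld k G M₃} {YN₁₂ : YetterDrinfeld k G N₁₂} {YM₂₃ : YetterDrinfeld k G M₂₃}
    {α₁₂ : M₁ →ₗ[k] M₂ →ₗ[k] M₁₂} {β₁₂ : N₁ →ₗ[k] N₂ →ₗ[k] N₁₂}
    {α₃ : M₁₂ →ₗ[k] M₃ →ₗ[k] X} {β₃ : N₁₂ →ₗ[k] N₃ →ₗ[k] Z}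
    {α₂₃ : M₂ →ₗ[k] M₃ →ₗ[k] M₂₃} {β₂₃ : N₂ →ₗ[k] N₃ →ₗ[k] N₂₃}
    {α₁ : M₁ →ₗ[k] M₂₃ →ₗ[k] X} {β₁ : N₁ →ₗ[k] N₂₃ →ₗ[k] Z}
    (hα : ∀ x y z, α₃ (α₁₂ x y) z = α₁ x (α₂₃ y z)) (hβ : ∀ x y z, β₃ (β₁₂ x y) z = β₁ x (β₂₃ y z))
    (hdeg : ∀ g h, ∀ x ∈ YN₁.deg g, ∀ y ∈ YN₂.deg h, β₁₂ x y ∈ YN₁₂.deg (g * h))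
    (hact : ∀ g x y, YM₂₃.act g (α₂₃ x y) = α₂₃ (YM₂.act g x) (YM₃.act g y))
    (t₁ : M₁ ⊗[k] N₁) (t₂ : M₂ ⊗[k] N₂) (t₃ : M₃ ⊗[k] N₃) :
    brMul YN₁₂ YM₃ α₃ β₃ (brMul YN₁ YM₂ α₁₂ β₁₂ t₁ t₂) t₃ =
      brMul YN₁ YM₂₃ α₁ β₁ t₁ (brMul YN₂ YM₃ α₂₃ β₂₃ t₂ t₃) := by
  induction t₁ using YN₁.tmul_induction with
  | add s t hs ht => simp only [map_add, LinearMap.add_apply, hs, ht]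
  | tmul m₁ g n₁ hn₁ =>
    induction t₂ using YN₂.tmul_induction with
    | add s t hs ht => simp only [map_add, LinearMap.add_apply, hs, ht]
    | tmul m₂ h n₂ hn₂ =>
      induction t₃ with
      | zero => simp only [map_zero]
      | add s t hs ht => simp only [map_add, hs, ht]
      | tmul m₃ n₃ =>
        rw [brMul_tmul hn₁, brMul_tmul (hdeg g h n₁ hn₁ n₂ hn₂), brMul_tmul hn₂, brMul_tmul hn₁,
          hα, hβ, hact, map_mul]
        rfl

/-- Braided products are natural in maps that preserve the degree of the second factor on the left
and commute with the action on the first factor on the right. -/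
theorem map_brMul {M' N' K' L' X' Z' : Type*}
    [AddCommGroup M'] [Module k M'] [AddCommGroup N'] [Module k N']
    [AddCommGroup K'] [Module k K'] [AddCommGroup L'] [Module k L']
    [AddCommGroup X'] [Module k X'] [AddCommGroup Z'] [Module k Z']
    {YN : YetterDrinfeld k G N} {YK : YetterDrinfeld k G K}
    {YN' : YetterDrinfeld k G N'} {YK' : YetterDrinfeld k G K'}
    {α : M →ₗ[k] K →ₗ[k] X} {β : N →ₗ[k] L →ₗ[k] Z}
    {α' : M' →ₗ[k] K' →ₗ[k] X'} {β' : N' →ₗ[k] L' →ₗ[k] Z'}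
    {f : X →ₗ[k] X'} {g : Z →ₗ[k] Z'} (f₁ : M →ₗ[k] M') (g₁ : N →ₗ[k] N') (f₂ : K →ₗ[k] K')
    (g₂ : L →ₗ[k] L') (hf : ∀ m x, f (α m x) = α' (f₁ m) (f₂ x))
    (hg : ∀ n l, g (β n l) = β' (g₁ n) (g₂ l)) (hdeg : ∀ h, ∀ n ∈ YN.deg h, g₁ n ∈ YN'.deg h)
    (hact : ∀ h x, f₂ (YK.act h x) = YK'.act h (f₂ x)) (s : M ⊗[k] N) (t : K ⊗[k] L) :
    TensorProduct.map f g (brMul YN YK α β s t) =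
      brMul YN' YK' α' β' (TensorProduct.map f₁ g₁ s) (TensorProduct.map f₂ g₂ t) := by
  induction s using YN.tmul_induction with
  | add s t hs ht => simp only [map_add, LinearMap.add_apply, hs, ht]
  | tmul m h n hn =>
    induction t with
    | zero => simp only [map_zero]
    | add s t hs ht => simp only [map_add, hs, ht]
    | tmul x l =>
      rw [brMul_tmul hn, TensorProduct.map_tmul, TensorProduct.map_tmul, TensorProduct.map_tmul,
        brMul_tmul (hdeg h n hn), hf, hg, hact]

/-- A multiplicative functional on the second factors, concentrated in degree `1`, takes a braided
product to a product. -/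
theorem rid_brMul {YN : YetterDrinfeld k G N} {YK : YetterDrinfeld k G K}
    {α : M →ₗ[k] K →ₗ[k] X} {β : N →ₗ[k] L →ₗ[k] Z} {ν : Z →ₗ[k] k} (ν₁ : N →ₗ[k] k)
    (ν₂ : L →ₗ[k] k) (hν : ∀ n l, ν (β n l) = ν₁ n * ν₂ l)
    (hν₁ : ∀ g, ∀ n ∈ YN.deg g, g ≠ 1 → ν₁ n = 0) (s : M ⊗[k] N) (t : K ⊗[k] L) :
    TensorProduct.rid k X (LinearMap.lTensor X ν (brMul YN YK α β s t)) =
      α (TensorProduct.rid k M (LinearMap.lTensor M ν₁ s))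
        (TensorProduct.rid k K (LinearMap.lTensor K ν₂ t)) := by
  induction s using YN.tmul_induction with
  | add s t hs ht => simp only [map_add, LinearMap.add_apply, hs, ht]
  | tmul m g n hn =>
    induction t with
    | zero => simp only [map_zero]
    | add s t hs ht => simp only [map_add, hs, ht]
    | tmul x l =>
      rw [brMul_tmul hn]
      by_cases hg : g = 1
      · subst hg
        simp [hν, mul_smul, smul_comm (ν₁ n)]
      · simp [hν, hν₁ g n hn hg]

/-- A multiplicative and invariant functional on the first factors takes a braided product to a
product. -/
theorem lid_brMul {YN : YetterDrinfeld k G N} {YK : YetterDrinfeld k G K}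
    {α : M →ₗ[k] K →ₗ[k] X} {β : N →ₗ[k] L →ₗ[k] Z} {μ : X →ₗ[k] k} (μ₁ : M →ₗ[k] k)
    (μ₂ : K →ₗ[k] k) (hμ : ∀ m x, μ (α m x) = μ₁ m * μ₂ x)
    (hμ₂ : ∀ g x, μ₂ (YK.act g x) = μ₂ x) (s : M ⊗[k] N) (t : K ⊗[k] L) :
    TensorProduct.lid k Z (LinearMap.rTensor Z μ (brMul YN YK α β s t)) =
      β (TensorProduct.lid k N (LinearMap.rTensor N μ₁ s))
        (TensorProduct.lid k L (LinearMap.rTensor L μ₂ t)) := by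
  induction s using YN.tmul_induction with
  | add s t hs ht => simp only [map_add, LinearMap.add_apply, hs, ht]
  | tmul m g n hn =>
    induction t with
    | zero => simp only [map_zero]
    | add s t hs ht => simp only [map_add, hs, ht]
    | tmul x l =>
      rw [brMul_tmul hn]
      simp [hμ, hμ₂, mul_smul, smul_comm (μ₁ m)]

end BraidedProduct

end YetterDrinfeld

open YetterDrinfeld

section Actions

/-- The left action of `A` as a bilinear map. -/
def leftMul (k A M : Type*) [Field k] [Ring A] [Algebra k A] [AddCommGroup M] [Module k M]
    [Module A M] [IsScalarTower k A M] : A →ₗ[k] M →ₗ[k] M :=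
  (Algebra.lsmul k k M : A →ₐ[k] Module.End k M).toLinearMap

/-- The right action of `A` as a bilinear map. -/
def rightMul (k A M : Type*) [Field k] [Ring A] [Algebra k A] [AddCommGroup M] [Module k M]
    [Module Aᵐᵒᵖ M] [IsScalarTower k Aᵐᵒᵖ M] : M →ₗ[k] A →ₗ[k] M :=
  ((Algebra.lsmul k k M : Aᵐᵒᵖ →ₐ[k] Module.End k M).toLinearMap ∘ₗ
    (opLinearEquiv k : A ≃ₗ[k] Aᵐᵒᵖ).toLinearMap).flip

variable {k G A : Type*} [Field k] [Group G] [Ring A] [Algebra k A]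
  {M : Type*} [AddCommGroup M] [Module k M] [Module A M] [Module Aᵐᵒᵖ M]
  [IsScalarTower k A M] [IsScalarTower k Aᵐᵒᵖ M]

@[simp]
theorem leftMul_apply (a : A) (x : M) : leftMul k A M a x = a • x := rfl

@[simp]
theorem rightMul_apply (a : A) (x : M) : rightMul k A M x a = op a • x := rfl

variable {YA : YetterDrinfeld k G A} {YM : YetterDrinfeld k G M}

theorem YetterDrinfeld.tmul_mem {V W : Type*} [AddCommGroup V] [Module k V] [AddCommGroup W]
    [Module k W] {Y : YetterDrinfeld k G V} {Z : YetterDrinfeld k G W} {g h : G} {v : V} {w : W}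
    (hv : v ∈ Y.deg g) (hw : w ∈ Z.deg h) : v ⊗ₜ w ∈ (Y.tensor Z).deg (g * h) :=
  Submodule.subset_span ⟨g, h, v, w, rfl, hv, hw, rfl⟩

namespace IsYDBimodule

theorem act_smul (h : IsYDBimodule YA YM) (g : G) (a : A) (x : M) :
    YM.act g (a • x) = YA.act g a • YM.act g x := by
  simpa [YetterDrinfeld.tensor] using (h.left_hom.map_act g (a ⊗ₜ x)).symm

theorem act_op_smul (h : IsYDBimodule YA YM) (g : G) (a : A) (x : M) :
    YM.act g (op a • x) = op (YA.act g a) • YM.act g x := by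
  simpa [YetterDrinfeld.tensor] using (h.right_hom.map_act g (x ⊗ₜ a)).symm

theorem smul_mem (h : IsYDBimodule YA YM) {s t : G} {a : A} {x : M} (ha : a ∈ YA.deg s)
    (hx : x ∈ YM.deg t) : a • x ∈ YM.deg (s * t) := by
  simpa using h.left_hom.map_deg (s * t) (a ⊗ₜ x) (tmul_mem ha hx)

theorem op_smul_mem (h : IsYDBimodule YA YM) {s t : G} {a : A} {x : M} (hx : x ∈ YM.deg s)
    (ha : a ∈ YA.deg t) : op a • x ∈ YM.deg (s * t) := by
  simpa using h.right_hom.map_deg (s * t) (x ⊗ₜ a) (tmul_mem hx ha)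

end IsYDBimodule

namespace IsBimonoid

variable [Coalgebra k A]

theorem isYDBimodule (hA : IsBimonoid YA) : IsYDBimodule YA YA where
  left_hom := by
    convert hA.mul_hom using 1
    exact TensorProduct.ext' fun a b => rfl
  right_hom := by
    convert hA.mul_hom using 1
    exact TensorProduct.ext' fun a b => rfl

theorem one_mem (hA : IsBimonoid YA) : (1 : A) ∈ YA.deg 1 := by
  have := hA.one_hom.map_deg 1 1 (by simp [YetterDrinfeld.unit])
  simpa using this

theorem counit_act (hA : IsBimonoid YA) (g : G) (a : A) :
    Coalgebra.counit (R := k) (YA.act g a) = Coalgebra.counit (R := k) a := by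
  simpa [YetterDrinfeld.unit] using hA.counit_hom.map_act g a

theorem counit_eq_zero (hA : IsBimonoid YA) (g : G) (a : A) (ha : a ∈ YA.deg g) (hg : g ≠ 1) :
    Coalgebra.counit (R := k) a = 0 := by
  simpa [YetterDrinfeld.unit, hg] using hA.counit_hom.map_deg g a ha

theorem comul_mul' (hA : IsBimonoid YA) (a b : A) : Coalgebra.comul (R := k) (a * b) =
    brMul YA YA (LinearMap.mul k A) (LinearMap.mul k A) (Coalgebra.comul a)
      (Coalgebra.comul b) :=
  LinearMap.congr_fun hA.comul_mul (a ⊗ₜ b)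

end IsBimonoid

end Actions

section TwTensor

variable {k G A : Type*} [Field k] [Group G] [Ring A] [Algebra k A] [Coalgebra k A]
  {YA : YetterDrinfeld k G A}
  {M N : Type*} [AddCommGroup M] [Module k M] [Module A M] [Module Aᵐᵒᵖ M]
  [IsScalarTower k A M] [IsScalarTower k Aᵐᵒᵖ M] [SMulCommClass A Aᵐᵒᵖ M]
  [AddCommGroup N] [Module k N] [Module A N] [Module Aᵐᵒᵖ N]
  [IsScalarTower k A N] [IsScalarTower k Aᵐᵒᵖ N] [SMulCommClass A Aᵐᵒᵖ N]
  {YM : YetterDrinfeld k G M} {YN : YetterDrinfeld k G N}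

set_option linter.unusedVariables false in
/-- The tensor product over `k` of two bimodules in Yetter–Drinfeld modules, as an `A`-bimodule:
the natural bimodule structure over the braided tensor product algebra `A ⊗ A` is restricted along
the comultiplication `A → A ⊗ A`. -/
def TwTensor (hA : IsBimonoid YA) (hM : IsYDBimodule YA YM) (hN : IsYDBimodule YA YN) : Type _ :=
  M ⊗[k] N

namespace TwTensor

variable {hA : IsBimonoid YA} {hM : IsYDBimodule YA YM} {hN : IsYDBimodule YA YN}

instance : AddCommGroup (TwTensor hA hM hN) := inferInstanceAs (AddCommGroup (M ⊗[k] N))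

instance : Module k (TwTensor hA hM hN) := inferInstanceAs (Module k (M ⊗[k] N))

variable (hA hM hN) in
/-- The left action of `A`, `a · (x ⊗ y) = a₁ (a₂₋₁ x) ⊗ a₂₀ y`. -/
def leftAct : A →+* Module.End k (TwTensor hA hM hN) where
  toFun a := brMul YA YM (leftMul k A M) (leftMul k A N) (Coalgebra.comul a)
  map_one' := by
    refine TensorProduct.ext' fun x y => ?_
    rw [hA.comul_one, brMul_tmul hA.one_mem]
    simp only [map_one, Module.End.one_apply, leftMul_apply, one_smul]
    rfl
  map_mul' a b := by
    ext t
    rw [hA.comul_mul']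
    exact brMul_assoc (fun a b x => mul_smul a b x) (fun a b x => mul_smul a b x)
      (fun g h x hx y hy => hA.isYDBimodule.smul_mem hx hy) hM.act_smul _ _ _
  map_zero' := by simp only [map_zero]; rfl
  map_add' a b := by simp only [map_add]; rfl

variable (hA hM hN) in
/-- The right action of `A`, `(x ⊗ y) · a = x (y₋₁ a₁) ⊗ y₀ a₂`. -/
def rightAct : Aᵐᵒᵖ →+* Module.End k (TwTensor hA hM hN) where
  toFun a := (brMul YN YA (rightMul k A M) (rightMul k A N)).flip (Coalgebra.comul a.unop)
  map_one' := by
    refine TensorProduct.ext' fun x y => ?_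
    rw [unop_one, hA.comul_one, LinearMap.flip_apply]
    induction y using YN.induction with
    | mem g y hy =>
      have h1 : YA.act g (1 : A) = 1 := by
        simpa [YetterDrinfeld.unit] using (hA.one_hom.map_act g 1).symm
      rw [brMul_tmul hy, h1]
      simp only [rightMul_apply, op_one, one_smul]
      rfl
    | add v w hv hw =>
      rw [TensorProduct.tmul_add, map_add, LinearMap.add_apply, hv, hw]
      rfl
  map_mul' a b := by
    ext t
    rw [unop_mul, hA.comul_mul']
    exact (brMul_assoc (fun x a b => (mul_smul (op b) (op a) x).symm)
      (fun x a b => (mul_smul (op b) (op a) x).symm)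
      (fun g h x hx y hy => hN.op_smul_mem hx hy) hA.isYDBimodule.act_smul _ _ _).symm
  map_zero' := by simp only [unop_zero, map_zero]; rfl
  map_add' a b := by simp only [unop_add, map_add]; rfl

instance : Module A (TwTensor hA hM hN) := Module.compHom _ (leftAct hA hM hN)

instance : Module Aᵐᵒᵖ (TwTensor hA hM hN) := Module.compHom _ (rightAct hA hM hN)

theorem smul_def (a : A) (t : TwTensor hA hM hN) :
    a • t = brMul YA YM (leftMul k A M) (leftMul k A N) (Coalgebra.comul a) t := rfl

theorem op_smul_def (a : A) (t : TwTensor hA hM hN) :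
    op a • t = brMul YN YA (rightMul k A M) (rightMul k A N) t (Coalgebra.comul a) := rfl

instance : IsScalarTower k A (TwTensor hA hM hN) where
  smul_assoc c a t := by
    rw [smul_def, smul_def, map_smul, map_smul]
    rfl

instance : IsScalarTower k Aᵐᵒᵖ (TwTensor hA hM hN) where
  smul_assoc c a t := by
    induction a using MulOpposite.rec' with
    | h a =>
      rw [← op_smul, op_smul_def, op_smul_def, map_smul, map_smul]
      rfl

instance : SMulCommClass A Aᵐᵒᵖ (TwTensor hA hM hN) where
  smul_comm a b t := by
    induction b using MulOpposite.rec' with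
    | h b =>
      exact (brMul_assoc (fun a x b => (smul_comm a (op b) x).symm)
        (fun a x b => (smul_comm a (op b) x).symm)
        (fun g h x hx y hy => hN.smul_mem hx hy) (fun g x a => hM.act_op_smul g a x) _ _ _).symm

variable {M' N' : Type*} [AddCommGroup M'] [Module k M'] [Module A M'] [Module Aᵐᵒᵖ M']
  [IsScalarTower k A M'] [IsScalarTower k Aᵐᵒᵖ M'] [SMulCommClass A Aᵐᵒᵖ M']
  [AddCommGroup N'] [Module k N'] [Module A N'] [Module Aᵐᵒᵖ N']
  [IsScalarTower k A N'] [IsScalarTower k Aᵐᵒᵖ N'] [SMulCommClass A Aᵐᵒᵖ N']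
  {YM' : YetterDrinfeld k G M'} {YN' : YetterDrinfeld k G N'}
  {hM' : IsYDBimodule YA YM'} {hN' : IsYDBimodule YA YN'}

/-- Functoriality of `TwTensor` in morphisms of bimodules in Yetter–Drinfeld modules. -/
def map (f : BimodHom k A M M') (g : BimodHom k A N N') (hf : YM.IsHom YM' f.toLin)
    (hg : YN.IsHom YN' g.toLin) : BimodHom k A (TwTensor hA hM hN) (TwTensor hA hM' hN') where
  toLin := TensorProduct.map f.toLin g.toLin
  map_left a t := by
    rw [smul_def, smul_def]
    refine (map_brMul (YN' := YA) (α' := leftMul k A M') (β' := leftMul k A N') LinearMap.id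
      LinearMap.id f.toLin g.toLin f.map_left g.map_left (fun _ _ h => h) hf.map_act _ _).trans ?_
    rw [TensorProduct.map_id]
    rfl
  map_right a t := by
    rw [op_smul_def, op_smul_def]
    refine (map_brMul (YK' := YA) (α' := rightMul k A M') (β' := rightMul k A N') f.toLin g.toLin
      LinearMap.id LinearMap.id (fun x a => f.map_right a x) (fun x a => g.map_right a x)
      hg.map_deg (fun _ _ => rfl) _ _).trans ?_
    rw [TensorProduct.map_id]
    rfl

variable (hA) in
/-- The comultiplication as a bimodule morphism. -/
def comul : BimodHom k A A (TwTensor hA hA.isYDBimodule hA.isYDBimodule) where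
  toLin := (Coalgebra.comul : A →ₗ[k] A ⊗[k] A)
  map_left a b := hA.comul_mul' a b
  map_right a b := hA.comul_mul' b a

end TwTensor

end TwTensor

/-! ### The Yetter–Drinfeld structure on cochains -/

section InternalHom

variable {k G A : Type*} [Field k] [Group G] [Ring A] [Algebra k A] [Coalgebra k A]
  {YA : YetterDrinfeld k G A}
  {M N : Type*} [AddCommGroup M] [Module k M] [Module A M] [Module Aᵐᵒᵖ M]
  [IsScalarTower k A M] [IsScalarTower k Aᵐᵒᵖ M]
  [AddCommGroup N] [Module k N] [Module A N] [Module Aᵐᵒᵖ N]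
  [IsScalarTower k A N] [IsScalarTower k Aᵐᵒᵖ N]
  {YM : YetterDrinfeld k G M} {YN : YetterDrinfeld k G N}

namespace HomTriv

/-- The action `(g • f) x = f (g⁻¹ • x)` of `G` on the bimodule maps from `M` to `k`. -/
def act (hA : IsBimonoid YA) (hM : IsYDBimodule YA YM) : Representation k G (HomTriv k A M) where
  toFun g := (LinearMap.lcomp k k (YM.act g⁻¹)).restrict fun f hf =>
    ⟨fun a x => by simp [hM.act_smul, hf.1, hA.counit_act],
      fun a x => by simp [hM.act_op_smul, hf.2, hA.counit_act]⟩
  map_one' := by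
    ext f x
    simp
  map_mul' g h := by
    ext f x
    simp
    rfl

variable (A YM) in
/-- The bimodule maps of degree `h`: those that vanish on all `M_s` with `s ≠ h⁻¹`. -/
def deg (h : G) : Submodule k (HomTriv k A M) where
  carrier := {f | ∀ s, s ≠ h⁻¹ → ∀ x ∈ YM.deg s, f.1 x = 0}
  add_mem' hf hg s hs x hx := by simp [hf s hs x hx, hg s hs x hx]
  zero_mem' s _ x _ := by simp
  smul_mem' c f hf s hs x hx := by simp [hf s hs x hx]

theorem ext_homogeneous {f f' : HomTriv k A M} (h : ∀ s, ∀ x ∈ YM.deg s, f.1 x = f'.1 x) :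
    f = f' := by
  refine Subtype.ext (LinearMap.ext fun x => ?_)
  induction x using YM.induction with
  | mem s x hx => exact h s x hx
  | add v w hv hw => rw [map_add, map_add, hv, hw]

variable (YM) in
/-- The projection of `M` onto its component of degree `s`. -/
def proj (s : G) : M →ₗ[k] M := Finsupp.lapply s ∘ₗ YM.isGrading.coact

theorem proj_of_mem {s : G} {x : M} (hx : x ∈ YM.deg s) : proj YM s x = x := by
  simp [proj, YM.isGrading.coact_of_mem hx]

theorem proj_of_mem_of_ne {s t : G} (h : t ≠ s) {x : M} (hx : x ∈ YM.deg t) :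
    proj YM s x = 0 := by
  simp [proj, YM.isGrading.coact_of_mem hx, h]

/-- The component of degree `s⁻¹` of a bimodule map: it agrees with `f` on `M_s` and vanishes on the
other components of `M`. It is a bimodule map because the counit is concentrated in degree `1`. -/
def component (hA : IsBimonoid YA) (hM : IsYDBimodule YA YM) (s : G) (f : HomTriv k A M) :
    HomTriv k A M :=
  ⟨f.1 ∘ₗ proj YM s, fun a x => by
    induction a using YA.induction with
    | add a b ha hb => simp only [add_smul, map_add, ha, hb, add_mul]
    | mem g a ha =>
      induction x using YM.induction with
      | add x y hx hy => simp only [smul_add, map_add, hx, hy, mul_add]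
      | mem t x hx =>
        by_cases hg : g = 1
        · subst hg
          have := hM.smul_mem ha hx
          rw [one_mul] at this
          by_cases ht : t = s
          · subst ht
            simp [proj_of_mem this, proj_of_mem hx, f.2.1]
          · simp [proj_of_mem_of_ne ht this, proj_of_mem_of_ne ht hx]
        · rw [hA.counit_eq_zero g a ha hg, zero_mul]
          by_cases ht : g * t = s
          · subst ht
            simp [proj_of_mem (hM.smul_mem ha hx), f.2.1, hA.counit_eq_zero g a ha hg]
          · simp [proj_of_mem_of_ne ht (hM.smul_mem ha hx)], fun a x => by
    induction a using YA.induction with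
    | add a b ha hb => simp only [op_add, add_smul, map_add, ha, hb, mul_add]
    | mem g a ha =>
      induction x using YM.induction with
      | add x y hx hy => simp only [smul_add, map_add, hx, hy, add_mul]
      | mem t x hx =>
        by_cases hg : g = 1
        · subst hg
          have := hM.op_smul_mem hx ha
          rw [mul_one] at this
          by_cases ht : t = s
          · subst ht
            simp [proj_of_mem this, proj_of_mem hx, f.2.2]
          · simp [proj_of_mem_of_ne ht this, proj_of_mem_of_ne ht hx]
        · rw [hA.counit_eq_zero g a ha hg, mul_zero]
          by_cases ht : t * g = s
          · subst ht
            simp [proj_of_mem (hM.op_smul_mem hx ha), f.2.2, hA.counit_eq_zero g a ha hg]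
          · simp [proj_of_mem_of_ne ht (hM.op_smul_mem hx ha)]⟩

theorem component_apply (hA : IsBimonoid YA) (hM : IsYDBimodule YA YM) (s : G)
    (f : HomTriv k A M) (x : M) : (component hA hM s f).1 x = f.1 (proj YM s x) := rfl

/-- The bimodule maps from `M` to `k` are graded as soon as they are determined by their restriction
to finitely many components of `M`. -/
theorem isGrading (hA : IsBimonoid YA) (hM : IsYDBimodule YA YM) (S : Finset G)
    (hS : ∀ f : HomTriv k A M, (∀ s ∈ S, ∀ x ∈ YM.deg s, f.1 x = 0) → f = 0) :
    IsGrading (V := HomTriv k A M) (deg A YM) where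
  indep := by
    intro g
    rw [Submodule.disjoint_def]
    intro f hf hf'
    let W : Submodule k (HomTriv k A M) :=
      { carrier := {f | ∀ x ∈ YM.deg g⁻¹, f.1 x = 0}
        add_mem' := fun hf hg x hx => by simp [hf x hx, hg x hx]
        zero_mem' := fun x _ => by simp
        smul_mem' := fun c f hf x hx => by simp [hf x hx] }
    have hle : (⨆ (j) (_ : j ≠ g), deg A YM j) ≤ W :=
      iSup₂_le fun j hj f hf x hx => hf g⁻¹ (fun h => hj (inv_injective h.symm)) x hx
    refine ext_homogeneous (YM := YM) fun s x hx => ?_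
    by_cases hs : s = g⁻¹
    · subst hs
      exact hle hf' x hx
    · exact hf s hs x hx
  span := by
    classical
    refine eq_top_iff.2 fun f _ => ?_
    have e : f = ∑ s ∈ S, component hA hM s f := by
      refine sub_eq_zero.1 (hS _ fun s hs x hx => ?_)
      rw [Submodule.coe_sub, LinearMap.sub_apply, sub_eq_zero, Submodule.coe_sum,
        LinearMap.sum_apply, Finset.sum_eq_single_of_mem s hs, component_apply, proj_of_mem hx]
      intro t _ ht
      rw [component_apply, proj_of_mem_of_ne ht.symm hx, map_zero]
    rw [e]
    refine sum_mem fun s _ => Submodule.mem_iSup_of_mem s⁻¹ fun t ht x hx => ?_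
    rw [inv_inv] at ht
    rw [component_apply, proj_of_mem_of_ne ht hx, map_zero]

/-- The Yetter–Drinfeld structure of the internal hom on the bimodule maps from `M` to `k`. -/
def yd (hA : IsBimonoid YA) (hM : IsYDBimodule YA YM)
    (hgr : IsGrading (V := HomTriv k A M) (deg A YM)) :
    YetterDrinfeld k G (HomTriv k A M) where
  act := act hA hM
  deg := deg A YM
  isGrading := hgr
  act_mem g h f hf s hs x hx := by
    refine hf _ (fun e => hs ?_) _ (YM.act_mem g⁻¹ s x hx)
    rw [inv_inv] at e
    have : s = g * (g⁻¹ * s * g) * g⁻¹ := by group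
    rw [this, e]
    group

theorem isInternalHom (hA : IsBimonoid YA) (hM : IsYDBimodule YA YM)
    (hgr : IsGrading (V := HomTriv k A M) (deg A YM)) : IsInternalHom YM (yd hA hM hgr) where
  act_apply _ _ _ := by
    simp only [yd, YetterDrinfeld.unit]
    rfl
  mem_deg h f := by
    refine forall_congr' fun s => ?_
    by_cases hs : s = h⁻¹
    · subst hs
      simp [YetterDrinfeld.unit]
    · have : ¬ h * s = 1 := fun e => hs (eq_inv_of_mul_eq_one_right e)
      simp [YetterDrinfeld.unit, this, hs]

theorem isHom_precomp (hA : IsBimonoid YA) {hM : IsYDBimodule YA YM} {hN : IsYDBimodule YA YN}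
    {hgM : IsGrading (V := HomTriv k A M) (deg A YM)}
    {hgN : IsGrading (V := HomTriv k A N) (deg A YN)} (φ : BimodHom k A M N)
    (hφ : YM.IsHom YN φ.toLin) :
    (yd hA hN hgN).IsHom (yd hA hM hgM) (HomTriv.precomp φ) where
  map_act _ f := Subtype.ext <| LinearMap.ext fun x => congrArg f.1 (hφ.map_act _ x).symm
  map_deg _ _ hf s hs x hx := hf s hs _ (hφ.map_deg s x hx)

end HomTriv

/-- The degrees of a finite set of homogeneous free generators determine the degrees in which a
bimodule map to `k` is supported. -/
theorem GradedFreeIso.isGrading {P : ℕ → Type*} [∀ n, AddCommGroup (P n)] [∀ n, Module k (P n)]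
    [∀ n, Module A (P n)] [∀ n, Module Aᵐᵒᵖ (P n)] [∀ n, IsScalarTower k A (P n)]
    [∀ n, IsScalarTower k Aᵐᵒᵖ (P n)] [∀ n, SMulCommClass A Aᵐᵒᵖ (P n)] {R : YDResolution YA P}
    {V : Type*} [AddCommGroup V] [Module k V] [FiniteDimensional k V] {D : G → Submodule k V}
    {n : ℕ} (i : GradedFreeIso R n D) (hA : IsBimonoid YA) (hD : IsGrading D) :
    IsGrading (V := HomTriv k A (P n)) (HomTriv.deg A (R.yd n)) := by
  have hfin : {g | D g ≠ ⊥}.Finite := WellFoundedGT.finite_ne_bot_of_iSupIndep hD.indep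
  refine HomTriv.isGrading hA (R.isYDBimodule n) hfin.toFinset fun f hf => ?_
  have hv : ∀ v : V, f.1 (i.equiv (1 ⊗ₜ (v ⊗ₜ 1))) = 0 := fun v => by
    have hv : v ∈ ⨆ g, D g := hD.span ▸ Submodule.mem_top
    induction hv using Submodule.iSup_induction' with
    | zero => simp
    | add v w _ _ hv hw =>
      rw [TensorProduct.add_tmul, TensorProduct.tmul_add, map_add, map_add, hv, hw, add_zero]
    | mem g v hv =>
      by_cases hg : D g = ⊥
      · rw [hg, Submodule.mem_bot] at hv
        simp [hv]
      · refine hf g (by simpa using hg) _ ((i.map_deg g _).1 ?_)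
        exact Submodule.subset_span ⟨1, g, 1, v ⊗ₜ 1, one_mul g, hA.one_mem,
          Submodule.subset_span ⟨g, 1, v, 1, mul_one g, hv, hA.one_mem, rfl⟩, rfl⟩
  refine Subtype.ext (LinearMap.ext fun x => ?_)
  induction x using i.induction with
  | tmul a v c => rw [i.equiv_tmul, f.2.1, f.2.2, hv, zero_mul, mul_zero]; rfl
  | add x y hx hy => rw [map_add, map_add, hx, hy]

end InternalHom

/-! ### The complex `P ⊗ P` and the comultiplication -/

namespace YDResolution

variable {k G A : Type*} [Field k] [Group G] [Ring A] [Algebra k A] [Coalgebra k A]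
  {YA : YetterDrinfeld k G A}
  {P : ℕ → Type*} [∀ n, AddCommGroup (P n)] [∀ n, Module k (P n)] [∀ n, Module A (P n)]
  [∀ n, Module Aᵐᵒᵖ (P n)] [∀ n, IsScalarTower k A (P n)] [∀ n, IsScalarTower k Aᵐᵒᵖ (P n)]
  [∀ n, SMulCommClass A Aᵐᵒᵖ (P n)] (R : YDResolution YA P) (hA : IsBimonoid YA)
  {V : ℕ → Type*} [∀ n, AddCommGroup (V n)] [∀ n, Module k (V n)] {D : ∀ n, G → Submodule k (V n)}

/-- The double complex `P p ⊗ P q` of bimodules, where `A` acts through its comultiplication. -/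
abbrev TwComplex (p q : ℕ) : Type _ := TwTensor hA (R.isYDBimodule p) (R.isYDBimodule q)

/-- The horizontal differential of the double complex `P ⊗ P`. -/
def twD₁ (p q : ℕ) : BimodHom k A (R.TwComplex hA (p + 1) q) (R.TwComplex hA p q) :=
  TwTensor.map (R.d p) BimodHom.id (R.d_hom p) ⟨fun _ _ => rfl, fun _ _ h => h⟩

/-- The vertical differential of the double complex `P ⊗ P`. -/
def twD₂ (p q : ℕ) : BimodHom k A (R.TwComplex hA p (q + 1)) (R.TwComplex hA p q) :=
  TwTensor.map BimodHom.id (R.d q) ⟨fun _ _ => rfl, fun _ _ h => h⟩ (R.d_hom q)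

/-- The differential of the total complex of `P ⊗ P`. -/
abbrev dTw (n : ℕ) : Tot (R.TwComplex hA) (n + 1) →ₗ[k] Tot (R.TwComplex hA) n :=
  totD (X := R.TwComplex hA) (fun p q => (R.twD₁ hA p q).toLin) (fun p q => (R.twD₂ hA p q).toLin) n

variable {R}

/-- The rows of `P ⊗ P` are contracted onto `A ⊗ P`. -/
def RightContraction.tw (c : RightContraction R) :
    RowContraction (X := R.TwComplex hA) (Y := fun q => A ⊗[k] P q)
      (fun p q => (R.twD₁ hA p q).toLin) (fun p q => (R.twD₂ hA p q).toLin)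
      (fun q => LinearMap.lTensor A (R.d q).toLin) where
  e q := LinearMap.rTensor (P q) R.aug.toLin
  u q := LinearMap.rTensor (P q) (rightMul k A (P 0) c.u)
  s p q := LinearMap.rTensor (P q) (c.s p)
  e_d₁ q t := by
    have e : R.aug.toLin ∘ₗ (R.d 0).toLin = 0 := LinearMap.ext R.aug_d
    change (LinearMap.rTensor (P q) R.aug.toLin ∘ₗ LinearMap.rTensor (P q) (R.d 0).toLin) t = 0
    rw [← LinearMap.rTensor_comp, e, LinearMap.rTensor_zero]
    rfl
  e_d₂ q t := LinearMap.congr_fun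
    ((LinearMap.rTensor_comp_lTensor _ R.aug.toLin (R.d q).toLin).trans
    (LinearMap.lTensor_comp_rTensor _ R.aug.toLin (R.d q).toLin).symm) t
  u_d q t := LinearMap.congr_fun
    ((LinearMap.rTensor_comp_lTensor _ (rightMul k A (P 0) c.u) (R.d q).toLin).trans
      (LinearMap.lTensor_comp_rTensor _ (rightMul k A (P 0) c.u) (R.d q).toLin).symm) t
  s_d₂ p q t := LinearMap.congr_fun ((LinearMap.rTensor_comp_lTensor _ (c.s p) (R.d q).toLin).trans
    (LinearMap.lTensor_comp_rTensor _ (c.s p) (R.d q).toLin).symm) t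
  ds_zero q t := by
    have e : (R.d 0).toLin ∘ₗ c.s 0 + rightMul k A (P 0) c.u ∘ₗ R.aug.toLin = LinearMap.id :=
      LinearMap.ext c.ds_zero
    have e' := LinearMap.congr_fun (congrArg (LinearMap.rTensor (P q)) e) t
    rw [LinearMap.rTensor_add, LinearMap.rTensor_comp, LinearMap.rTensor_comp,
      LinearMap.rTensor_id] at e'
    exact e'
  ds_succ p q t := by
    have e : (R.d (p + 1)).toLin ∘ₗ c.s (p + 1) + c.s p ∘ₗ (R.d p).toLin = LinearMap.id :=
      LinearMap.ext (c.ds_succ p)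
    have e' := LinearMap.congr_fun (congrArg (LinearMap.rTensor (P q)) e) t
    rw [LinearMap.rTensor_add, LinearMap.rTensor_comp, LinearMap.rTensor_comp,
      LinearMap.rTensor_id] at e'
    exact e'

theorem mem_range_dTw (hP : ∀ n, Nonempty (GradedFreeIso R n (D n))) (m : ℕ)
    (t : Tot (R.TwComplex hA) (m + 1)) (ht : R.dTw hA m t = 0) :
    t ∈ LinearMap.range (R.dTw hA (m + 1)) :=
  ((nonempty_rightContraction hP).some.tw hA).exact
    (fun m y h => (Module.Flat.lTensor_exact A (R.exact_d m) y).1 h) m t ht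

theorem mem_range_dTw_zero (hP : ∀ n, Nonempty (GradedFreeIso R n (D n)))
    (t : Tot (R.TwComplex hA) 0)
    (ht : TensorProduct.map R.aug.toLin R.aug.toLin (t ⟨(0, 0), rfl⟩ : P 0 ⊗[k] P 0) = 0) :
    t ∈ LinearMap.range (R.dTw hA 0) :=
  ((nonempty_rightContraction hP).some.tw hA).exact_zero (LinearMap.lTensor A R.aug.toLin)
    (fun y h => (Module.Flat.lTensor_exact A R.exact_aug y).1 h) t
    ((LinearMap.congr_fun (LinearMap.lTensor_comp_rTensor _ R.aug.toLin R.aug.toLin) _).trans ht)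

/-- The comultiplication of `A` lifts to a chain map of bimodules `P → P ⊗ A`. -/
theorem exists_rightComul (hP : ∀ n, Nonempty (GradedFreeIso R n (D n))) :
    ∃ ρ : ∀ n, BimodHom k A (P n) (TwTensor hA (R.isYDBimodule n) hA.isYDBimodule),
      (∀ x, LinearMap.rTensor A R.aug.toLin ((ρ 0).toLin x) =
        Coalgebra.comul (R := k) (R.aug.toLin x)) ∧
      ∀ n x, LinearMap.rTensor A (R.d n).toLin ((ρ (n + 1)).toLin x) =
        (ρ n).toLin ((R.d n).toLin x) := by
  have hid : YA.IsHom YA (BimodHom.id (k := k) (A := A) (M := A)).toLin :=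
    ⟨fun _ _ => rfl, fun _ _ h => h⟩
  exact exists_chainMap (T := fun n => TwTensor hA (R.isYDBimodule n) hA.isYDBimodule) hP
    (fun n => (TwTensor.map (R.d n) BimodHom.id (R.d_hom n) hid).toLin_mem)
    (fun m t h => (Module.Flat.rTensor_exact A (R.exact_d m) t).1 h)
    (TwTensor.map (hA := hA) (hM' := hA.isYDBimodule) (hN' := hA.isYDBimodule) R.aug BimodHom.id
      R.aug_hom hid).toLin_mem
    (fun t h => (Module.Flat.rTensor_exact A R.exact_aug t).1 h)
    (TwTensor.comul hA).toLin_mem (fun a => LinearMap.rTensor_surjective A R.aug_surjective _)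

/-- The comultiplication of `A` lifts to a chain map of bimodules `P → A ⊗ P`. -/
theorem exists_leftComul (hP : ∀ n, Nonempty (GradedFreeIso R n (D n))) :
    ∃ l : ∀ n, BimodHom k A (P n) (TwTensor hA hA.isYDBimodule (R.isYDBimodule n)),
      (∀ x, LinearMap.lTensor A R.aug.toLin ((l 0).toLin x) =
        Coalgebra.comul (R := k) (R.aug.toLin x)) ∧
      ∀ n x, LinearMap.lTensor A (R.d n).toLin ((l (n + 1)).toLin x) =
        (l n).toLin ((R.d n).toLin x) := by
  have hid : YA.IsHom YA (BimodHom.id (k := k) (A := A) (M := A)).toLin :=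
    ⟨fun _ _ => rfl, fun _ _ h => h⟩
  exact exists_chainMap (T := fun n => TwTensor hA hA.isYDBimodule (R.isYDBimodule n)) hP
    (fun n => (TwTensor.map BimodHom.id (R.d n) hid (R.d_hom n)).toLin_mem)
    (fun m t h => (Module.Flat.lTensor_exact A (R.exact_d m) t).1 h)
    (TwTensor.map (hA := hA) (hM' := hA.isYDBimodule) (hN' := hA.isYDBimodule) BimodHom.id R.aug
      hid R.aug_hom).toLin_mem
    (fun t h => (Module.Flat.lTensor_exact A R.exact_aug t).1 h)
    (TwTensor.comul hA).toLin_mem (fun a => LinearMap.lTensor_surjective A R.aug_surjective _)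

end YDResolution

namespace TwTensor

variable {k G A : Type*} [Field k] [Group G] [Ring A] [Algebra k A] [Coalgebra k A]
  {YA : YetterDrinfeld k G A}
  {M N : Type*} [AddCommGroup M] [Module k M] [Module A M] [Module Aᵐᵒᵖ M]
  [IsScalarTower k A M] [IsScalarTower k Aᵐᵒᵖ M] [SMulCommClass A Aᵐᵒᵖ M]
  [AddCommGroup N] [Module k N] [Module A N] [Module Aᵐᵒᵖ N]
  [IsScalarTower k A N] [IsScalarTower k Aᵐᵒᵖ N] [SMulCommClass A Aᵐᵒᵖ N]
  {YM : YetterDrinfeld k G M} {YN : YetterDrinfeld k G N}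
  {hA : IsBimonoid YA} {hM : IsYDBimodule YA YM} {hN : IsYDBimodule YA YN}

variable (hA hM) in
/-- The map `id ⊗ ε : M ⊗ A → M`. -/
def counitRight : BimodHom k A (TwTensor hA hM hA.isYDBimodule) M where
  toLin := (TensorProduct.rid k M).toLinearMap ∘ₗ LinearMap.lTensor M Coalgebra.counit
  map_left a t := by
    rw [smul_def]
    refine (rid_brMul Coalgebra.counit Coalgebra.counit hA.counit_mul
      hA.counit_eq_zero _ _).trans ?_
    rw [Coalgebra.lTensor_counit_comul, TensorProduct.rid_tmul, one_smul]
    rfl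
  map_right a t := by
    rw [op_smul_def]
    refine (rid_brMul Coalgebra.counit Coalgebra.counit hA.counit_mul
      hA.counit_eq_zero _ _).trans ?_
    rw [Coalgebra.lTensor_counit_comul, TensorProduct.rid_tmul, one_smul]
    rfl

variable (hA hN) in
/-- The map `ε ⊗ id : A ⊗ N → N`. -/
def counitLeft : BimodHom k A (TwTensor hA hA.isYDBimodule hN) N where
  toLin := (TensorProduct.lid k N).toLinearMap ∘ₗ LinearMap.rTensor N Coalgebra.counit
  map_left a t := by
    rw [smul_def]
    refine (lid_brMul Coalgebra.counit Coalgebra.counit hA.counit_mul hA.counit_act _ _).trans ?_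
    rw [Coalgebra.rTensor_counit_comul, TensorProduct.lid_tmul, one_smul]
    rfl
  map_right a t := by
    rw [op_smul_def]
    refine (lid_brMul Coalgebra.counit Coalgebra.counit hA.counit_mul hA.counit_act _ _).trans ?_
    rw [Coalgebra.rTensor_counit_comul, TensorProduct.lid_tmul, one_smul]
    rfl

/-- For morphisms `ρ : M → M ⊗ A` and `l : N → A ⊗ N`, the morphism `M ⊗_A N → M ⊗ N` which maps
`x ⊗ y` to the braided product of `ρ x` and `l y`. -/
def mulRL (ρ : BimodHom k A M (TwTensor hA hM hA.isYDBimodule))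
    (l : BimodHom k A N (TwTensor hA hA.isYDBimodule hN)) :
    BimodHom k A (TensorOver k A M N) (TwTensor hA hM hN) := by
  refine TensorOver.bimodHomOfMk (TensorOver.desc (TensorProduct.lift
      ((brMul YA YA (rightMul k A M) (leftMul k A N)).compl₁₂ ρ.toLin l.toLin)) fun x a y => ?_)
    (fun a x y => ?_) (fun a x y => ?_)
  · change brMul YA YA (rightMul k A M) (leftMul k A N) (ρ.toLin (op a • x)) (l.toLin y) =
      brMul YA YA (rightMul k A M) (leftMul k A N) (ρ.toLin x) (l.toLin (a • y))
    rw [ρ.map_right, l.map_left, op_smul_def, smul_def]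
    exact brMul_assoc (fun x a b => (mul_smul (op b) (op a) x).symm) (fun a b y => mul_smul a b y)
      (fun g h x hx y hy => hA.isYDBimodule.op_smul_mem hx hy) hA.isYDBimodule.act_smul _ _ _
  · change brMul YA YA (rightMul k A M) (leftMul k A N) (ρ.toLin (a • x)) (l.toLin y) =
      brMul YA YM (leftMul k A M) (leftMul k A N) (Coalgebra.comul a)
        (brMul YA YA (rightMul k A M) (leftMul k A N) (ρ.toLin x) (l.toLin y))
    rw [ρ.map_left, smul_def]
    exact brMul_assoc (fun a x b => (smul_comm a (op b) x).symm) (fun a b y => mul_smul a b y)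
      (fun g h x hx y hy => hA.isYDBimodule.smul_mem hx hy) (fun g x a => hM.act_op_smul g a x)
      _ _ _
  · change brMul YA YA (rightMul k A M) (leftMul k A N) (ρ.toLin x) (l.toLin (op a • y)) =
      brMul YN YA (rightMul k A M) (rightMul k A N)
        (brMul YA YA (rightMul k A M) (leftMul k A N) (ρ.toLin x) (l.toLin y)) (Coalgebra.comul a)
    rw [l.map_right, op_smul_def]
    exact (brMul_assoc (fun x a b => (mul_smul (op b) (op a) x).symm)
      (fun a x b => (smul_comm a (op b) x).symm)
      (fun g h x hx y hy => hN.smul_mem hx hy) (fun g x a => hA.isYDBimodule.act_op_smul g a x)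
      _ _ _).symm

theorem mulRL_mk (ρ : BimodHom k A M (TwTensor hA hM hA.isYDBimodule))
    (l : BimodHom k A N (TwTensor hA hA.isYDBimodule hN)) (x : M) (y : N) :
    (mulRL ρ l).toLin (TensorOver.mk k A M N (x ⊗ₜ y)) =
      brMul YA YA (rightMul k A M) (leftMul k A N) (ρ.toLin x) (l.toLin y) := rfl

/-- For morphisms `l : N → A ⊗ N` and `ρ : M → M ⊗ A`, the morphism `N ⊗_A M → M ⊗ N` which maps
`x ⊗ y` to the braided product of `l x` and `ρ y`. -/
def mulLR (l : BimodHom k A N (TwTensor hA hA.isYDBimodule hN))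
    (ρ : BimodHom k A M (TwTensor hA hM hA.isYDBimodule)) :
    BimodHom k A (TensorOver k A N M) (TwTensor hA hM hN) := by
  refine TensorOver.bimodHomOfMk (TensorOver.desc (TensorProduct.lift
      ((brMul YN YM (leftMul k A M) (rightMul k A N)).compl₁₂ l.toLin ρ.toLin)) fun x a y => ?_)
    (fun a x y => ?_) (fun a x y => ?_)
  · change brMul YN YM (leftMul k A M) (rightMul k A N) (l.toLin (op a • x)) (ρ.toLin y) =
      brMul YN YM (leftMul k A M) (rightMul k A N) (l.toLin x) (ρ.toLin (a • y))
    rw [l.map_right, ρ.map_left, op_smul_def, smul_def]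
    exact brMul_assoc (fun a b y => mul_smul a b y) (fun x a b => (mul_smul (op b) (op a) x).symm)
      (fun g h x hx y hy => hN.op_smul_mem hx hy) hM.act_smul _ _ _
  · change brMul YN YM (leftMul k A M) (rightMul k A N) (l.toLin (a • x)) (ρ.toLin y) =
      brMul YA YM (leftMul k A M) (leftMul k A N) (Coalgebra.comul a)
        (brMul YN YM (leftMul k A M) (rightMul k A N) (l.toLin x) (ρ.toLin y))
    rw [l.map_left, smul_def]
    exact brMul_assoc (fun a b y => mul_smul a b y) (fun a x b => (smul_comm a (op b) x).symm)
      (fun g h x hx y hy => hN.smul_mem hx hy) hM.act_smul _ _ _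
  · change brMul YN YM (leftMul k A M) (rightMul k A N) (l.toLin x) (ρ.toLin (op a • y)) =
      brMul YN YA (rightMul k A M) (rightMul k A N)
        (brMul YN YM (leftMul k A M) (rightMul k A N) (l.toLin x) (ρ.toLin y)) (Coalgebra.comul a)
    rw [ρ.map_right, op_smul_def]
    exact (brMul_assoc (fun a x b => (smul_comm a (op b) x).symm)
      (fun x a b => (mul_smul (op b) (op a) x).symm)
      (fun g h x hx y hy => hN.op_smul_mem hx hy) (fun g x a => hM.act_op_smul g a x)
      _ _ _).symm

theorem mulLR_mk (l : BimodHom k A N (TwTensor hA hA.isYDBimodule hN))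
    (ρ : BimodHom k A M (TwTensor hA hM hA.isYDBimodule)) (x : N) (y : M) :
    (mulLR l ρ).toLin (TensorOver.mk k A N M (x ⊗ₜ y)) =
      brMul YN YM (leftMul k A M) (rightMul k A N) (l.toLin x) (ρ.toLin y) := rfl

variable {M' N' : Type*} [AddCommGroup M'] [Module k M'] [Module A M'] [Module Aᵐᵒᵖ M']
  [IsScalarTower k A M'] [IsScalarTower k Aᵐᵒᵖ M'] [SMulCommClass A Aᵐᵒᵖ M']
  [AddCommGroup N'] [Module k N'] [Module A N'] [Module Aᵐᵒᵖ N']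
  [IsScalarTower k A N'] [IsScalarTower k Aᵐᵒᵖ N'] [SMulCommClass A Aᵐᵒᵖ N']
  {YM' : YetterDrinfeld k G M'} {YN' : YetterDrinfeld k G N'}
  {hM' : IsYDBimodule YA YM'} {hN' : IsYDBimodule YA YN'}

theorem map_mulRL {ρ : BimodHom k A M (TwTensor hA hM hA.isYDBimodule)}
    {l : BimodHom k A N (TwTensor hA hA.isYDBimodule hN)}
    {ρ' : BimodHom k A M' (TwTensor hA hM' hA.isYDBimodule)}
    {l' : BimodHom k A N' (TwTensor hA hA.isYDBimodule hN')} (f : BimodHom k A M M')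
    (g : BimodHom k A N N')
    (hρ : ∀ x, LinearMap.rTensor A f.toLin (ρ.toLin x) = ρ'.toLin (f.toLin x))
    (hl : ∀ y, LinearMap.lTensor A g.toLin (l.toLin y) = l'.toLin (g.toLin y))
    (t : TensorOver k A M N) :
    TensorProduct.map f.toLin g.toLin ((mulRL ρ l).toLin t) =
      (mulRL ρ' l').toLin (TensorOver.map f g t) := by
  induction t using TensorOver.induction with
  | add s t hs ht =>
    rw [map_add, map_add, map_add, ← hs, ← ht]
    exact map_add _ _ _
  | tmul x y =>
    rw [TensorOver.map_mk, mulRL_mk, mulRL_mk, ← hρ, ← hl]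
    exact map_brMul f.toLin LinearMap.id LinearMap.id g.toLin (fun x a => f.map_right a x)
      g.map_left (fun _ _ h => h) (fun _ _ => rfl) _ _

theorem map_mulLR {ρ : BimodHom k A M (TwTensor hA hM hA.isYDBimodule)}
    {l : BimodHom k A N (TwTensor hA hA.isYDBimodule hN)}
    {ρ' : BimodHom k A M' (TwTensor hA hM' hA.isYDBimodule)}
    {l' : BimodHom k A N' (TwTensor hA hA.isYDBimodule hN')} (f : BimodHom k A M M')
    (g : BimodHom k A N N') (hf : YM.IsHom YM' f.toLin) (hg : YN.IsHom YN' g.toLin)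
    (hρ : ∀ x, LinearMap.rTensor A f.toLin (ρ.toLin x) = ρ'.toLin (f.toLin x))
    (hl : ∀ y, LinearMap.lTensor A g.toLin (l.toLin y) = l'.toLin (g.toLin y))
    (t : TensorOver k A N M) :
    TensorProduct.map f.toLin g.toLin ((mulLR l ρ).toLin t) =
      (mulLR l' ρ').toLin (TensorOver.map g f t) := by
  induction t using TensorOver.induction with
  | add s t hs ht =>
    rw [map_add, map_add, map_add, ← hs, ← ht]
    exact map_add _ _ _
  | tmul x y =>
    rw [TensorOver.map_mk, mulLR_mk, mulLR_mk, ← hρ, ← hl]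
    exact map_brMul LinearMap.id g.toLin f.toLin LinearMap.id f.map_left
      (fun x a => g.map_right a x) hg.map_deg hf.map_act _ _

end TwTensor

/-! ### Cochains on `P ⊗ P` -/

section Functionals

variable {k G : Type*} [Field k] [Group G]
  {M N K L X Z : Type*} [AddCommGroup M] [Module k M] [AddCommGroup N] [Module k N]
  [AddCommGroup K] [Module k K] [AddCommGroup L] [Module k L]
  [AddCommGroup X] [Module k X] [AddCommGroup Z] [Module k Z]

/-- A tensor product `φ ⊗ γ` of multiplicative functionals is multiplicative on braided products, up
to a twist `φ₂'` of `φ₂` which accounts for the degrees on which `γ₁` is supported. -/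
theorem YetterDrinfeld.mul_map_brMul {YN : YetterDrinfeld k G N} {YK : YetterDrinfeld k G K}
    {α : M →ₗ[k] K →ₗ[k] X} {β : N →ₗ[k] L →ₗ[k] Z} {φ : X →ₗ[k] k} {γ : Z →ₗ[k] k}
    (φ₁ : M →ₗ[k] k) (φ₂ φ₂' : K →ₗ[k] k) (γ₁ : N →ₗ[k] k) (γ₂ : L →ₗ[k] k)
    (hφ : ∀ m x, φ (α m x) = φ₁ m * φ₂ x) (hγ : ∀ n l, γ (β n l) = γ₁ n * γ₂ l)
    (h : ∀ g, ∀ n ∈ YN.deg g, ∀ x, γ₁ n * φ₂ (YK.act g x) = γ₁ n * φ₂' x)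
    (s : M ⊗[k] N) (t : K ⊗[k] L) :
    LinearMap.mul' k k (TensorProduct.map φ γ (brMul YN YK α β s t)) =
      LinearMap.mul' k k (TensorProduct.map φ₁ γ₁ s) *
        LinearMap.mul' k k (TensorProduct.map φ₂' γ₂ t) := by
  induction s using YN.tmul_induction with
  | add s t hs ht => simp only [map_add, LinearMap.add_apply, hs, ht, add_mul]
  | tmul m g n hn =>
    induction t with
    | zero => simp only [map_zero, mul_zero]
    | add s t hs ht => simp only [map_add, hs, ht, mul_add]
    | tmul x l =>
      rw [brMul_tmul hn]
      simp only [TensorProduct.map_tmul, LinearMap.mul'_apply, hφ, hγ]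
      linear_combination φ₁ m * γ₂ l * h g n hn x

end Functionals

section

variable {k G A : Type*} [Field k] [Group G] [Ring A] [Algebra k A] [Coalgebra k A]
  {YA : YetterDrinfeld k G A}
  {M N : Type*} [AddCommGroup M] [Module k M] [Module A M] [Module Aᵐᵒᵖ M]
  [IsScalarTower k A M] [IsScalarTower k Aᵐᵒᵖ M] [SMulCommClass A Aᵐᵒᵖ M]
  [AddCommGroup N] [Module k N] [Module A N] [Module Aᵐᵒᵖ N]
  [IsScalarTower k A N] [IsScalarTower k Aᵐᵒᵖ N] [SMulCommClass A Aᵐᵒᵖ N]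
  {YM : YetterDrinfeld k G M} {YN : YetterDrinfeld k G N}
  {hA : IsBimonoid YA} {hM : IsYDBimodule YA YM} {hN : IsYDBimodule YA YN}

theorem mul_map_counit_comul (a : A) :
    LinearMap.mul' k k (TensorProduct.map (Coalgebra.counit (R := k) (A := A)) Coalgebra.counit
      (Coalgebra.comul (R := k) a)) = Coalgebra.counit (R := k) a := by
  have h := LinearMap.rTensor_comp_lTensor A (Coalgebra.counit (R := k) (A := A))
    (Coalgebra.counit (R := k) (A := A))
  rw [← h, LinearMap.comp_apply, Coalgebra.lTensor_counit_comul]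
  simp

variable (hA hM hN) in
/-- The map `f ⊗ g ↦ (x ⊗ y ↦ f x * g y)`. -/
def HomTriv.twTensor :
    HomTriv k A M ⊗[k] HomTriv k A N →ₗ[k] HomTriv k A (TwTensor hA hM hN) :=
  (LinearMap.compRight k (LinearMap.mul' k k) ∘ₗ
      TensorProduct.homTensorHomMap (RingHom.id k) M N k k ∘ₗ
    TensorProduct.map (HomTriv k A M).subtype (HomTriv k A N).subtype).codRestrict _ fun t => by
    induction t with
    | zero => rw [map_zero]; exact zero_mem _
    | add s t hs ht => rw [map_add]; exact add_mem hs ht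
    | tmul f g =>
      refine ⟨fun a t => ?_, fun a t => ?_⟩
      · refine (mul_map_brMul (α := leftMul k A M) (β := leftMul k A N) Coalgebra.counit
          f.1 f.1 Coalgebra.counit g.1 f.2.1 g.2.1
          (fun h n hn x => ?_) _ t).trans ?_
        · by_cases e : h = 1
          · rw [e, map_one]; rfl
          · rw [hA.counit_eq_zero h n hn e, zero_mul, zero_mul]
        · rw [mul_map_counit_comul]
          rfl
      · refine (mul_map_brMul (α := rightMul k A M) (β := rightMul k A N) f.1 Coalgebra.counit
          Coalgebra.counit g.1 Coalgebra.counit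
          (fun x a => f.2.2 a x) (fun x a => g.2.2 a x)
          (fun h n hn x => by rw [hA.counit_act]) t _).trans ?_
        rw [mul_map_counit_comul]
        rfl

theorem HomTriv.twTensor_apply (f : HomTriv k A M) (g : HomTriv k A N) (t : TwTensor hA hM hN) :
    (HomTriv.twTensor hA hM hN (f ⊗ₜ g)).1 t =
      LinearMap.mul' k k (TensorProduct.map f.1 g.1 t) := rfl

theorem HomTriv.mul_map_counit (f : HomTriv k A M) (t : TwTensor hA hM hA.isYDBimodule) :
    LinearMap.mul' k k (TensorProduct.map f.1 Coalgebra.counit t) =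
      f.1 ((TwTensor.counitRight hA hM).toLin t) := by
  change M ⊗[k] A at t
  change _ = f.1 (TensorProduct.rid k M (LinearMap.lTensor M Coalgebra.counit t))
  induction t with
  | zero => simp only [map_zero]
  | add s t hs ht => simp only [map_add, hs, ht]
  | tmul x a => simp [mul_comm]

theorem HomTriv.mul_map_counit' (g : HomTriv k A N) (t : TwTensor hA hA.isYDBimodule hN) :
    LinearMap.mul' k k (TensorProduct.map Coalgebra.counit g.1 t) =
      g.1 ((TwTensor.counitLeft hA hN).toLin t) := by
  change A ⊗[k] N at t
  change _ = g.1 (TensorProduct.lid k N (LinearMap.rTensor N Coalgebra.counit t))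
  induction t with
  | zero => simp only [map_zero]
  | add s t hs ht => simp only [map_add, hs, ht]
  | tmul x a => simp

variable (ρ : BimodHom k A M (TwTensor hA hM hA.isYDBimodule))
  (l : BimodHom k A N (TwTensor hA hA.isYDBimodule hN))

theorem HomTriv.twTensor_mulRL (f : HomTriv k A M) (g : HomTriv k A N) (t : TensorOver k A M N) :
    (HomTriv.twTensor hA hM hN (f ⊗ₜ g)).1 ((TwTensor.mulRL ρ l).toLin t) =
      (HomTriv.tensor k A M N (HomTriv.precomp ((TwTensor.counitRight hA hM).comp ρ) f ⊗ₜ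
        HomTriv.precomp ((TwTensor.counitLeft hA hN).comp l) g)).1 t := by
  induction t using TensorOver.induction with
  | add s t hs ht => rw [map_add, map_add, map_add, hs, ht]
  | tmul x y =>
    rw [HomTriv.tensor_mk, HomTriv.twTensor_apply, TwTensor.mulRL_mk]
    refine (mul_map_brMul f.1 Coalgebra.counit Coalgebra.counit Coalgebra.counit g.1
      (fun x a => f.2.2 a x) g.2.1 (fun h n hn x => by rw [hA.counit_act]) _ _).trans ?_
    exact congrArg₂ (· * ·) (HomTriv.mul_map_counit _ _) (HomTriv.mul_map_counit' _ _)

theorem HomTriv.twTensor_mulLR {hgM : IsGrading (V := HomTriv k A M) (HomTriv.deg A YM)}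
    {hgN : IsGrading (V := HomTriv k A N) (HomTriv.deg A YN)} {h : G} (f : HomTriv k A M)
    {g : HomTriv k A N} (hg : g ∈ (HomTriv.yd hA hN hgN).deg h) (t : TensorOver k A N M) :
    (HomTriv.twTensor hA hM hN (f ⊗ₜ g)).1 ((TwTensor.mulLR l ρ).toLin t) =
      (HomTriv.tensor k A N M (HomTriv.precomp ((TwTensor.counitLeft hA hN).comp l) g ⊗ₜ
        HomTriv.precomp ((TwTensor.counitRight hA hM).comp ρ)
          ((HomTriv.yd hA hM hgM).act h f))).1 t := by
  induction t using TensorOver.induction with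
  | add s t hs ht => rw [map_add, map_add, map_add, hs, ht]
  | tmul x y =>
    rw [HomTriv.tensor_mk, HomTriv.twTensor_apply, TwTensor.mulLR_mk]
    refine (mul_map_brMul Coalgebra.counit f.1 ((HomTriv.yd hA hM hgM).act h f).1 g.1
      Coalgebra.counit f.2.1 (fun x a => g.2.2 a x) (fun s n hn x => ?_) _ _).trans ?_
    · by_cases e : s = h⁻¹
      · subst e
        rfl
      · rw [hg s e n hn, zero_mul, zero_mul]
    · exact congrArg₂ (· * ·) (HomTriv.mul_map_counit' _ _) (HomTriv.mul_map_counit _ _)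

end

/-! ### Two chain maps from `P` to `P ⊗ P` -/

theorem rid_lTensor_rTensor {k M N K : Type*} [Field k] [AddCommGroup M] [Module k M]
    [AddCommGroup N] [Module k N] [AddCommGroup K] [Module k K] (f : M →ₗ[k] N) (e : K →ₗ[k] k)
    (t : M ⊗[k] K) : TensorProduct.rid k N (LinearMap.lTensor N e (LinearMap.rTensor K f t)) =
      f (TensorProduct.rid k M (LinearMap.lTensor M e t)) := by
  induction t with
  | zero => simp only [map_zero]
  | add s t hs ht => simp only [map_add, hs, ht]
  | tmul x y => simp

theorem lid_rTensor_lTensor {k M N K : Type*} [Field k] [AddCommGroup M] [Module k M]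
    [AddCommGroup N] [Module k N] [AddCommGroup K] [Module k K] (f : M →ₗ[k] N) (e : K →ₗ[k] k)
    (t : K ⊗[k] M) : TensorProduct.lid k N (LinearMap.rTensor N e (LinearMap.lTensor K f t)) =
      f (TensorProduct.lid k M (LinearMap.rTensor M e t)) := by
  induction t with
  | zero => simp only [map_zero]
  | add s t hs ht => simp only [map_add, hs, ht]
  | tmul x y => simp

namespace YDResolution

variable {k G A : Type*} [Field k] [Group G] [Ring A] [Algebra k A] [Coalgebra k A]
  {YA : YetterDrinfeld k G A}
  {P : ℕ → Type*} [∀ n, AddCommGroup (P n)] [∀ n, Module k (P n)] [∀ n, Module A (P n)]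
  [∀ n, Module Aᵐᵒᵖ (P n)] [∀ n, IsScalarTower k A (P n)] [∀ n, IsScalarTower k Aᵐᵒᵖ (P n)]
  [∀ n, SMulCommClass A Aᵐᵒᵖ (P n)] {R : YDResolution YA P} {hA : IsBimonoid YA}

/-- Chain maps `ρ : P → P ⊗ A` and `l : P → A ⊗ P` of bimodules which lift the comultiplication
of `A`. -/
structure ComulLift (R : YDResolution YA P) (hA : IsBimonoid YA) where
  ρ : ∀ n, BimodHom k A (P n) (TwTensor hA (R.isYDBimodule n) hA.isYDBimodule)
  l : ∀ n, BimodHom k A (P n) (TwTensor hA hA.isYDBimodule (R.isYDBimodule n))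
  aug_ρ : ∀ x, LinearMap.rTensor A R.aug.toLin ((ρ 0).toLin x) =
    Coalgebra.comul (R := k) (R.aug.toLin x)
  d_ρ : ∀ n x, LinearMap.rTensor A (R.d n).toLin ((ρ (n + 1)).toLin x) =
    (ρ n).toLin ((R.d n).toLin x)
  aug_l : ∀ x, LinearMap.lTensor A R.aug.toLin ((l 0).toLin x) =
    Coalgebra.comul (R := k) (R.aug.toLin x)
  d_l : ∀ n x, LinearMap.lTensor A (R.d n).toLin ((l (n + 1)).toLin x) =
    (l n).toLin ((R.d n).toLin x)

namespace ComulLift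

variable (c : ComulLift R hA)

/-- The chain map `(id ⊗ ε) ρ` from `P` to itself. -/
def right (n : ℕ) : BimodHom k A (P n) (P n) :=
  (TwTensor.counitRight hA (R.isYDBimodule n)).comp (c.ρ n)

/-- The chain map `(ε ⊗ id) l` from `P` to itself. -/
def left (n : ℕ) : BimodHom k A (P n) (P n) :=
  (TwTensor.counitLeft hA (R.isYDBimodule n)).comp (c.l n)

theorem d_right (n : ℕ) (x : P (n + 1)) :
    (R.d n).toLin ((c.right (n + 1)).toLin x) = (c.right n).toLin ((R.d n).toLin x) :=
  (rid_lTensor_rTensor (R.d n).toLin Coalgebra.counit _).symm.trans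
    (congrArg (TwTensor.counitRight hA (R.isYDBimodule n)).toLin (c.d_ρ n x))

theorem aug_right (x : P 0) : R.aug.toLin ((c.right 0).toLin x) = R.aug.toLin x := by
  refine (rid_lTensor_rTensor R.aug.toLin Coalgebra.counit _).symm.trans ?_
  rw [c.aug_ρ, Coalgebra.lTensor_counit_comul, TensorProduct.rid_tmul, one_smul]

theorem d_left (n : ℕ) (x : P (n + 1)) :
    (R.d n).toLin ((c.left (n + 1)).toLin x) = (c.left n).toLin ((R.d n).toLin x) :=
  (lid_rTensor_lTensor (R.d n).toLin Coalgebra.counit _).symm.trans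
    (congrArg (TwTensor.counitLeft hA (R.isYDBimodule n)).toLin (c.d_l n x))

theorem aug_left (x : P 0) : R.aug.toLin ((c.left 0).toLin x) = R.aug.toLin x := by
  refine (lid_rTensor_lTensor R.aug.toLin Coalgebra.counit _).symm.trans ?_
  rw [c.aug_l, Coalgebra.rTensor_counit_comul, TensorProduct.lid_tmul, one_smul]

/-- The morphism `P p ⊗_A P q → P p ⊗ P q` given by the braided product of `ρ x` and `l y`. -/
def mulRL (p q : ℕ) : BimodHom k A (TensorOver k A (P p) (P q)) (R.TwComplex hA p q) :=
  TwTensor.mulRL (c.ρ p) (c.l q)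

/-- The morphism `P q ⊗_A P p → P p ⊗ P q` given by the braided product of `l x` and `ρ y`. -/
def mulLR (p q : ℕ) : BimodHom k A (TensorOver k A (P q) (P p)) (R.TwComplex hA p q) :=
  TwTensor.mulLR (c.l q) (c.ρ p)

theorem d₁_mulRL (p q : ℕ) (t : TensorOver k A (P (p + 1)) (P q)) :
    (R.twD₁ hA p q).toLin ((c.mulRL (p + 1) q).toLin t) =
      (c.mulRL p q).toLin (TensorOver.map (R.d p) BimodHom.id t) :=
  TwTensor.map_mulRL (R.d p) BimodHom.id (c.d_ρ p)
    (fun _ => LinearMap.congr_fun (LinearMap.lTensor_id A (P q)) _) t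

theorem d₂_mulRL (p q : ℕ) (t : TensorOver k A (P p) (P (q + 1))) :
    (R.twD₂ hA p q).toLin ((c.mulRL p (q + 1)).toLin t) =
      (c.mulRL p q).toLin (TensorOver.map BimodHom.id (R.d q) t) :=
  TwTensor.map_mulRL BimodHom.id (R.d q)
    (fun _ => LinearMap.congr_fun (LinearMap.rTensor_id A (P p)) _) (c.d_l q) t

theorem d₁_mulLR (p q : ℕ) (t : TensorOver k A (P q) (P (p + 1))) :
    (R.twD₁ hA p q).toLin ((c.mulLR (p + 1) q).toLin t) =
      (c.mulLR p q).toLin (TensorOver.map BimodHom.id (R.d p) t) :=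
  TwTensor.map_mulLR (R.d p) BimodHom.id (R.d_hom p) ⟨fun _ _ => rfl, fun _ _ h => h⟩ (c.d_ρ p)
    (fun _ => LinearMap.congr_fun (LinearMap.lTensor_id A (P q)) _) t

theorem d₂_mulLR (p q : ℕ) (t : TensorOver k A (P (q + 1)) (P p)) :
    (R.twD₂ hA p q).toLin ((c.mulLR p (q + 1)).toLin t) =
      (c.mulLR p q).toLin (TensorOver.map (R.d q) BimodHom.id t) :=
  TwTensor.map_mulLR BimodHom.id (R.d q) ⟨fun _ _ => rfl, fun _ _ h => h⟩ (R.d_hom q)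
    (fun _ => LinearMap.congr_fun (LinearMap.rTensor_id A (P p)) _) (c.d_l q) t

theorem aug_mulRL (t : TensorOver k A (P 0) (P 0)) :
    TensorProduct.map R.aug.toLin R.aug.toLin ((c.mulRL 0 0).toLin t) =
      Coalgebra.comul (R := k) (R.augTensor t) := by
  refine (TwTensor.map_mulRL (ρ' := TwTensor.comul hA) (l' := TwTensor.comul hA) R.aug R.aug
    c.aug_ρ c.aug_l t).trans ?_
  rw [map_aug_aug, TwTensor.mulRL_mk]
  exact (hA.comul_mul' _ _).symm.trans (by rw [one_mul])

theorem aug_mulLR (t : TensorOver k A (P 0) (P 0)) :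
    TensorProduct.map R.aug.toLin R.aug.toLin ((c.mulLR 0 0).toLin t) =
      Coalgebra.comul (R := k) (R.augTensor t) := by
  refine (TwTensor.map_mulLR (ρ' := TwTensor.comul hA) (l' := TwTensor.comul hA) R.aug R.aug
    R.aug_hom R.aug_hom c.aug_ρ c.aug_l t).trans ?_
  rw [map_aug_aug, TwTensor.mulLR_mk]
  exact (hA.comul_mul' _ _).symm.trans (by rw [one_mul])

variable (ω : Diagonal R)

/-- The chain map `P → P ⊗ P` with components `mulRL ∘ ω`. -/
def diagRL (n : ℕ) : BimodHom k A (P n) (Tot (R.TwComplex hA) n) :=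
  BimodHom.pi fun i => (c.mulRL i.1.1 i.1.2).comp (ω.comp i.1.1 i.1.2 n i.2)

/-- The chain map `P → P ⊗ P` with components `(-1) ^ (p * q) • mulLR ∘ ω`. -/
def diagLR (n : ℕ) : BimodHom k A (P n) (Tot (R.TwComplex hA) n) :=
  BimodHom.pi fun i => bimodHomOfMem (Submodule.smul_mem _ ((-1 : k) ^ (i.1.1 * i.1.2))
    ((c.mulLR i.1.1 i.1.2).comp
      (ω.comp i.1.2 i.1.1 n ((Nat.add_comm _ _).trans i.2))).toLin_mem)

theorem diagLR_apply (p q n : ℕ) (h : p + q = n) (h' : q + p = n) (x : P n) :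
    (c.diagLR ω n).toLin x ⟨(p, q), h⟩ =
      (-1 : k) ^ (p * q) • (c.mulLR p q).toLin ((ω.comp q p n h').toLin x) := rfl

theorem dTw_diagRL (n : ℕ) (x : P (n + 1)) :
    R.dTw hA n ((c.diagRL ω (n + 1)).toLin x) = (c.diagRL ω n).toLin ((R.d n).toLin x) := by
  funext ⟨⟨p, q⟩, h⟩
  rw [totD_apply]
  refine (congrArg₂ (· + (-1 : k) ^ p • ·) (c.d₁_mulRL p q _) (c.d₂_mulRL p q _)).trans ?_
  change _ = (c.mulRL p q).toLin _
  rw [ω.comm p q n h x, map_add, map_smul]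

theorem dTw_diagLR (n : ℕ) (x : P (n + 1)) :
    R.dTw hA n ((c.diagLR ω (n + 1)).toLin x) = (c.diagLR ω n).toLin ((R.d n).toLin x) := by
  funext ⟨⟨p, q⟩, h⟩
  have h' : q + p = n := (Nat.add_comm q p).trans h
  rw [totD_apply, c.diagLR_apply ω p q n h h',
    c.diagLR_apply ω (p + 1) q (n + 1) (by omega) (by omega),
    c.diagLR_apply ω p (q + 1) (n + 1) (by omega) (by omega), map_smul, map_smul, c.d₁_mulLR,
    c.d₂_mulLR, ω.comm q p n h' x, map_add, map_smul, smul_add, smul_smul, smul_smul, ← pow_add,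
    ← pow_add, neg_one_pow_eq (m := p + p * (q + 1)) (n := p * q) p (by ring),
    show (p + 1) * q = p * q + q by ring, add_comm]

variable {V : ℕ → Type*} [∀ n, AddCommGroup (V n)] [∀ n, Module k (V n)]
  {D : ∀ n, G → Submodule k (V n)}

/-- Both chain maps `P → P ⊗ P` lift the comultiplication of `A`, so they are homotopic. -/
theorem homotopic₂_diag (hP : ∀ n, Nonempty (GradedFreeIso R n (D n))) :
    Homotopic₂ (C := fun n => HomTriv k A (P n)) R.homD
      (fun p q n h => HomTriv.precomp ((c.diagRL ω n).component ⟨(p, q), h⟩) ∘ₗ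
        HomTriv.twTensor hA (R.isYDBimodule p) (R.isYDBimodule q))
      (fun p q n h => HomTriv.precomp ((c.diagLR ω n).component ⟨(p, q), h⟩) ∘ₗ
        HomTriv.twTensor hA (R.isYDBimodule p) (R.isYDBimodule q)) := by
  refine homotopic₂_precomp hP (X := R.TwComplex hA) (fun p q => (R.twD₁ hA p q).toLin_mem)
    (fun p q => (R.twD₂ hA p q).toLin_mem) (mem_range_dTw hA hP) _ _ (c.dTw_diagRL ω)
    (c.dTw_diagLR ω) (fun x => mem_range_dTw_zero hA hP _ ?_) _ (fun p q f g t => ?_)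
    (fun p q f g t => ?_)
  · rw [Pi.sub_apply, c.diagLR_apply ω 0 0 0 rfl rfl, mul_zero, pow_zero, one_smul]
    refine (map_sub (TensorProduct.map R.aug.toLin R.aug.toLin) _ _).trans (sub_eq_zero.2 ?_)
    exact (c.aug_mulRL _).trans (c.aug_mulLR _).symm
  · rw [HomTriv.twTensor_apply, HomTriv.twTensor_apply]
    refine congrArg (LinearMap.mul' k k) ?_
    exact LinearMap.congr_fun (TensorProduct.map_comp f.1 g.1 (R.d p).toLin LinearMap.id) t
  · rw [HomTriv.twTensor_apply, HomTriv.twTensor_apply]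
    refine congrArg (LinearMap.mul' k k) ?_
    exact LinearMap.congr_fun (TensorProduct.map_comp f.1 g.1 LinearMap.id (R.d q).toLin) t

end ComulLift

theorem nonempty_comulLift (R : YDResolution YA P) (hA : IsBimonoid YA)
    {V : ℕ → Type*} [∀ n, AddCommGroup (V n)] [∀ n, Module k (V n)]
    {D : ∀ n, G → Submodule k (V n)} (hP : ∀ n, Nonempty (GradedFreeIso R n (D n))) :
    Nonempty (ComulLift R hA) := by
  obtain ⟨ρ, hρ, hρ'⟩ := exists_rightComul hA hP
  obtain ⟨l, hl, hl'⟩ := exists_leftComul hA hP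
  exact ⟨⟨ρ, l, hρ, hρ', hl, hl'⟩⟩

end YDResolution

/-! ### Braided commutativity -/

theorem YetterDrinfeld.tensor_hom_ext {k G V W Z : Type*} [Field k] [Group G] [AddCommGroup V]
    [Module k V] [AddCommMonoid W] [Module k W] [AddCommMonoid Z] [Module k Z]
    (Y : YetterDrinfeld k G V) {u v : V ⊗[k] W →ₗ[k] Z}
    (h : ∀ g, ∀ x ∈ Y.deg g, ∀ y, u (x ⊗ₜ y) = v (x ⊗ₜ y)) : u = v :=
  TensorProduct.ext' fun x y => by
    induction x using Y.induction with
    | mem g x hx => exact h g x hx y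
    | add x x' hx hx' => rw [TensorProduct.add_tmul, map_add, map_add, hx, hx']

namespace Diagonal

open YDResolution

variable {k G A : Type*} [Field k] [Group G] [Ring A] [Algebra k A] [Coalgebra k A]
  {YA : YetterDrinfeld k G A}
  {P : ℕ → Type*} [∀ n, AddCommGroup (P n)] [∀ n, Module k (P n)] [∀ n, Module A (P n)]
  [∀ n, Module Aᵐᵒᵖ (P n)] [∀ n, IsScalarTower k A (P n)] [∀ n, IsScalarTower k Aᵐᵒᵖ (P n)]
  [∀ n, SMulCommClass A Aᵐᵒᵖ (P n)] {R : YDResolution YA P} (ω : Diagonal R)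
  {V : ℕ → Type*} [∀ n, AddCommGroup (V n)] [∀ n, Module k (V n)]
  {D : ∀ n, G → Submodule k (V n)}

theorem opCup_tmul_eq_cup (p q n : ℕ) (h : p + q = n) (f : HomTriv k A (P p))
    (g : HomTriv k A (P q)) :
    opCup ω p q n h (f ⊗ₜ g) = (-1 : k) ^ (p * q) • cup ω q p n (by omega) g f := rfl

/-- The cup product is homotopic to its composition with `c.right ⊗ c.left`, which is the product
given by `diagRL`, hence to the product given by `diagLR`. For `f` of degree `h` the latter, with
the factors exchanged, is the composition of the cup product with `c.left ⊗ c.right` and with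
`f ⊗ g ↦ f ⊗ (h • g)`, and `c.left ⊗ c.right` can be removed again. -/
theorem isBraidedCommUpToHomotopy (hP : ∀ n, Nonempty (GradedFreeIso R n (D n)))
    (hA : IsBimonoid YA)
    (hgr : ∀ n, IsGrading (V := HomTriv k A (P n)) (HomTriv.deg A (R.yd n))) :
    IsBraidedCommUpToHomotopy (C := fun n => HomTriv k A (P n)) R.homD
      (fun n => HomTriv.yd hA (R.isYDBimodule n) (hgr n)) (opCup ω) := by
  obtain ⟨c⟩ := R.nonempty_comulLift hA hP
  let Y : ∀ n, YetterDrinfeld k G (HomTriv k A (P n)) :=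
    fun n => HomTriv.yd hA (R.isYDBimodule n) (hgr n)
  have hYd : ∀ n, (Y n).IsHom (Y (n + 1)) (R.homD n) := fun n =>
    HomTriv.isHom_precomp hA (R.d n) (R.d_hom n)
  -- `β (f ⊗ g) = f ⊗ (h • g)` for `f` of degree `h`
  let β : ∀ p q, HomTriv k A (P p) ⊗[k] HomTriv k A (P q) →ₗ[k]
      HomTriv k A (P p) ⊗[k] HomTriv k A (P q) := fun p q =>
    (TensorProduct.comm k _ _).toLinearMap ∘ₗ (Y p).braid (Y q)
  have hβ : ∀ p q h, ∀ f ∈ (Y p).deg h, ∀ g, β p q (f ⊗ₜ g) = f ⊗ₜ (Y q).act h g :=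
    fun p q h f hf g => by
      change TensorProduct.comm k _ _ ((Y p).braid (Y q) (f ⊗ₜ g)) = _
      rw [braid_tmul _ _ hf, TensorProduct.comm_tmul]
  have h₁ := homotopic₂_map ω hP c.right c.left c.d_right c.d_left c.aug_right c.aug_left
  have h₂ := (c.homotopic₂_diag ω hP).congr
    (g := fun p q n h => TensorProduct.lift (cup ω p q n h) ∘ₗ
      TensorProduct.map (HomTriv.precomp (c.right p)) (HomTriv.precomp (c.left q)))
    (fun p q n h => TensorProduct.ext' fun f g => Subtype.ext <| LinearMap.ext fun x =>
      (HomTriv.twTensor_mulRL (c.ρ p) (c.l q) f g _).symm) (fun _ _ _ _ => rfl)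
  have hβ₁ : ∀ p q, β (p + 1) q ∘ₗ LinearMap.rTensor (HomTriv k A (P q)) (R.homD p) =
      LinearMap.rTensor (HomTriv k A (P q)) (R.homD p) ∘ₗ β p q := fun p q => by
    refine (Y p).tensor_hom_ext fun h f hf g => ?_
    change β (p + 1) q (R.homD p f ⊗ₜ g) = LinearMap.rTensor _ (R.homD p) (β p q (f ⊗ₜ g))
    rw [hβ p q h f hf, LinearMap.rTensor_tmul, hβ (p + 1) q h _ ((hYd p).map_deg h f hf)]
  have hβ₂ : ∀ p q, β p (q + 1) ∘ₗ LinearMap.lTensor (HomTriv k A (P p)) (R.homD q) =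
      LinearMap.lTensor (HomTriv k A (P p)) (R.homD q) ∘ₗ β p q := fun p q => by
    refine (Y p).tensor_hom_ext fun h f hf g => ?_
    change β p (q + 1) (f ⊗ₜ R.homD q g) = LinearMap.lTensor _ (R.homD q) (β p q (f ⊗ₜ g))
    rw [hβ p q h f hf, LinearMap.lTensor_tmul, hβ p (q + 1) h f hf, (hYd q).map_act]
  have hLR : ∀ p q n (h : p + q = n) (h' : q + p = n), (-1 : k) ^ (p * q) •
        (HomTriv.precomp ((c.diagLR ω n).component ⟨(q, p), h'⟩) ∘ₗ
          HomTriv.twTensor hA (R.isYDBimodule q) (R.isYDBimodule p)) ∘ₗ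
        (TensorProduct.comm k (HomTriv k A (P p)) (HomTriv k A (P q))).toLinearMap =
      (TensorProduct.lift (cup ω p q n h) ∘ₗ TensorProduct.map (HomTriv.precomp (c.left p))
        (HomTriv.precomp (c.right q))) ∘ₗ β p q := fun p q n h h' => by
    refine (Y p).tensor_hom_ext fun s f hf g => Subtype.ext <| LinearMap.ext fun x => ?_
    change (-1 : k) ^ (p * q) • (HomTriv.twTensor hA _ _ (g ⊗ₜ f)).1
        ((-1 : k) ^ (q * p) • (c.mulLR q p).toLin ((ω.comp p q n h).toLin x)) =
      (TensorProduct.lift (cup ω p q n h) (TensorProduct.map (HomTriv.precomp (c.left p))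
        (HomTriv.precomp (c.right q)) (β p q (f ⊗ₜ g)))).1 x
    rw [hβ p q s f hf, map_smul, smul_smul, ← pow_add,
      neg_one_pow_eq (m := p * q + q * p) (n := 0) (p * q) (by ring), pow_zero, one_smul]
    exact HomTriv.twTensor_mulLR (hgM := hgr q) (hgN := hgr p) (c.ρ q) (c.l p) g hf _
  have h₃ := (homotopic₂_map ω hP c.left c.right c.d_left c.d_right c.aug_left c.aug_right).comp β
    hβ₁ hβ₂
  refine ((h₁.trans h₂).swap.trans (h₃.symm.congr (fun p q n h => hLR p q n h _)
    fun _ _ _ _ => rfl)).congr (fun p q n h => ?_) fun p q n h => ?_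
  · exact TensorProduct.ext' fun f g => rfl
  · refine TensorProduct.ext' fun f g => ?_
    change (-1 : k) ^ (p * q) • opCup ω q p n (by omega) ((Y p).braid (Y q) (f ⊗ₜ g)) =
      TensorProduct.lift (cup ω p q n h)
        (TensorProduct.comm k _ _ ((Y p).braid (Y q) (f ⊗ₜ g)))
    generalize (Y p).braid (Y q) (f ⊗ₜ g) = t
    induction t with
    | zero => simp only [map_zero, smul_zero]
    | add s t hs ht => rw [map_add, smul_add, map_add, map_add, hs, ht]
    | tmul g f =>
      rw [opCup_tmul_eq_cup, smul_smul, ← pow_add,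
        neg_one_pow_eq (m := p * q + q * p) (n := 0) (p * q) (by ring), pow_zero, one_smul]
      rfl

/-- The Leibniz rule for the cup product. -/
theorem homD_cup (p q n : ℕ) (h : p + q = n) (f : HomTriv k A (P p)) (g : HomTriv k A (P q)) :
    R.homD n (cup ω p q n h f g) =
      cup ω (p + 1) q (n + 1) (by omega) (R.homD p f) g +
        (-1 : k) ^ p • cup ω p (q + 1) (n + 1) (by omega) f (R.homD q g) := by
  refine Subtype.ext (LinearMap.ext fun x => ?_)
  change (HomTriv.tensor k A _ _ (f ⊗ₜ g)).1 ((ω.comp p q n h).toLin ((R.d n).toLin x)) =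
    (HomTriv.tensor k A _ _ (HomTriv.precomp (R.d p) f ⊗ₜ HomTriv.precomp BimodHom.id g)).1 _ +
    (-1 : k) ^ p •
      (HomTriv.tensor k A _ _ (HomTriv.precomp BimodHom.id f ⊗ₜ HomTriv.precomp (R.d q) g)).1 _
  rw [HomTriv.tensor_precomp, HomTriv.tensor_precomp, ω.comm, map_add, map_smul]

/-- The cochains with the opposite of the cup product form a differential graded algebra up to
homotopy. -/
theorem isHomotopyMonoid (hP : ∀ n, Nonempty (GradedFreeIso R n (D n))) (hA : IsBimonoid YA) :
    IsHomotopyMonoid (C := fun n => HomTriv k A (P n)) R.homD (opCup ω) (R.homOne hA) where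
  d_comp_d n := LinearMap.ext fun f => Subtype.ext <| LinearMap.ext fun x => by
    change f.1 ((R.d n).toLin ((R.d (n + 1)).toLin x)) = 0
    rw [R.d_d, map_zero]
  leibniz p q n h := by
    refine TensorProduct.ext' fun f g => ?_
    change R.homD n (opCup ω p q n h (f ⊗ₜ g)) =
      opCup ω (p + 1) q (n + 1) (by omega) (R.homD p f ⊗ₜ g) +
        (-1 : k) ^ p • opCup ω p (q + 1) (n + 1) (by omega) (f ⊗ₜ R.homD q g)
    rw [opCup_tmul_eq_cup, opCup_tmul_eq_cup, opCup_tmul_eq_cup, map_smul, homD_cup,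
      smul_add, smul_smul, smul_smul,
      ← pow_add, ← pow_add, show (p + 1) * q = p * q + q by ring,
      neg_one_pow_eq (m := p + p * (q + 1)) (n := p * q) p (by ring)]
    exact add_comm _ _
  d_one := Subtype.ext <| LinearMap.ext fun x => by
    change Coalgebra.counit (R := k) (R.aug.toLin ((R.d 0).toLin x)) = 0
    rw [R.aug_d, map_zero]
  one_mul := by
    refine Eq.subst (motive := fun F => Homotopic₁ (C := fun n => HomTriv k A (P n)) R.homD F
      fun _ => LinearMap.id) (funext fun n => LinearMap.ext fun f => ?_) (ω.cup_homOne hP hA)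
    change _ = opCup ω 0 n n (Nat.zero_add n) (R.homOne hA ⊗ₜ f)
    rw [opCup_tmul_eq_cup, zero_mul, pow_zero, one_smul]
    rfl
  mul_one := by
    refine Eq.subst (motive := fun F => Homotopic₁ (C := fun n => HomTriv k A (P n)) R.homD F
      fun _ => LinearMap.id) (funext fun n => LinearMap.ext fun f => ?_) (ω.homOne_cup hP hA)
    change _ = opCup ω n 0 n (Nat.add_zero n) (f ⊗ₜ R.homOne hA)
    rw [opCup_tmul_eq_cup, mul_zero, pow_zero, one_smul]
  mul_assoc := ω.homotopic₃_opCup hP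

end Diagonal

end

theorem theorem4 {k : Type*} [Field k] {G : Type*} [CommGroup G]
    {A : Type*} [Ring A] [Algebra k A] [Coalgebra k A]
    (YA : YetterDrinfeld k G A) (hA : IsBimonoid YA)
    (P : ℕ → Type*) [∀ n, AddCommGroup (P n)] [∀ n, Module k (P n)] [∀ n, Module A (P n)]
    [∀ n, Module Aᵐᵒᵖ (P n)] [∀ n, IsScalarTower k A (P n)] [∀ n, IsScalarTower k Aᵐᵒᵖ (P n)]
    [∀ n, SMulCommClass A Aᵐᵒᵖ (P n)] (R : YDResolution YA P)
    (V : ℕ → Type*) [∀ n, AddCommGroup (V n)] [∀ n, Module k (V n)]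
    [∀ n, FiniteDimensional k (V n)] (D : ∀ n, G → Submodule k (V n))
    (hD : ∀ n, IsGrading (D n)) (hP : ∀ n, Nonempty (GradedFreeIso R n (D n))) :
    Nonempty (Diagonal R) ∧
    ∃ Y : ∀ n, YetterDrinfeld k G (HomTriv k A (P n)),
      (∀ n, IsInternalHom (R.yd n) (Y n)) ∧
      (∀ n, (Y n).IsHom (Y (n + 1)) (R.homD n)) ∧
      ∀ ω : Diagonal R,
        IsHomotopyMonoid (C := fun n => HomTriv k A (P n)) R.homD
          (YDResolution.opCup ω) (R.homOne hA) ∧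
        IsBraidedCommUpToHomotopy (C := fun n => HomTriv k A (P n)) R.homD Y
          (YDResolution.opCup ω) := by
  have hgr : ∀ n, IsGrading (V := HomTriv k A (P n)) (HomTriv.deg A (R.yd n)) := fun n =>
    (hP n).some.isGrading hA (hD n)
  exact ⟨YDResolution.nonempty_diagonal hP,
    fun n => HomTriv.yd hA (R.isYDBimodule n) (hgr n),
    fun n => HomTriv.isInternalHom hA (R.isYDBimodule n) (hgr n),
    fun n => HomTriv.isHom_precomp hA (R.d n) (R.d_hom n),
    fun ω => ⟨ω.isHomotopyMonoid hP hA, ω.isBraidedCommUpToHomotopy hP hA hgr⟩⟩
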